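/- For a positive integer $n$ let $a(n)$ be the number of recursive divisors of $n$, defined by $a(n) = 1 + \sum_{m \mid n,\ m<n} a(m)$ (so that $a(1)=1$), and call $n$ pristine if $a(n) = n$. Let $d > 1$ be an odd integer. Then there are at most $d-1$ pristine numbers of the form $2^c q^d$ with $c \ge 0$ an integer and $q$ an odd prime, where $c$ and $q$ are both allowed to vary. -/

import Mathlib

open scoped BigOperators

/-- The number of recursive divisors `a(n)`: `a(n) = 1 + ∑ a(m)`, the sum being over the proper
divisors `m` of `n` (so `a(1) = 1`). -/
def numRecDivisors (n : ℕ) : ℕ :=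
  1 + ∑ m ∈ n.properDivisors.attach, numRecDivisors m.1
termination_by n
decreasing_by exact (Nat.mem_properDivisors.mp m.2).2

theorem numRecDivisors_eq (n : ℕ) :
    numRecDivisors n = 1 + ∑ m ∈ n.properDivisors, numRecDivisors m := by
  rw [numRecDivisors, Finset.sum_attach n.properDivisors numRecDivisors]

/-- A positive integer `n` is pristine (recursively perfect) if `a(n) = n`. -/
def IsPristine (n : ℕ) : Prop := 0 < n ∧ numRecDivisors n = n

open PowerSeries in
/-- `chainPoly c d` is the coefficient of `t ^ d` in `(1 + t) ^ d / (1 - t) ^ (c + 1)`. It equals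
`∑ k, choose d k * choose c k * 2 ^ (d - k)`. -/
noncomputable def chainPoly (c d : ℕ) : ℤ :=
  coeff d ((1 + X : ℤ⟦X⟧) ^ d * (invOneSubPow ℤ (c + 1)).val)

section ChainPoly
open PowerSeries

theorem one_sub_X_mul_invOneSubPow_succ (c : ℕ) :
    (1 - X : ℤ⟦X⟧) * (invOneSubPow ℤ (c + 1)).val = (invOneSubPow ℤ c).val := by
  have := one_sub_pow_mul_invOneSubPow_val_add_eq_invOneSubPow_val ℤ c 1
  simpa using this

theorem chainPoly_zero_right (c : ℕ) : chainPoly c 0 = 1 := by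
  rw [chainPoly, invOneSubPow_val_succ_eq_mk_add_choose]
  simp

theorem chainPoly_succ_succ (c d : ℕ) :
    chainPoly (c + 1) (d + 1) + chainPoly c d = chainPoly c (d + 1) + 2 * chainPoly (c + 1) d := by
  have h := one_sub_X_mul_invOneSubPow_succ (c + 1)
  unfold chainPoly
  set I := (invOneSubPow ℤ (c + 1 + 1)).val
  rw [← h]
  have e1 : coeff (d + 1) ((1 + X : ℤ⟦X⟧) ^ (d + 1) * ((1 - X) * I))
      = coeff (d + 1) ((1 + X : ℤ⟦X⟧) ^ (d + 1) * I) - coeff d ((1 + X : ℤ⟦X⟧) ^ (d + 1) * I) := by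
    rw [← coeff_succ_X_mul d, ← map_sub]; congr 1; ring
  have e2 : coeff d ((1 + X : ℤ⟦X⟧) ^ (d + 1) * I)
      = 2 * coeff d ((1 + X : ℤ⟦X⟧) ^ d * I) - coeff d ((1 + X : ℤ⟦X⟧) ^ d * ((1 - X) * I)) := by
    rw [two_mul, ← map_add, ← map_sub]; congr 1; ring
  rw [e1, e2]; ring

theorem chainPoly_zero_left (d : ℕ) : chainPoly 0 d = 2 ^ d := by
  rw [chainPoly, coeff_mul]
  have : (invOneSubPow ℤ (0 + 1)).val = PowerSeries.mk 1 := by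
    rw [invOneSubPow_val_succ_eq_mk_add_choose]; ext n; simp
  rw [this]
  have h := Finset.Nat.sum_antidiagonal_eq_sum_range_succ_mk
    (fun p : ℕ × ℕ => coeff p.1 ((1 + X : ℤ⟦X⟧) ^ d) * coeff p.2 (PowerSeries.mk (1 : ℕ → ℤ))) d
  rw [h]
  have h2 : ∀ k, coeff k ((1 + X : ℤ⟦X⟧) ^ d) = (d.choose k : ℤ) := by
    intro k
    have := Polynomial.coeff_one_add_X_pow ℤ d k
    rw [← this, ← Polynomial.coeff_coe]; simp
  simp only [h2, coeff_mk, Pi.one_apply, mul_one]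
  exact_mod_cast Nat.sum_range_choose d

theorem coeff_one_sub_sq_pow (d k : ℕ) :
    coeff k ((1 - X ^ 2 : ℤ⟦X⟧) ^ d) = if Even k then (-1) ^ (k / 2) * (d.choose (k / 2) : ℤ) else 0 := by
  have : (1 - X ^ 2 : ℤ⟦X⟧) ^ d = ∑ i ∈ Finset.range (d + 1),
      C ((-1) ^ i * (d.choose i : ℤ)) * X ^ (2 * i) := by
    rw [sub_eq_neg_add, add_pow]
    refine Finset.sum_congr rfl fun i _ => ?_
    rw [neg_pow]; simp [pow_mul]; ring
  rw [this, map_sum]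
  simp only [coeff_C_mul, coeff_X_pow]
  by_cases hk : Even k
  · obtain ⟨j, rfl⟩ := hk
    have hj : (j + j) / 2 = j := by omega
    simp only [Even.add_self, if_true, hj]
    rw [Finset.sum_eq_single j]
    · simp [two_mul]
    · intro b _ hb; rw [if_neg (by omega)]; simp
    · intro hb
      rw [Nat.choose_eq_zero_of_lt (by simpa using hb)]; simp
  · rw [if_neg hk]
    refine Finset.sum_eq_zero fun i _ => ?_
    rw [if_neg, mul_zero]
    rintro rfl; exact hk (even_two_mul i)

theorem sum_range_two_mul_ite_even (m : ℕ) (g f : ℕ → ℤ) :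
    ∑ k ∈ Finset.range (2 * m), (if Even k then g (k / 2) else 0) * f k
      = ∑ i ∈ Finset.range m, g i * f (2 * i) := by
  induction m with
  | zero => simp
  | succ m ih =>
    rw [show 2 * (m + 1) = 2 * m + 1 + 1 by ring, Finset.sum_range_succ, Finset.sum_range_succ, ih,
      Finset.sum_range_succ]
    simp

/-- Expansion in rising factorials of `c + d + 1`. -/
theorem chainPoly_eq_alternating_sum (c h : ℕ) :
    chainPoly c (2 * h + 1) = ∑ i ∈ Finset.range (h + 1),
      (-1) ^ i * ((2 * h + 1).choose i : ℤ) *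
        ((c + (2 * h + 1) + (2 * h + 1 - 2 * i)).choose (2 * h + 1 - 2 * i) : ℕ) := by
  set d := 2 * h + 1 with hd
  have key : (1 + X : ℤ⟦X⟧) ^ d * (invOneSubPow ℤ (c + 1)).val
      = (1 - X ^ 2) ^ d * (invOneSubPow ℤ (c + d + 1)).val := by
    have := one_sub_pow_mul_invOneSubPow_val_add_eq_invOneSubPow_val ℤ (c + 1) d
    rw [← this, ← mul_assoc, ← mul_pow, show c + 1 + d = c + d + 1 by ring,
      show (1 + X : ℤ⟦X⟧) * (1 - X) = 1 - X ^ 2 by ring]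
  rw [chainPoly, key, coeff_mul]
  have h1 := Finset.Nat.sum_antidiagonal_eq_sum_range_succ_mk
    (fun p : ℕ × ℕ => coeff p.1 ((1 - X ^ 2 : ℤ⟦X⟧) ^ d) * coeff p.2 (invOneSubPow ℤ (c + d + 1)).val) d
  rw [h1]
  simp only [coeff_one_sub_sq_pow]
  rw [show d.succ = 2 * (h + 1) by omega,
    sum_range_two_mul_ite_even (h + 1) (fun j => (-1) ^ j * (d.choose j : ℤ))
      (fun k => coeff (d - k) (invOneSubPow ℤ (c + d + 1)).val)]
  refine Finset.sum_congr rfl fun i hi => ?_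
  rw [invOneSubPow_val_succ_eq_mk_add_choose, coeff_mk, Nat.choose_symm_add]

end ChainPoly

theorem chainPoly_one_right (c : ℕ) : chainPoly c 1 = c + 2 := by
  have := chainPoly_eq_alternating_sum c 0
  simp at this; linarith

theorem chainPoly_three_term (c : ℕ) : ∀ n : ℕ,
    ((n : ℤ) + 2) * chainPoly c (n + 2)
      = (c + 5 + 3 * n) * chainPoly c (n + 1) - 2 * (n + 1) * chainPoly c n := by
  induction c with
  | zero => intro n; simp only [chainPoly_zero_left]; push_cast; ring
  | succ c ih =>
    intro n
    induction n with
    | zero =>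
      have h1 := chainPoly_succ_succ c 1
      have h2 := ih 0
      simp only [Nat.reduceAdd, zero_add, chainPoly_one_right, chainPoly_zero_right] at *
      push_cast at *
      linear_combination 2 * h1 + h2
    | succ n ihn =>
      have d0 := chainPoly_succ_succ c n
      have d1 := chainPoly_succ_succ c (n + 1)
      have d2 := chainPoly_succ_succ c (n + 2)
      have i0 := ih n
      have i1 := ih (n + 1)
      simp only [show n + 1 + 1 = n + 2 by ring, show n + 1 + 2 = n + 3 by ring] at *
      push_cast at *
      linear_combination 2 * ihn + ((n : ℤ) + 3) * d2 - (c + 7 + 3 * n) * d1 + (2 * n + 2) * d0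
        + i1 - i0

theorem sum_divisors_numRecDivisors {n : ℕ} (hn : n ≠ 0) :
    ∑ m ∈ n.divisors, (numRecDivisors m : ℤ) = 2 * numRecDivisors n - 1 := by
  have h := numRecDivisors_eq n
  rw [← Nat.insert_self_properDivisors hn, Finset.sum_insert Nat.self_notMem_properDivisors]
  have h' : (numRecDivisors n : ℤ) = 1 + ∑ m ∈ n.properDivisors, (numRecDivisors m : ℤ) := by
    exact_mod_cast h
  linarith

theorem sum_divisors_prime_pow_mul_prime_pow {p q : ℕ} (hp : p.Prime) (hq : q.Prime) (hpq : p ≠ q)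
    (c d : ℕ) (f : ℕ → ℤ) : ∑ m ∈ (p ^ c * q ^ d).divisors, f m
      = ∑ i ∈ Finset.range (c + 1), ∑ j ∈ Finset.range (d + 1), f (p ^ i * q ^ j) := by
  have hcop : Nat.Coprime (p ^ c) (q ^ d) :=
    Nat.Coprime.pow _ _ ((Nat.coprime_primes hp hq).2 hpq)
  rw [Nat.divisors_mul, Finset.mul_def, Finset.sum_image (fun x hx y hy h =>
    hcop.mul_injOn_divisors hx hy h), Finset.sum_product, Nat.sum_divisors_prime_pow hp]
  exact Finset.sum_congr rfl fun i _ => Nat.sum_divisors_prime_pow hq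

theorem numRecDivisors_two_primes {p q : ℕ} (hp : p.Prime) (hq : q.Prime) (hpq : p ≠ q) (c d : ℕ) :
    (numRecDivisors (p ^ c * q ^ d) : ℤ) = 2 ^ c * chainPoly c d := by
  set G : ℕ → ℕ → ℤ := fun i j => numRecDivisors (p ^ i * q ^ j) with hG
  have hS : ∀ c d, ∑ i ∈ Finset.range (c + 1), ∑ j ∈ Finset.range (d + 1), G i j = 2 * G c d - 1 := by
    intro c d
    rw [hG, ← sum_divisors_prime_pow_mul_prime_pow hp hq hpq c d (fun m => (numRecDivisors m : ℤ)),
      sum_divisors_numRecDivisors (mul_ne_zero (pow_ne_zero _ hp.ne_zero) (pow_ne_zero _ hq.ne_zero))]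
  have h00 : G 0 0 = 1 := by have := hS 0 0; simp at this; linarith
  have hc0 : ∀ c, G (c + 1) 0 = 2 * G c 0 := by
    intro c
    have h1 := hS (c + 1) 0
    have h2 := hS c 0
    rw [Finset.sum_range_succ] at h1
    simp only [zero_add, Finset.sum_range_one] at h1 h2
    linarith
  have h0d : ∀ d, G 0 (d + 1) = 2 * G 0 d := by
    intro d
    have h1 := hS 0 (d + 1)
    have h2 := hS 0 d
    simp only [zero_add, Finset.sum_range_one] at h1 h2
    rw [Finset.sum_range_succ] at h1
    linarith
  have hcd : ∀ c d, G (c + 1) (d + 1) = 2 * G c (d + 1) + 2 * G (c + 1) d - 2 * G c d := by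
    intro c d
    have h11 := hS (c + 1) (d + 1)
    have h10 := hS (c + 1) d
    have h01 := hS c (d + 1)
    have h00 := hS c d
    rw [Finset.sum_range_succ] at h11 h10
    rw [Finset.sum_range_succ _ (d + 1)] at h11
    linarith
  change G c d = _
  induction c generalizing d with
  | zero =>
    induction d with
    | zero => simp [h00, chainPoly_zero_right]
    | succ d ih => rw [h0d, ih]; simp only [chainPoly_zero_left]; ring
  | succ c ih =>
    induction d with
    | zero => rw [hc0, ih]; simp only [chainPoly_zero_right]; ring
    | succ d ihd =>
      rw [hcd, ih, ihd, ih]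
      have := chainPoly_succ_succ c d
      linear_combination (-(2 : ℤ) ^ (c + 1)) * this

/-- Partial fractions of `n! / (y (y + 1) ⋯ (y + n))`. -/
theorem sum_alternating_choose_div {K : Type*} [Field K] (n : ℕ) : ∀ y : K,
    (∀ i ≤ n, y + i ≠ 0) →
    (∑ i ∈ Finset.range (n + 1), (-1) ^ i * (n.choose i : K) / (y + i)) *
      ∏ i ∈ Finset.range (n + 1), (y + i) = n.factorial := by
  induction n with
  | zero => intro y hy; have := hy 0 le_rfl; simp at this; simp [this]
  | succ n ih =>
    intro y hy
    have h1 := ih y fun i hi => hy i (by omega)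
    have h2 := ih (y + 1) fun i hi => by
      have := hy (i + 1) (by omega); push_cast at this; rwa [add_assoc, add_comm 1 (i : K)]
    have hsum : ∑ i ∈ Finset.range (n + 1 + 1), (-1) ^ i * ((n + 1).choose i : K) / (y + i)
        = ∑ i ∈ Finset.range (n + 1), (-1) ^ i * (n.choose i : K) / (y + i)
          - ∑ i ∈ Finset.range (n + 1), (-1) ^ i * (n.choose i : K) / (y + 1 + i) := by
      rw [Finset.sum_range_succ' _ (n + 1)]
      have e1 : ∀ i ∈ Finset.range (n + 1), (-1 : K) ^ (i + 1) * ((n + 1).choose (i + 1) : K) / (y + (i + 1 : ℕ))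
          = (-1) ^ (i + 1) * (n.choose (i + 1) : K) / (y + (i + 1 : ℕ))
            - (-1) ^ i * (n.choose i : K) / (y + 1 + i) := by
        intro i _
        rw [Nat.choose_succ_succ]; push_cast
        rw [show y + 1 + (i : K) = y + (i + 1) by ring]; ring
      rw [Finset.sum_congr rfl e1, Finset.sum_sub_distrib]
      have e2 := Finset.sum_range_succ' (fun i => (-1 : K) ^ i * (n.choose i : K) / (y + i)) (n + 1)
      rw [Finset.sum_range_succ] at e2
      simp only [Nat.choose_succ_self, Nat.cast_zero, mul_zero, zero_div, add_zero] at e2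
      simp only [Nat.choose_zero_right] at e2 ⊢
      rw [e2]; push_cast; ring
    have hp1 : ∏ i ∈ Finset.range (n + 1 + 1), (y + (i : K))
        = (∏ i ∈ Finset.range (n + 1), (y + i)) * (y + (n + 1 : ℕ)) := Finset.prod_range_succ _ _
    have hp2 : ∏ i ∈ Finset.range (n + 1 + 1), (y + (i : K))
        = (∏ i ∈ Finset.range (n + 1), (y + 1 + i)) * y := by
      rw [Finset.prod_range_succ']
      simp only [Nat.cast_zero, add_zero]
      congr 1
      refine Finset.prod_congr rfl fun i _ => ?_
      push_cast; ring
    rw [hsum, sub_mul]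
    nth_rewrite 1 [hp1]
    rw [hp2, ← mul_assoc, ← mul_assoc, h1, h2, Nat.factorial_succ]
    push_cast; ring

theorem choose_add_mul_eq (x k : ℕ) (hk : 0 < k) :
    k * (x + k).choose k = (x + 1) * (x + k).choose (k - 1) := by
  obtain ⟨k, rfl⟩ : ∃ j, k = j + 1 := ⟨k - 1, by omega⟩
  have h := Nat.add_one_mul_choose_eq (x + k) k
  have h3 := Nat.choose_mul_succ_eq (x + k) k
  have : x + k + 1 - k = x + 1 := by omega
  rw [this] at h3
  simp only [Nat.add_sub_cancel]
  rw [show x + (k + 1) = x + k + 1 by ring]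
  nlinarith

/-- `c + d + 1` divides `L * chainPoly c d` once `L` clears the denominators. -/
theorem dvd_mul_chainPoly (c h L : ℕ)
    (hL : ∀ i ≤ h, 2 * h + 1 - 2 * i ∣ L * (2 * h + 1).choose i) :
    ((c + (2 * h + 1) + 1 : ℕ) : ℤ) ∣ L * chainPoly c (2 * h + 1) := by
  rw [chainPoly_eq_alternating_sum, Finset.mul_sum]
  refine Finset.dvd_sum fun i hi => ?_
  have hi' : i ≤ h := by simpa [Nat.lt_succ_iff] using hi
  obtain ⟨e, he⟩ := hL i hi'
  set k := 2 * h + 1 - 2 * i with hk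
  have h1 := choose_add_mul_eq (c + (2 * h + 1)) k (by omega)
  refine ⟨(-1) ^ i * e * ((c + (2 * h + 1) + k).choose (k - 1) : ℕ), ?_⟩
  have h1' : (k : ℤ) * ((c + (2 * h + 1) + k).choose k : ℕ)
      = ((c + (2 * h + 1) + 1 : ℕ) : ℤ) * ((c + (2 * h + 1) + k).choose (k - 1) : ℕ) := by exact_mod_cast h1
  have he' : (L : ℤ) * ((2 * h + 1).choose i : ℕ) = k * e := by exact_mod_cast he
  linear_combination ((-1) ^ i * ((c + (2 * h + 1) + k).choose k : ℕ) : ℤ) * he' + (-1) ^ i * e * h1'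

theorem chainPoly_pos_and_le_succ (d : ℕ) : ∀ c,
    1 ≤ chainPoly c d ∧ chainPoly c d ≤ chainPoly (c + 1) d := by
  induction d with
  | zero => intro c; simp [chainPoly_zero_right]
  | succ d ih =>
    intro c
    have h0 : ∀ c, chainPoly c (d + 1) ≤ chainPoly (c + 1) (d + 1) := fun c => by
      have := chainPoly_succ_succ c d
      have h1 := ih c
      have h2 := ih (c + 1)
      linarith
    refine ⟨?_, h0 c⟩
    induction c with
    | zero => rw [chainPoly_zero_left]; exact one_le_pow₀ (by norm_num)
    | succ c ihc => exact ihc.trans (h0 c)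

theorem chainPoly_lt_succ (c d : ℕ) (hd : 1 ≤ d) : chainPoly c d < chainPoly (c + 1) d := by
  obtain ⟨d, rfl⟩ : ∃ e, d = e + 1 := ⟨d - 1, by omega⟩
  have := chainPoly_succ_succ c d
  have h1 := chainPoly_pos_and_le_succ d c
  linarith

theorem chainPoly_strictMono {d : ℕ} (hd : 1 ≤ d) : StrictMono fun c => chainPoly c d :=
  strictMono_nat_of_lt_succ fun c => chainPoly_lt_succ c d hd

theorem two_pow_add_le_chainPoly (c : ℕ) {d : ℕ} (hd : 1 ≤ d) : (2 : ℤ) ^ d + c ≤ chainPoly c d := by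
  induction c with
  | zero => simp [chainPoly_zero_left]
  | succ c ih => have := chainPoly_lt_succ c d hd; push_cast; linarith

theorem lt_chainPoly (c : ℕ) {d : ℕ} (hd : 2 ≤ d) : (c : ℤ) + d + 1 < chainPoly c d := by
  have h1 := two_pow_add_le_chainPoly c (show 1 ≤ d by omega)
  have h2 : d + 1 < 2 ^ d := by
    induction d, hd using Nat.le_induction with
    | base => norm_num
    | succ d hd ih =>
      have := ih (two_pow_add_le_chainPoly c (by omega))
      rw [pow_succ]; omega
  have h3 : (d : ℤ) + 1 < 2 ^ d := by exact_mod_cast h2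
  linarith

theorem choose_cast_zmod_eq_one {q x k : ℕ} [Fact q.Prime] (hx : q ∣ x) (hk : k < q) :
    (((x + k).choose k : ℕ) : ZMod q) = 1 := by
  have h := Choose.choose_modEq_choose_mod_mul_choose_div_nat (n := x + k) (k := k) (p := q)
  have h1 : (x + k) % q = k := by
    rw [Nat.add_mod, Nat.mod_eq_zero_of_dvd hx, zero_add, Nat.mod_mod, Nat.mod_eq_of_lt hk]
  rw [h1, Nat.mod_eq_of_lt hk, Nat.div_eq_of_lt hk] at h
  have := (ZMod.natCast_eq_natCast_iff _ _ _).2 h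
  simpa using this

theorem half_alternating_sum_ne_zero {q h : ℕ} [Fact q.Prime] (hq : 2 * h + 1 < q) (h1 : 1 ≤ h) :
    ∑ i ∈ Finset.range (h + 1),
      (-1) ^ i * ((2 * h + 1).choose i : ZMod q) / ((2 * h + 1 - 2 * i : ℕ) : ZMod q) ≠ 0 := by
  intro h0
  have hne : ∀ k : ℕ, 0 < k → k < q → (k : ZMod q) ≠ 0 := fun k hk hkq h => by
    rw [ZMod.natCast_eq_zero_iff] at h
    exact absurd (Nat.le_of_dvd hk h) (by omega)
  have h2 : (2 : ZMod q) ≠ 0 := by exact_mod_cast hne 2 (by omega) (by omega)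
  set d := 2 * h + 1 with hd
  have hyi : ∀ i ≤ d, -(d : ZMod q) / 2 + i ≠ 0 := by
    intro i hi hz
    have hz' : 2 * (i : ZMod q) - d = 0 := by
      field_simp at hz; linear_combination hz
    rcases le_total (2 * i) d with hle | hle
    · refine hne (d - 2 * i) (by omega) (by omega) ?_
      rw [Nat.cast_sub hle]; push_cast; linear_combination -hz'
    · refine hne (2 * i - d) (by omega) (by omega) ?_
      rw [Nat.cast_sub hle]; push_cast; linear_combination hz'
  have key := sum_alternating_choose_div d (-(d : ZMod q) / 2) hyi
  set g : ℕ → ZMod q := fun i => (-1) ^ i * (d.choose i : ZMod q) / (-(d : ZMod q) / 2 + i) with hg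
  have hsym : ∀ i ≤ d, g (d - i) = g i := by
    intro i hi
    have e1 : (-1 : ZMod q) ^ (d - i) = - (-1) ^ i := by
      have : (-1 : ZMod q) ^ (d - i) * (-1) ^ i = -1 := by
        rw [← pow_add, Nat.sub_add_cancel hi, hd, pow_succ, pow_mul]; simp
      rcases neg_one_pow_eq_or (ZMod q) i with h | h <;> rw [h] at this ⊢
      · linear_combination this
      · linear_combination -this
    have e2 : -(d : ZMod q) / 2 + ((d - i : ℕ) : ZMod q) = -(-(d : ZMod q) / 2 + i) := by
      rw [Nat.cast_sub hi]; field_simp; ring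
    simp only [hg]
    rw [e1, e2, Nat.choose_symm hi, neg_mul, neg_div_neg_eq]
  have hhalf : ∑ i ∈ Finset.range (h + 1), g i = 0 := by
    have : ∀ i ∈ Finset.range (h + 1), g i
        = -2 * ((-1) ^ i * (d.choose i : ZMod q) / ((d - 2 * i : ℕ) : ZMod q)) := by
      intro i hi
      have hi' : i ≤ h := by simpa [Nat.lt_succ_iff] using hi
      have e : -(d : ZMod q) / 2 + i = -((d - 2 * i : ℕ) : ZMod q) / 2 := by
        rw [Nat.cast_sub (by omega)]; push_cast; field_simp; ring
      have := hne (d - 2 * i) (by omega) (by omega)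
      simp only [hg]; rw [e]; field_simp
    rw [Finset.sum_congr rfl this, ← Finset.mul_sum, h0, mul_zero]
  have hfull : ∑ i ∈ Finset.range (d + 1), g i = 0 := by
    rw [show d + 1 = (h + 1) + (h + 1) by omega, Finset.sum_range_add, hhalf, zero_add,
      ← Finset.sum_range_reflect, ← hhalf]
    refine Finset.sum_congr rfl fun i hi => ?_
    have hi' : i ≤ h := by simpa [Nat.lt_succ_iff] using hi
    rw [← hsym i (by omega)]; congr 1; omega
  rw [hfull, zero_mul] at key
  have := (Nat.Prime.dvd_factorial (Fact.out : q.Prime)).1 ((ZMod.natCast_eq_zero_iff _ _).1 key.symm)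
  omega

/-- A prime dividing both `c + d + 1` and the perfect power `chainPoly c d` is at most `d`. -/
theorem prime_le_of_dvd {c h q : ℕ} (h1 : 1 ≤ h) (hq : q.Prime)
    (hP : chainPoly c (2 * h + 1) = (q : ℤ) ^ (2 * h + 1)) (hx : q ∣ c + (2 * h + 1) + 1) :
    q ≤ 2 * h + 1 := by
  by_contra hlt
  push Not at hlt
  have := Fact.mk hq
  set d := 2 * h + 1 with hd
  set x := c + d + 1 with hxd
  set Z : ℤ := ∑ i ∈ Finset.range (h + 1), (-1) ^ i * (((d.factorial / (d - 2 * i) : ℕ) : ℤ) *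
    (d.choose i : ℕ) * ((c + d + (d - 2 * i)).choose (d - 2 * i - 1) : ℕ)) with hZ
  have hfac : ∀ i ∈ Finset.range (h + 1), (d - 2 * i) * (d.factorial / (d - 2 * i)) = d.factorial := by
    intro i hi
    have hi' : i ≤ h := by simpa [Nat.lt_succ_iff] using hi
    exact Nat.mul_div_cancel' (Nat.dvd_factorial (by omega) (by omega))
  have hmul : (d.factorial : ℤ) * (q : ℤ) ^ d = x * Z := by
    rw [← hP, hd, chainPoly_eq_alternating_sum, ← hd, hZ, Finset.mul_sum, Finset.mul_sum]
    refine Finset.sum_congr rfl fun i hi => ?_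
    have hi' : i ≤ h := by simpa [Nat.lt_succ_iff] using hi
    have e1 := hfac i hi
    have e2 := choose_add_mul_eq (c + d) (d - 2 * i) (by omega)
    set k := d - 2 * i
    have e1' : (k : ℤ) * ((d.factorial / k : ℕ) : ℤ) = (d.factorial : ℕ) := by exact_mod_cast e1
    have e2' : (k : ℤ) * ((c + d + k).choose k : ℕ) = (x : ℤ) * ((c + d + k).choose (k - 1) : ℕ) := by
      exact_mod_cast e2
    rw [← e1']
    linear_combination ((-1) ^ i * ((d.factorial / k : ℕ) : ℤ) * (d.choose i : ℕ)) * e2'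
  have hqZ : (q : ℤ) ∣ Z := by
    by_contra hnd
    have hcop : IsCoprime ((q : ℤ) ^ d) Z :=
      ((Nat.prime_iff_prime_int.1 hq).coprime_iff_not_dvd.2 hnd).pow_left
    have hdv : (q : ℤ) ^ d ∣ (x : ℤ) := hcop.dvd_of_dvd_mul_right ⟨_, by rw [← hmul]; ring⟩
    have := Int.le_of_dvd (by rw [hxd]; positivity) hdv
    have h2 := lt_chainPoly c (show 2 ≤ d by omega)
    rw [hP] at h2
    rw [hxd] at this; push_cast at this
    linarith
  have hz0 : (Z : ZMod q) = 0 := (ZMod.intCast_zmod_eq_zero_iff_dvd _ _).2 hqZ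
  refine half_alternating_sum_ne_zero (q := q) (h := h) hlt h1 ?_
  have hdf : (d.factorial : ZMod q) ≠ 0 := by
    rw [Ne, ZMod.natCast_eq_zero_iff, hq.dvd_factorial]; omega
  have : (d.factorial : ZMod q) * ∑ i ∈ Finset.range (h + 1),
      (-1) ^ i * (d.choose i : ZMod q) / ((d - 2 * i : ℕ) : ZMod q) = Z := by
    rw [hZ, Finset.mul_sum]
    simp only [Int.cast_sum, Int.cast_mul, Int.cast_pow, Int.cast_neg, Int.cast_one, Int.cast_natCast]
    refine Finset.sum_congr rfl fun i hi => ?_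
    have hi' : i ≤ h := by simpa [Nat.lt_succ_iff] using hi
    have e1 := hfac i hi
    set k := d - 2 * i with hk
    have e3 : (((c + d + k).choose (k - 1) : ℕ) : ZMod q) = 1 := by
      rw [show c + d + k = x + (k - 1) by omega]
      exact choose_cast_zmod_eq_one hx (by omega)
    have hk0 : (k : ZMod q) ≠ 0 := by
      rw [Ne, ZMod.natCast_eq_zero_iff]
      intro h; exact absurd (Nat.le_of_dvd (by omega) h) (by omega)
    have e1' : (k : ZMod q) * ((d.factorial / k : ℕ) : ZMod q) = (d.factorial : ZMod q) := by
      rw [← Nat.cast_mul, e1]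
    rw [e3, ← e1']
    field_simp
  rw [hz0] at this
  exact (mul_eq_zero.1 this).resolve_left hdf

section Roots
open Polynomial

/-- The polynomial `n! * chainPoly c n` in the variable `c`, given by its three-term recurrence. -/
noncomputable def monicChain : ℕ → ℝ[X]
  | 0 => 1
  | 1 => X + C 2
  | n + 2 => (X + C (5 + 3 * (n : ℝ))) * monicChain (n + 1) - C (2 * ((n : ℝ) + 1) ^ 2) * monicChain n

theorem monicChain_add_two (n : ℕ) : monicChain (n + 2) =
    (X + C (5 + 3 * (n : ℝ))) * monicChain (n + 1) - C (2 * ((n : ℝ) + 1) ^ 2) * monicChain n := by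
  rw [monicChain]

theorem monicChain_monic_natDegree (n : ℕ) :
    (monicChain n).Monic ∧ (monicChain n).natDegree = n := by
  induction n using Nat.twoStepInduction with
  | zero => simp [monicChain]
  | one => exact ⟨monic_X_add_C 2, natDegree_X_add_C 2⟩
  | more n h0 h1 =>
    rw [monicChain_add_two]
    have hm : ((X + C (5 + 3 * (n : ℝ))) * monicChain (n + 1)).Monic := (monic_X_add_C _).mul h1.1
    have hn : ((X + C (5 + 3 * (n : ℝ))) * monicChain (n + 1)).natDegree = n + 2 := by
      rw [(monic_X_add_C _).natDegree_mul h1.1, natDegree_X_add_C, h1.2]; ring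
    have hlt : (C (2 * ((n : ℝ) + 1) ^ 2) * monicChain n).degree
        < ((X + C (5 + 3 * (n : ℝ))) * monicChain (n + 1)).degree := by
      rw [degree_C_mul (by positivity), degree_eq_natDegree hm.ne_zero, hn, degree_eq_natDegree h0.1.ne_zero, h0.2]
      exact_mod_cast (by omega : n < n + 2)
    refine ⟨hm.sub_of_left hlt, ?_⟩
    rw [natDegree_eq_of_degree_eq (degree_sub_eq_left_of_degree_lt hlt), hn]

theorem eval_monicChain_natCast (n c : ℕ) :
    (monicChain n).eval (c : ℝ) = n.factorial * (chainPoly c n : ℝ) := by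
  induction n using Nat.twoStepInduction with
  | zero => simp [monicChain, chainPoly_zero_right]
  | one => simp [monicChain, chainPoly_one_right]
  | more n h0 h1 =>
    have h := chainPoly_three_term c n
    have h' : ((n : ℝ) + 2) * chainPoly c (n + 2)
        = (c + 5 + 3 * n) * chainPoly c (n + 1) - 2 * (n + 1) * chainPoly c n := by exact_mod_cast h
    rw [monicChain_add_two]
    simp only [eval_sub, eval_mul, eval_add, eval_X, eval_C, h0, h1]
    rw [Nat.factorial_succ (n + 1), Nat.factorial_succ n]
    push_cast
    linear_combination -((n + 1 : ℝ) * n.factorial) * h'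

theorem eval_monicChain_pos {n : ℕ} {y : ℝ} (hy : -1 ≤ y) : 0 < (monicChain n).eval y := by
  have key : ∀ n : ℕ, 0 < (monicChain n).eval y ∧
      (n + 1) * (monicChain n).eval y ≤ (monicChain (n + 1)).eval y := by
    intro n
    induction n with
    | zero => simp [monicChain]; linarith
    | succ n ih =>
      obtain ⟨h1, h2⟩ := ih
      have h3 : 0 < (monicChain (n + 1)).eval y := lt_of_lt_of_le (by positivity) h2
      refine ⟨h3, ?_⟩
      rw [monicChain_add_two]
      simp only [eval_sub, eval_mul, eval_add, eval_X, eval_C]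
      push_cast
      nlinarith [mul_le_mul_of_nonneg_left h2 (by positivity : (0 : ℝ) ≤ 2 * (n + 1)),
        mul_nonneg (by linarith : 0 ≤ y + 1) h3.le]
  exact (key n).1

theorem neg_one_pow_mul_eval_monicChain_pos {d : ℕ} (hd : 2 ≤ d) {y : ℝ}
    (hy : (35 * d - 14) / 6 ≤ y) : 0 < (-1) ^ d * (monicChain d).eval (-y) := by
  have hd' : (2 : ℝ) ≤ d := by exact_mod_cast hd
  have key : ∀ n : ℕ, n + 1 ≤ d → 0 < (-1) ^ n * (monicChain n).eval (-y) ∧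
      3 / 2 * (n + 1) * ((-1) ^ n * (monicChain n).eval (-y))
        ≤ (-1) ^ (n + 1) * (monicChain (n + 1)).eval (-y) := by
    intro n
    induction n with
    | zero => intro _; simp [monicChain]; linarith
    | succ n ih =>
      intro hn
      obtain ⟨h1, h2⟩ := ih (by omega)
      have h3 : 0 < (-1) ^ (n + 1) * (monicChain (n + 1)).eval (-y) :=
        lt_of_lt_of_le (by positivity) h2
      refine ⟨h3, ?_⟩
      have hn' : (n : ℝ) + 2 ≤ d := by exact_mod_cast hn
      rw [monicChain_add_two]
      simp only [eval_sub, eval_mul, eval_add, eval_X, eval_C]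
      set u := (-1) ^ n * (monicChain n).eval (-y) with hu
      set w := (-1) ^ (n + 1) * (monicChain (n + 1)).eval (-y) with hw
      have e : (-1) ^ (n + 1 + 1) * ((-y + (5 + 3 * (n : ℝ))) * (monicChain (n + 1)).eval (-y)
          - 2 * ((n : ℝ) + 1) ^ 2 * (monicChain n).eval (-y))
          = (y - 5 - 3 * n) * w - 2 * (n + 1) ^ 2 * u := by
        rw [hu, hw]; ring
      rw [e]; push_cast
      have h4 : 35 * n + 56 ≤ 6 * y := by linarith
      nlinarith [mul_le_mul_of_nonneg_left h2 (by positivity : (0 : ℝ) ≤ 4 / 3 * (n + 1)),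
        mul_nonneg (by linarith : 0 ≤ 6 * y - (35 * n + 56)) h3.le]
  obtain ⟨d, rfl⟩ : ∃ e, d = e + 1 := ⟨d - 1, by omega⟩
  obtain ⟨h1, h2⟩ := key d le_rfl
  exact lt_of_lt_of_le (by positivity) h2

theorem aeval_monicChain_ne_zero_of_im_pos {z : ℂ} (hz : 0 < z.im) (n : ℕ) :
    aeval z (monicChain n) ≠ 0 := by
  have key : ∀ n : ℕ, aeval z (monicChain n) ≠ 0 ∧
      0 < (aeval z (monicChain (n + 1)) / aeval z (monicChain n)).im := by
    intro n
    induction n with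
    | zero => simp [monicChain, hz]
    | succ n ih =>
      obtain ⟨h1, h2⟩ := ih
      have h3 : aeval z (monicChain (n + 1)) ≠ 0 := by
        intro h; rw [h] at h2; simp at h2
      refine ⟨h3, ?_⟩
      set w := aeval z (monicChain (n + 1)) / aeval z (monicChain n) with hw
      have hw0 : w ≠ 0 := div_ne_zero h3 h1
      have e : aeval z (monicChain (n + 1 + 1)) / aeval z (monicChain (n + 1))
          = z + ((5 + 3 * n : ℝ) : ℂ) - ((2 * (n + 1) ^ 2 : ℝ) : ℂ) * w⁻¹ := by
        rw [monicChain_add_two, hw]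
        simp only [map_sub, map_mul, map_add, aeval_X, aeval_C, Complex.coe_algebraMap]
        field_simp
        push_cast
        ring
      rw [e, Complex.sub_im, Complex.add_im, Complex.ofReal_im, Complex.im_ofReal_mul,
        Complex.inv_im]
      have : 0 < 2 * ((n : ℝ) + 1) ^ 2 * (w.im / Complex.normSq w) :=
        mul_pos (by positivity) (div_pos h2 (Complex.normSq_pos.2 hw0))
      rw [neg_div]; linarith
  exact (key n).1

theorem im_eq_zero_of_aeval_monicChain_eq_zero {z : ℂ} {n : ℕ}
    (h : aeval z (monicChain n) = 0) : z.im = 0 := by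
  rcases lt_trichotomy z.im 0 with h1 | h1 | h1
  · refine absurd ?_ (aeval_monicChain_ne_zero_of_im_pos (z := (starRingEnd ℂ) z) (by simpa using h1) n)
    rw [aeval_conj, h, map_zero]
  · exact h1
  · exact absurd h (aeval_monicChain_ne_zero_of_im_pos h1 n)

theorem exists_monicChain_eq_prod (n : ℕ) :
    ∃ θ : Fin n → ℝ, monicChain n = ∏ i, (X + C (θ i)) := by
  obtain ⟨hm, hdeg⟩ := monicChain_monic_natDegree n
  set q := (monicChain n).map Complex.ofRealHom with hq
  have hqm : q.Monic := hm.map _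
  have hs := IsAlgClosed.splits q
  have hprod : q = (q.roots.map fun a => X - C a).prod := hs.eq_prod_roots_of_monic hqm
  have hcard : q.roots.card = n := by
    rw [← hs.natDegree_eq_card_roots, hq, natDegree_map_eq_of_injective Complex.ofRealHom.injective, hdeg]
  have hreal : ∀ z ∈ q.roots, z.im = 0 := by
    intro z hz
    have : q.eval z = 0 := (mem_roots'.1 hz).2
    refine im_eq_zero_of_aeval_monicChain_eq_zero (n := n) ?_
    rw [hq, eval_map] at this
    rw [aeval_def]; exact this
  set l := q.roots.toList with hl
  have hll : l.length = n := by rw [hl, Multiset.length_toList, hcard]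
  refine ⟨fun i => -(l.get (i.cast hll.symm)).re, ?_⟩
  apply map_injective Complex.ofRealHom Complex.ofRealHom.injective
  rw [← hq, Polynomial.map_prod, hprod, ← Multiset.coe_toList q.roots, ← hl, Multiset.map_coe, Multiset.prod_coe]
  rw [← Fin.prod_univ_fun_getElem l]
  refine Fintype.prod_equiv (finCongr hll) _ _ fun i => ?_
  have hi : (l.get i).im = 0 := hreal _ (by rw [← Multiset.mem_toList]; exact List.get_mem l i)
  have : ((l.get i).re : ℂ) = l.get i := Complex.ext rfl hi.symm
  simp only [Polynomial.map_add, map_X, map_C, finCongr_apply, Fin.cast_cast, Fin.cast_eq_self]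
  simp only [Complex.ofRealHom_eq_coe, Complex.ofReal_neg, this]
  rw [C_neg, sub_eq_add_neg, List.get_eq_getElem]

/-- Newton's identities for the first three coefficients of `∏ (1 + θ i * X)`. -/
theorem coeff_prod_one_add_C_mul_X {ι : Type*} (s : Finset ι) (θ : ι → ℝ) :
    (∏ i ∈ s, (1 + C (θ i) * X)).coeff 0 = 1 ∧
    (∏ i ∈ s, (1 + C (θ i) * X)).coeff 1 = ∑ i ∈ s, θ i ∧
    (∏ i ∈ s, (1 + C (θ i) * X)).coeff 2 = ((∑ i ∈ s, θ i) ^ 2 - ∑ i ∈ s, θ i ^ 2) / 2 ∧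
    (∏ i ∈ s, (1 + C (θ i) * X)).coeff 3 = ((∑ i ∈ s, θ i) ^ 3
      - 3 * (∑ i ∈ s, θ i) * (∑ i ∈ s, θ i ^ 2) + 2 * ∑ i ∈ s, θ i ^ 3) / 6 := by
  classical
  induction s using Finset.induction_on with
  | empty => simp [coeff_one]
  | insert a s ha ih =>
    obtain ⟨h0, h1, h2, h3⟩ := ih
    simp only [Finset.prod_insert ha, Finset.sum_insert ha, add_mul, one_mul, coeff_add, mul_assoc,
      coeff_C_mul]
    refine ⟨by simp [h0], ?_, ?_, ?_⟩
    · rw [coeff_X_mul, h1, h0]; ring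
    · rw [coeff_X_mul, h2, h1]; ring
    · rw [coeff_X_mul, h3, h2]; ring

/-- The reversal `t ^ n * monicChain n (1 / t)`. -/
noncomputable def revChain : ℕ → ℝ[X]
  | 0 => 1
  | 1 => 1 + C 2 * X
  | n + 2 => (1 + C (5 + 3 * (n : ℝ)) * X) * revChain (n + 1)
      - C (2 * ((n : ℝ) + 1) ^ 2) * X ^ 2 * revChain n

theorem revChain_add_two (n : ℕ) : revChain (n + 2) =
    (1 + C (5 + 3 * (n : ℝ)) * X) * revChain (n + 1)
      - C (2 * ((n : ℝ) + 1) ^ 2) * X ^ 2 * revChain n := by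
  rw [revChain]

theorem eval_revChain {t : ℝ} (ht : t ≠ 0) (n : ℕ) :
    (revChain n).eval t = t ^ n * (monicChain n).eval t⁻¹ := by
  induction n using Nat.twoStepInduction with
  | zero => simp [revChain, monicChain]
  | one => simp [revChain, monicChain]; field_simp
  | more n h0 h1 =>
    rw [revChain_add_two, monicChain_add_two]
    simp only [eval_sub, eval_mul, eval_add, eval_X, eval_C, eval_one, eval_pow, h0, h1]
    field_simp
    ring

theorem coeff_revChain (n : ℕ) :
    (revChain n).coeff 0 = 1 ∧ (revChain n).coeff 1 = n / 2 + 3 * n ^ 2 / 2 ∧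
    (revChain n).coeff 2 = -n / 12 + 3 * n ^ 2 / 8 - 17 * n ^ 3 / 12 + 9 * n ^ 4 / 8 ∧
    (revChain n).coeff 3 = 29 * n ^ 2 / 24 - 61 * n ^ 3 / 16 + 227 * n ^ 4 / 48 - 43 * n ^ 5 / 16
      + 9 * n ^ 6 / 16 := by
  induction n using Nat.twoStepInduction with
  | zero => simp [revChain, coeff_one]
  | one =>
    simp [revChain, coeff_one, coeff_X]
    norm_num
  | more n h0 h1 =>
    obtain ⟨a0, a1, a2, a3⟩ := h0
    obtain ⟨b0, b1, b2, b3⟩ := h1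
    have hx2 : ∀ m (q : ℝ[X]), (X ^ 2 * q).coeff (m + 2) = q.coeff m := fun m q => by
      rw [pow_two, mul_assoc, coeff_X_mul, coeff_X_mul]
    have hx20 : ∀ (q : ℝ[X]), (X ^ 2 * q).coeff 0 = 0 := fun q => by simp
    have hx21 : ∀ (q : ℝ[X]), (X ^ 2 * q).coeff 1 = 0 := fun q => by
      rw [pow_two, mul_assoc, coeff_X_mul]; simp
    rw [revChain_add_two]
    simp only [add_mul, one_mul, coeff_add, coeff_sub, mul_assoc, coeff_C_mul]
    refine ⟨?_, ?_, ?_, ?_⟩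
    · rw [hx20, b0]; simp
    · rw [hx21, coeff_X_mul, b0, b1]; push_cast; ring
    · rw [hx2 0, coeff_X_mul, b1, b2, a0]; push_cast; ring
    · rw [hx2 1, coeff_X_mul, b2, b3, a1]; push_cast; ring

/-- The negated, centered roots of `c ↦ d! * chainPoly c d`: they are real, of known range and with
known first three moments. -/
theorem exists_centered_roots {d : ℕ} (hd : 2 ≤ d) : ∃ σ : Fin d → ℝ,
    (∀ c : ℕ, (d.factorial : ℝ) * chainPoly c d = ∏ i, ((c + (3 * d + 1) / 2 : ℝ) + σ i)) ∧
    (∀ i, -(3 * d - 1) / 2 < σ i) ∧ (∀ i, σ i < (26 * d - 17) / 6) ∧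
    ∑ i, σ i = 0 ∧ ∑ i, σ i ^ 2 = d * ((25 * d + 1) * (d - 1) / 12) ∧
    ∑ i, σ i ^ 3 = d * (3 * d * (d - 1) * (d - 2)) := by
  obtain ⟨θ, hθ⟩ := exists_monicChain_eq_prod d
  have heval : ∀ y, (monicChain d).eval y = ∏ i, (y + θ i) := fun y => by
    rw [hθ, eval_prod]; simp
  have hroot : ∀ i, (monicChain d).eval (-θ i) = 0 := fun i => by
    rw [heval]; exact Finset.prod_eq_zero (Finset.mem_univ i) (by ring)
  have hrev : revChain d = ∏ i, (1 + C (θ i) * X) := by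
    refine eq_of_infinite_eval_eq _ _ (Set.Infinite.mono ?_ (Set.Ioi_infinite (0 : ℝ)))
    intro t ht
    have ht : t ≠ 0 := ne_of_gt ht
    simp only [Set.mem_ofPred_eq]
    rw [eval_revChain ht, heval, eval_prod]
    nth_rewrite 1 [show d = Fintype.card (Fin d) by simp]
    rw [← Finset.card_univ, ← Finset.prod_const, ← Finset.prod_mul_distrib]
    refine Finset.prod_congr rfl fun i _ => ?_
    simp; field_simp
  obtain ⟨-, c1, c2, c3⟩ := coeff_prod_one_add_C_mul_X Finset.univ θ
  obtain ⟨-, e1, e2, e3⟩ := coeff_revChain d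
  rw [hrev, c1] at e1
  rw [hrev, c2, e1] at e2
  rw [hrev, c3, e1] at e3
  set S2 := ∑ i, θ i ^ 2 with hS2
  set S3 := ∑ i, θ i ^ 3 with hS3
  have f2 : S2 = d / 6 - d ^ 2 / 2 + 13 * d ^ 3 / 3 := by linear_combination -2 * e2
  have f3 : S3 = 15 * d ^ 2 / 4 - 23 * d ^ 3 / 2 + 63 * d ^ 4 / 4 := by
    rw [f2] at e3; linear_combination 3 * e3
  refine ⟨fun i => θ i - (3 * d + 1) / 2, ?_, ?_, ?_, ?_, ?_, ?_⟩
  · intro c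
    rw [← eval_monicChain_natCast, heval]
    refine Finset.prod_congr rfl fun i _ => ?_
    ring
  · intro i
    by_contra h
    have := eval_monicChain_pos (n := d) (y := -θ i) (by linarith)
    rw [hroot] at this; exact lt_irrefl _ this
  · intro i
    by_contra h
    have := neg_one_pow_mul_eval_monicChain_pos hd (y := θ i) (by linarith)
    rw [hroot] at this; simp at this
  · rw [Finset.sum_sub_distrib, e1]; simp; ring
  · have : ∀ i, (θ i - (3 * d + 1) / 2) ^ 2 = θ i ^ 2 - (3 * d + 1) * θ i + ((3 * d + 1) / 2) ^ 2 :=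
      fun i => by ring
    simp only [this]
    rw [Finset.sum_add_distrib, Finset.sum_sub_distrib, ← Finset.mul_sum, e1, ← hS2, f2]; simp; ring
  · have : ∀ i, (θ i - (3 * d + 1) / 2) ^ 3 = θ i ^ 3 - 3 * ((3 * d + 1) / 2) * θ i ^ 2
        + 3 * ((3 * d + 1) / 2) ^ 2 * θ i - ((3 * d + 1) / 2) ^ 3 :=
      fun i => by ring
    simp only [this]
    rw [Finset.sum_sub_distrib, Finset.sum_add_distrib, Finset.sum_sub_distrib, ← Finset.mul_sum,
      ← Finset.mul_sum, e1, ← hS2, ← hS3, f2, f3]; simp; ring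

end Roots

section IteratedComparison

theorem nonneg_of_hasDerivAt_nonneg {φ φ' : ℝ → ℝ} {a b : ℝ} (hab : a ≤ b)
    (h : ∀ x ∈ Set.Icc a b, HasDerivAt φ (φ' x) x) (h0 : 0 ≤ φ a)
    (hφ : ∀ x ∈ Set.Icc a b, 0 ≤ φ' x) : 0 ≤ φ b := by
  have hm : MonotoneOn φ (Set.Icc a b) := by
    refine monotoneOn_of_deriv_nonneg (convex_Icc a b)
      (fun x hx => (h x hx).continuousAt.continuousWithinAt)
      (fun x hx => (h x (interior_subset hx)).differentiableAt.differentiableWithinAt) ?_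
    intro x hx
    rw [(h x (interior_subset hx)).deriv]
    exact hφ x (interior_subset hx)
  exact h0.trans (hm (Set.left_mem_Icc.2 hab) (Set.right_mem_Icc.2 hab) hab)

theorem linear_comb_nonneg {s F G f g s' F' G' f' g' : ℝ → ℝ} {a b : ℝ} (K0 K1 K2 K3 K4 K5 : ℝ)
    (hab : a ≤ b)
    (hs : ∀ x ∈ Set.Icc a b, HasDerivAt s (s' x) x) (hF : ∀ x ∈ Set.Icc a b, HasDerivAt F (F' x) x)
    (hG : ∀ x ∈ Set.Icc a b, HasDerivAt G (G' x) x) (hf : ∀ x ∈ Set.Icc a b, HasDerivAt f (f' x) x)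
    (hg : ∀ x ∈ Set.Icc a b, HasDerivAt g (g' x) x)
    (h0 : K0 + K1 * s a + K2 * F a + K3 * G a + K4 * f a + K5 * g a = 0)
    (h1 : ∀ x ∈ Set.Icc a b,
      0 ≤ K1 * s' x + K2 * F' x + K3 * G' x + K4 * f' x + K5 * g' x) :
    0 ≤ K0 + K1 * s b + K2 * F b + K3 * G b + K4 * f b + K5 * g b := by
  refine nonneg_of_hasDerivAt_nonneg
    (φ := fun x => K0 + K1 * s x + K2 * F x + K3 * G x + K4 * f x + K5 * g x) hab (fun x hx => ?_)
    h0.ge h1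
  exact ((((((hs x hx).const_mul K1).const_add K0).add ((hF x hx).const_mul K2)).add
    ((hG x hx).const_mul K3)).add ((hf x hx).const_mul K4)).add ((hg x hx).const_mul K5)

/-- The determinant with rows `(xᵢ, yᵢ, zᵢ)`. -/
def detThree {R : Type*} [CommRing R] (x₁ y₁ z₁ x₂ y₂ z₂ x₃ y₃ z₃ : R) : R :=
  x₁ * (y₂ * z₃ - y₃ * z₂) - y₁ * (x₂ * z₃ - x₃ * z₂) + z₁ * (x₂ * y₃ - x₃ * y₂)

/-- The determinant with rows `(1, sᵢ, fᵢ, gᵢ)`. -/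
def detFour {R : Type*} [CommRing R] (s f g : Fin 4 → R) : R :=
  detThree (s 1 - s 0) (f 1 - f 0) (g 1 - g 0) (s 2 - s 0) (f 2 - f 0) (g 2 - g 0)
    (s 3 - s 0) (f 3 - f 0) (g 3 - g 0)

/-- If a combination of `2 × 2` determinants of the second-order derivatives with respect to `t ^ 2`
is nonnegative, then so is the same combination of `4 × 4` determinants. -/
theorem comb_detFour_nonneg {T c₁ c₂ : ℝ} {F G f g P Q p q U V u v : ℝ → ℝ}
    (hF : ∀ x ∈ Set.Icc 0 T, HasDerivAt F (2 * x * P x) x)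
    (hG : ∀ x ∈ Set.Icc 0 T, HasDerivAt G (2 * x * Q x) x)
    (hf : ∀ x ∈ Set.Icc 0 T, HasDerivAt f (2 * x * p x) x)
    (hg : ∀ x ∈ Set.Icc 0 T, HasDerivAt g (2 * x * q x) x)
    (hP : ∀ x ∈ Set.Icc 0 T, HasDerivAt P (U x) x)
    (hQ : ∀ x ∈ Set.Icc 0 T, HasDerivAt Q (V x) x)
    (hp : ∀ x ∈ Set.Icc 0 T, HasDerivAt p (u x) x)
    (hq : ∀ x ∈ Set.Icc 0 T, HasDerivAt q (v x) x)
    (hW : ∀ x y, 0 ≤ x → x ≤ y → y ≤ T →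
      0 ≤ c₁ * (U x * V y - U y * V x) + c₂ * (u x * v y - u y * v x))
    {t : Fin 4 → ℝ} (h0 : 0 ≤ t 0) (h1 : t 0 ≤ t 1) (h2 : t 1 ≤ t 2) (h3 : t 2 ≤ t 3)
    (h4 : t 3 ≤ T) :
    0 ≤ c₁ * detFour (fun i => t i ^ 2) (fun i => F (t i)) (fun i => G (t i))
      + c₂ * detFour (fun i => t i ^ 2) (fun i => f (t i)) (fun i => g (t i)) := by
  have hsq : ∀ x : ℝ, HasDerivAt (fun y => y ^ 2) (2 * x) x := fun x => by
    simpa using hasDerivAt_pow 2 x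
  have hid : ∀ x : ℝ, HasDerivAt (fun _ : ℝ => (0 : ℝ)) 0 x := fun x => hasDerivAt_const x 0
  have sub : ∀ {a b x : ℝ}, 0 ≤ a → b ≤ T → x ∈ Set.Icc a b → x ∈ Set.Icc 0 T :=
    fun ha hb hx => ⟨ha.trans hx.1, hx.2.trans hb⟩
  have s4 : ∀ x y z, 0 ≤ x → x ≤ y → y ≤ z → z ≤ T →
      0 ≤ c₁ * ((P y - P x) * V z - (Q y - Q x) * U z)
        + c₂ * ((p y - p x) * v z - (q y - q x) * u z) := by
    intro x y z hx hxy hyz hz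
    have sub' : ∀ w ∈ Set.Icc x y, w ∈ Set.Icc 0 T := fun w => sub hx (hyz.trans hz)
    have := linear_comb_nonneg
      (c₁ * (-P x * V z + Q x * U z) + c₂ * (-p x * v z + q x * u z)) 0
      (c₁ * V z) (-c₁ * U z) (c₂ * v z) (-c₂ * u z) hxy (fun w _ => hid w)
      (fun w hw => hP w (sub' w hw)) (fun w hw => hQ w (sub' w hw)) (fun w hw => hp w (sub' w hw))
      (fun w hw => hq w (sub' w hw)) (by ring)
      (fun w hw => by linarith [hW w z (hx.trans hw.1) (hw.2.trans hyz) hz])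
    linarith
  have s3 : ∀ x y z, 0 ≤ x → x ≤ y → y ≤ z → z ≤ T →
      0 ≤ c₁ * ((P y - P x) * (Q z - Q x) - (P z - P x) * (Q y - Q x))
        + c₂ * ((p y - p x) * (q z - q x) - (p z - p x) * (q y - q x)) := by
    intro x y z hx hxy hyz hz
    have sub' : ∀ w ∈ Set.Icc y z, w ∈ Set.Icc 0 T := fun w => sub (hx.trans hxy) hz
    have := linear_comb_nonneg
      (c₁ * ((P y - P x) * -Q x + P x * (Q y - Q x)) + c₂ * ((p y - p x) * -q x + p x * (q y - q x)))
      0 (-c₁ * (Q y - Q x)) (c₁ * (P y - P x)) (-c₂ * (q y - q x)) (c₂ * (p y - p x)) hyz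
      (fun w _ => hid w)
      (fun w hw => hP w (sub' w hw)) (fun w hw => hQ w (sub' w hw)) (fun w hw => hp w (sub' w hw))
      (fun w hw => hq w (sub' w hw)) (by ring)
      (fun w hw => by linarith [s4 x y w hx hxy hw.1 (hw.2.trans hz)])
    linarith
  have s2 : ∀ x y z w, 0 ≤ x → x ≤ y → y ≤ z → z ≤ w → w ≤ T →
      0 ≤ c₁ * detThree (y ^ 2 - x ^ 2) (F y - F x) (G y - G x) 1 (P z) (Q z) 1 (P w) (Q w)
        + c₂ * detThree (y ^ 2 - x ^ 2) (f y - f x) (g y - g x) 1 (p z) (q z) 1 (p w) (q w) := by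
    intro x y z w hx hxy hyz hzw hw
    have sub' : ∀ r ∈ Set.Icc x y, r ∈ Set.Icc 0 T := fun r => sub hx (hyz.trans (hzw.trans hw))
    have := linear_comb_nonneg
      (c₁ * detThree (-x ^ 2) (-F x) (-G x) 1 (P z) (Q z) 1 (P w) (Q w)
        + c₂ * detThree (-x ^ 2) (-f x) (-g x) 1 (p z) (q z) 1 (p w) (q w))
      (c₁ * (P z * Q w - P w * Q z) + c₂ * (p z * q w - p w * q z))
      (-c₁ * (Q w - Q z)) (c₁ * (P w - P z)) (-c₂ * (q w - q z)) (c₂ * (p w - p z)) hxy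
      (fun r _ => hsq r)
      (fun r hr => hF r (sub' r hr)) (fun r hr => hG r (sub' r hr)) (fun r hr => hf r (sub' r hr))
      (fun r hr => hg r (sub' r hr)) (by simp only [detThree]; ring)
      (fun r hr => by
        have h := mul_nonneg (by linarith [hr.1] : 0 ≤ 2 * r)
          (s3 r z w (hx.trans hr.1) (hr.2.trans hyz) hzw hw)
        linarith)
    simp only [detThree] at this ⊢
    linarith
  have s1 : ∀ x y z w, 0 ≤ x → x ≤ y → y ≤ z → z ≤ w → w ≤ T →
      0 ≤ c₁ * detThree (y ^ 2 - x ^ 2) (F y - F x) (G y - G x) (z ^ 2 - x ^ 2) (F z - F x)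
          (G z - G x) 1 (P w) (Q w)
        + c₂ * detThree (y ^ 2 - x ^ 2) (f y - f x) (g y - g x) (z ^ 2 - x ^ 2) (f z - f x)
          (g z - g x) 1 (p w) (q w) := by
    intro x y z w hx hxy hyz hzw hw
    have sub' : ∀ r ∈ Set.Icc y z, r ∈ Set.Icc 0 T := fun r => sub (hx.trans hxy) (hzw.trans hw)
    have := linear_comb_nonneg
      (c₁ * detThree (y ^ 2 - x ^ 2) (F y - F x) (G y - G x) (- x ^ 2) (- F x) (- G x) 1 (P w) (Q w)
        + c₂ * detThree (y ^ 2 - x ^ 2) (f y - f x) (g y - g x) (- x ^ 2) (- f x) (- g x) 1 (p w) (q w))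
      (-c₁ * ((F y - F x) * Q w - (G y - G x) * P w) - c₂ * ((f y - f x) * q w - (g y - g x) * p w))
      (c₁ * ((y ^ 2 - x ^ 2) * Q w - (G y - G x))) (-c₁ * ((y ^ 2 - x ^ 2) * P w - (F y - F x)))
      (c₂ * ((y ^ 2 - x ^ 2) * q w - (g y - g x))) (-c₂ * ((y ^ 2 - x ^ 2) * p w - (f y - f x))) hyz
      (fun r _ => hsq r)
      (fun r hr => hF r (sub' r hr)) (fun r hr => hG r (sub' r hr)) (fun r hr => hf r (sub' r hr))
      (fun r hr => hg r (sub' r hr)) (by simp only [detThree]; ring)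
      (fun r hr => by
        have h := mul_nonneg (by linarith [hr.1] : 0 ≤ 2 * r)
          (s2 x y r w hx hxy hr.1 (hr.2.trans hzw) hw)
        simp only [detThree] at h
        linarith)
    simp only [detThree] at this ⊢
    linarith
  have sub' : ∀ r ∈ Set.Icc (t 2) (t 3), r ∈ Set.Icc 0 T :=
    fun r => sub (h0.trans (h1.trans h2)) h4
  have e : ∀ c d e f a b : ℝ, detThree a b c d e f 1 0 0 = b * f - c * e := by
    intros; simp only [detThree]; ring
  have := linear_comb_nonneg
      (c₁ * detThree (t 1 ^ 2 - t 0 ^ 2) (F (t 1) - F (t 0)) (G (t 1) - G (t 0))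
        (t 2 ^ 2 - t 0 ^ 2) (F (t 2) - F (t 0)) (G (t 2) - G (t 0)) (-t 0 ^ 2) (-F (t 0)) (-G (t 0))
        + c₂ * detThree (t 1 ^ 2 - t 0 ^ 2) (f (t 1) - f (t 0)) (g (t 1) - g (t 0))
        (t 2 ^ 2 - t 0 ^ 2) (f (t 2) - f (t 0)) (g (t 2) - g (t 0)) (-t 0 ^ 2) (-f (t 0)) (-g (t 0)))
      (c₁ * ((F (t 1) - F (t 0)) * (G (t 2) - G (t 0)) - (F (t 2) - F (t 0)) * (G (t 1) - G (t 0)))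
       + c₂ * ((f (t 1) - f (t 0)) * (g (t 2) - g (t 0)) - (f (t 2) - f (t 0)) * (g (t 1) - g (t 0))))
      (-c₁ * ((t 1 ^ 2 - t 0 ^ 2) * (G (t 2) - G (t 0)) - (t 2 ^ 2 - t 0 ^ 2) * (G (t 1) - G (t 0))))
      (c₁ * ((t 1 ^ 2 - t 0 ^ 2) * (F (t 2) - F (t 0)) - (t 2 ^ 2 - t 0 ^ 2) * (F (t 1) - F (t 0))))
      (-c₂ * ((t 1 ^ 2 - t 0 ^ 2) * (g (t 2) - g (t 0)) - (t 2 ^ 2 - t 0 ^ 2) * (g (t 1) - g (t 0))))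
      (c₂ * ((t 1 ^ 2 - t 0 ^ 2) * (f (t 2) - f (t 0)) - (t 2 ^ 2 - t 0 ^ 2) * (f (t 1) - f (t 0)))) h3
      (fun r _ => hsq r)
      (fun r hr => hF r (sub' r hr)) (fun r hr => hG r (sub' r hr)) (fun r hr => hf r (sub' r hr))
      (fun r hr => hg r (sub' r hr)) (by simp only [detThree]; ring)
      (fun r hr => by
        have h := mul_nonneg (by linarith [hr.1] : 0 ≤ 2 * r)
          (s1 (t 0) (t 1) (t 2) r h0 h1 h2 hr.1 (hr.2.trans h4))
        simp only [detThree] at h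
        linarith)
  simp only [detFour, detThree] at this ⊢
  linarith

theorem detFour_sq_cube_four (t : Fin 4 → ℝ) :
    detFour (fun i => t i ^ 2) (fun i => t i ^ 3) (fun i => t i ^ 4) =
      (t 1 - t 0) * (t 2 - t 0) * (t 3 - t 0) * (t 2 - t 1) * (t 3 - t 1) * (t 3 - t 2) *
      (t 0 * t 1 * t 2 + t 0 * t 1 * t 3 + t 0 * t 2 * t 3 + t 1 * t 2 * t 3) := by
  simp only [detFour, detThree]; ring

/-- Comparison of a `4 × 4` determinant with rows `(1, t ^ 2, f t, g t)` to the one with rows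
`(1, t ^ 2, t ^ 3, t ^ 4)`. -/
theorem detFour_bounds {T c C : ℝ} {f g p q u v : ℝ → ℝ}
    (hf : ∀ x ∈ Set.Icc 0 T, HasDerivAt f (2 * x * p x) x)
    (hg : ∀ x ∈ Set.Icc 0 T, HasDerivAt g (2 * x * q x) x)
    (hp : ∀ x ∈ Set.Icc 0 T, HasDerivAt p (u x) x)
    (hq : ∀ x ∈ Set.Icc 0 T, HasDerivAt q (v x) x)
    (hW : ∀ x y, 0 ≤ x → x ≤ y → y ≤ T → 6 * c * (y - x) ≤ u x * v y - u y * v x ∧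
      u x * v y - u y * v x ≤ 6 * C * (y - x))
    {t : Fin 4 → ℝ} (h0 : 0 ≤ t 0) (h1 : t 0 ≤ t 1) (h2 : t 1 ≤ t 2) (h3 : t 2 ≤ t 3)
    (h4 : t 3 ≤ T) :
    c * detFour (fun i => t i ^ 2) (fun i => t i ^ 3) (fun i => t i ^ 4)
      ≤ detFour (fun i => t i ^ 2) (fun i => f (t i)) (fun i => g (t i)) ∧
    detFour (fun i => t i ^ 2) (fun i => f (t i)) (fun i => g (t i))
      ≤ C * detFour (fun i => t i ^ 2) (fun i => t i ^ 3) (fun i => t i ^ 4) := by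
  have hF : ∀ x ∈ Set.Icc 0 T, HasDerivAt (fun x : ℝ => x ^ 3) (2 * x * (3 / 2 * x)) x :=
    fun x _ => (hasDerivAt_pow 3 x).congr_deriv (by push_cast; ring)
  have hG : ∀ x ∈ Set.Icc 0 T, HasDerivAt (fun x : ℝ => x ^ 4) (2 * x * (2 * x ^ 2)) x :=
    fun x _ => (hasDerivAt_pow 4 x).congr_deriv (by push_cast; ring)
  have hP : ∀ x ∈ Set.Icc 0 T, HasDerivAt (fun x : ℝ => 3 / 2 * x) (3 / 2) x :=
    fun x _ => by simpa using (hasDerivAt_id x).const_mul (3 / 2)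
  have hQ : ∀ x ∈ Set.Icc 0 T, HasDerivAt (fun x : ℝ => 2 * x ^ 2) (4 * x) x :=
    fun x _ => ((hasDerivAt_pow 2 x).const_mul 2).congr_deriv (by push_cast; ring)
  have a1 := comb_detFour_nonneg (c₁ := -c) (c₂ := 1) hF hG hf hg hP hQ hp hq
    (fun x y hx hxy hy => by linarith [(hW x y hx hxy hy).1]) h0 h1 h2 h3 h4
  have a2 := comb_detFour_nonneg (c₁ := C) (c₂ := -1) hF hG hf hg hP hQ hp hq
    (fun x y hx hxy hy => by linarith [(hW x y hx hxy hy).2]) h0 h1 h2 h3 h4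
  constructor <;> linarith

end IteratedComparison

section Moments

/-- Real numbers with the range and the first three moments of the centered roots. -/
structure RootData (d : ℕ) (σ : Fin d → ℝ) : Prop where
  low : ∀ i, -(3 / 2 * d) ≤ σ i
  high : ∀ i, σ i ≤ 13 / 3 * d
  sum_one : ∑ i, σ i = 0
  sum_sq : ∑ i, σ i ^ 2 = d * ((25 * d + 1) * (d - 1) / 12)
  sum_cube : ∑ i, σ i ^ 3 = d * (3 * d * (d - 1) * (d - 2))

noncomputable def logMean {d : ℕ} (σ : Fin d → ℝ) (t : ℝ) : ℝ := (∑ i, Real.log (1 + σ i * t)) / d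

noncomputable def sqMean {d : ℕ} (σ : Fin d → ℝ) (t : ℝ) : ℝ := (∑ i, σ i ^ 2 / (1 + σ i * t)) / d

noncomputable def cubeMean {d : ℕ} (σ : Fin d → ℝ) (s t : ℝ) : ℝ :=
  (∑ i, σ i ^ 3 / ((1 + σ i * s) * (1 + σ i * t))) / d

/-- The mean of the squares of the centered roots. -/
noncomputable def meanSq (d : ℕ) : ℝ := (25 * d + 1) * (d - 1) / 12

/-- The mean of the cubes of the centered roots. -/
noncomputable def meanCube (d : ℕ) : ℝ := 3 * d * (d - 1) * (d - 2)

theorem RootData.mul_bounds {d : ℕ} {σ : Fin d → ℝ} (h : RootData d σ) (hd : 89 ≤ d) {t : ℝ}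
    (ht : t ∈ Set.Icc (0 : ℝ) (2.72 / d ^ 2)) (i : Fin d) :
    -0.0459 ≤ σ i * t ∧ σ i * t ≤ 0.1325 := by
  have hd' : (89 : ℝ) ≤ d := by exact_mod_cast hd
  have hT : (2.72 : ℝ) / d ^ 2 * d ≤ 2.72 / 89 := by
    rw [div_mul_eq_mul_div, div_le_div_iff₀ (by positivity) (by norm_num)]; nlinarith
  have h1 : t * d ≤ 2.72 / 89 := le_trans (mul_le_mul_of_nonneg_right ht.2 (by positivity)) hT
  have h2 := mul_le_mul_of_nonneg_right (h.low i) ht.1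
  have h3 := mul_le_mul_of_nonneg_right (h.high i) ht.1
  constructor <;> linarith

theorem mean_le {d : ℕ} (hd : 0 < d) {f : Fin d → ℝ} {a b : ℝ} {σ : Fin d → ℝ} (h : RootData d σ)
    (hf : ∀ i, f i ≤ a * σ i ^ 3 + b * σ i ^ 2) :
    (∑ i, f i) / d ≤ a * meanCube d + b * meanSq d := by
  have hd' : (0 : ℝ) < d := by exact_mod_cast hd
  rw [div_le_iff₀ hd']
  refine (Finset.sum_le_sum fun i _ => hf i).trans (le_of_eq ?_)
  rw [Finset.sum_add_distrib, ← Finset.mul_sum, ← Finset.mul_sum, h.sum_sq, h.sum_cube, meanCube,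
    meanSq]
  ring

theorem le_mean {d : ℕ} (hd : 0 < d) {f : Fin d → ℝ} {a b : ℝ} {σ : Fin d → ℝ} (h : RootData d σ)
    (hf : ∀ i, a * σ i ^ 3 + b * σ i ^ 2 ≤ f i) :
    a * meanCube d + b * meanSq d ≤ (∑ i, f i) / d := by
  have hd' : (0 : ℝ) < d := by exact_mod_cast hd
  rw [le_div_iff₀ hd']
  refine (le_of_eq ?_).trans (Finset.sum_le_sum fun i _ => hf i)
  rw [Finset.sum_add_distrib, ← Finset.mul_sum, ← Finset.mul_sum, h.sum_sq, h.sum_cube, meanCube,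
    meanSq]
  ring

theorem meanSq_bounds {d : ℕ} (hd : 89 ≤ d) :
    2.06 * (d : ℝ) ^ 2 ≤ meanSq d ∧ meanSq d ≤ 25 / 12 * (d : ℝ) ^ 2 := by
  have hd' : (89 : ℝ) ≤ d := by exact_mod_cast hd
  constructor <;> rw [meanSq] <;> nlinarith

theorem meanCube_bounds {d : ℕ} (hd : 89 ≤ d) :
    2.89 * (d : ℝ) ^ 3 ≤ meanCube d ∧ meanCube d ≤ 3 * (d : ℝ) ^ 3 := by
  have hd' : (89 : ℝ) ≤ d := by exact_mod_cast hd
  constructor <;> rw [meanCube]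
  · have : 0 ≤ (d : ℝ) * (0.11 * d ^ 2 - 9 * d + 6) := mul_nonneg (by positivity) (by nlinarith)
    nlinarith
  · have : 0 ≤ (d : ℝ) * (9 * d - 6) := mul_nonneg (by positivity) (by nlinarith)
    nlinarith

section
variable {d : ℕ} {σ : Fin d → ℝ}

theorem sqMean_bounds (h : RootData d σ) (hd : 89 ≤ d) {t : ℝ}
    (ht : t ∈ Set.Icc (0 : ℝ) (2.72 / d ^ 2)) : 0.88 * meanSq d ≤ sqMean σ t := by
  have := le_mean (a := 0) (b := 0.88) (f := fun i => σ i ^ 2 / (1 + σ i * t)) (by omega : 0 < d) h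
    fun i => by
      obtain ⟨h1, h2⟩ := h.mul_bounds hd ht i
      rw [le_div_iff₀ (by linarith)]
      nlinarith [mul_nonneg (sq_nonneg (σ i)) (by linarith : 0 ≤ 1 - 0.88 * (1 + σ i * t))]
  simpa [sqMean] using this

theorem cubeMean_le (h : RootData d σ) (hd : 89 ≤ d) {s t : ℝ}
    (hs : s ∈ Set.Icc (0 : ℝ) (2.72 / d ^ 2)) (ht : t ∈ Set.Icc (0 : ℝ) (2.72 / d ^ 2)) :
    cubeMean σ s t ≤ meanCube d := by
  have := mean_le (a := 1) (b := 0)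
    (f := fun i => σ i ^ 3 / ((1 + σ i * s) * (1 + σ i * t))) (by omega : 0 < d) h
    fun i => by
      obtain ⟨h1, h2⟩ := h.mul_bounds hd ht i
      obtain ⟨h3, h4⟩ := h.mul_bounds hd hs i
      rw [div_le_iff₀ (mul_pos (by linarith) (by linarith))]
      have e : (1 * σ i ^ 3 + 0 * σ i ^ 2) * ((1 + σ i * s) * (1 + σ i * t)) - σ i ^ 3
          = (σ i ^ 2) ^ 2 * (s * (1 + σ i * t) + t) := by ring
      have : 0 ≤ (σ i ^ 2) ^ 2 * (s * (1 + σ i * t) + t) :=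
        mul_nonneg (by positivity) (add_nonneg (mul_nonneg hs.1 (by linarith)) ht.1)
      linarith
  simpa [cubeMean] using this

theorem cubeMean_nonneg (h : RootData d σ) (hd : 89 ≤ d) {s t : ℝ}
    (hs : s ∈ Set.Icc (0 : ℝ) (2.72 / d ^ 2)) (ht : t ∈ Set.Icc (0 : ℝ) (2.72 / d ^ 2)) :
    0 ≤ cubeMean σ s t := by
  have hd' : (89 : ℝ) ≤ d := by exact_mod_cast hd
  have := le_mean (a := 1) (b := -(0.96 * d))
    (f := fun i => σ i ^ 3 / ((1 + σ i * s) * (1 + σ i * t))) (by omega : 0 < d) h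
    fun i => by
      obtain ⟨h1, h2⟩ := h.mul_bounds hd ht i
      obtain ⟨h3, h4⟩ := h.mul_bounds hd hs i
      have hp : 0 < (1 + σ i * s) * (1 + σ i * t) := mul_pos (by linarith) (by linarith)
      rw [le_div_iff₀ hp]
      set D := (1 + σ i * s) * (1 + σ i * t) with hD
      have hD1 : 0.91 ≤ D := by rw [hD]; nlinarith
      have hD2 : D ≤ 1.2826 := by rw [hD]; nlinarith
      have : 0 ≤ σ i - σ i * D + 0.96 * d * D := by
        have hl := h.low i
        have hh := h.high i
        rcases le_total 0 (σ i) with h0 | h0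
        · nlinarith
        · nlinarith
      nlinarith [mul_nonneg (sq_nonneg (σ i)) this]
  have h2 := (meanSq_bounds hd).2
  have h3 := (meanCube_bounds hd).1
  refine le_trans ?_ this
  nlinarith [mul_le_mul_of_nonneg_left h2 (by positivity : (0 : ℝ) ≤ d), pow_pos (by linarith : (0 : ℝ) < d) 3]

theorem sqMean_sub (h : RootData d σ) (hd : 89 ≤ d) {s t : ℝ}
    (hs : s ∈ Set.Icc (0 : ℝ) (2.72 / d ^ 2)) (ht : t ∈ Set.Icc (0 : ℝ) (2.72 / d ^ 2)) :
    sqMean σ s - sqMean σ t = (t - s) * cubeMean σ s t := by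
  rw [sqMean, sqMean, cubeMean, ← sub_div, ← mul_div_assoc, ← Finset.sum_sub_distrib, Finset.mul_sum]
  congr 1
  refine Finset.sum_congr rfl fun i _ => ?_
  obtain ⟨h1, -⟩ := h.mul_bounds hd ht i
  obtain ⟨h3, -⟩ := h.mul_bounds hd hs i
  have : 1 + σ i * s ≠ 0 := by linarith
  have : 1 + σ i * t ≠ 0 := by linarith
  field_simp; ring

theorem sqMean_zero (h : RootData d σ) (hd : 0 < d) : sqMean σ 0 = meanSq d := by
  have : (d : ℝ) ≠ 0 := by positivity
  simp [sqMean, h.sum_sq, meanSq, this]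

theorem sqMean_anti (h : RootData d σ) (hd : 89 ≤ d) {s t : ℝ}
    (hs : s ∈ Set.Icc (0 : ℝ) (2.72 / d ^ 2)) (ht : t ∈ Set.Icc (0 : ℝ) (2.72 / d ^ 2))
    (hst : s ≤ t) : sqMean σ t ≤ sqMean σ s := by
  have h1 := sqMean_sub h hd hs ht
  have h2 := mul_nonneg (sub_nonneg.2 hst) (cubeMean_nonneg h hd hs ht)
  linarith

theorem sqMean_le (h : RootData d σ) (hd : 89 ≤ d) {t : ℝ}
    (ht : t ∈ Set.Icc (0 : ℝ) (2.72 / d ^ 2)) : sqMean σ t ≤ meanSq d := by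
  rw [← sqMean_zero h (by omega)]
  exact sqMean_anti h hd ⟨le_rfl, by positivity⟩ ht ht.1

theorem hasDerivAt_logMean (h : RootData d σ) (hd : 89 ≤ d) {t : ℝ}
    (ht : t ∈ Set.Icc (0 : ℝ) (2.72 / d ^ 2)) :
    HasDerivAt (logMean σ) (-t * sqMean σ t) t := by
  have hi : ∀ i ∈ Finset.univ, HasDerivAt (fun t => Real.log (1 + σ i * t)) (σ i / (1 + σ i * t)) t := by
    intro i _
    obtain ⟨h1, -⟩ := h.mul_bounds hd ht i
    have : HasDerivAt (fun t => 1 + σ i * t) (σ i) t := by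
      simpa using ((hasDerivAt_id t).const_mul (σ i)).const_add 1
    exact this.log (by linarith)
  refine ((HasDerivAt.fun_sum hi).div_const (d : ℝ)).congr_deriv ?_
  rw [sqMean, ← mul_div_assoc]
  congr 1
  have e := h.sum_one
  rw [Finset.mul_sum, ← sub_eq_zero, ← Finset.sum_sub_distrib, ← e]
  refine Finset.sum_congr rfl fun i _ => ?_
  obtain ⟨h1, -⟩ := h.mul_bounds hd ht i
  have : 1 + σ i * t ≠ 0 := by linarith
  field_simp; ring

theorem hasDerivAt_sqMean (h : RootData d σ) (hd : 89 ≤ d) {t : ℝ}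
    (ht : t ∈ Set.Icc (0 : ℝ) (2.72 / d ^ 2)) :
    HasDerivAt (sqMean σ) (-cubeMean σ t t) t := by
  have hi : ∀ i ∈ Finset.univ, HasDerivAt (fun t => σ i ^ 2 / (1 + σ i * t))
      (-(σ i ^ 3 / ((1 + σ i * t) * (1 + σ i * t)))) t := by
    intro i _
    obtain ⟨h1, -⟩ := h.mul_bounds hd ht i
    have h2 : 1 + σ i * t ≠ 0 := by linarith
    have : HasDerivAt (fun t => 1 + σ i * t) (σ i) t := by
      simpa using ((hasDerivAt_id t).const_mul (σ i)).const_add 1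
    refine ((hasDerivAt_const t (σ i ^ 2)).div this h2).congr_deriv ?_
    field_simp; ring
  refine ((HasDerivAt.fun_sum hi).div_const (d : ℝ)).congr_deriv ?_
  rw [cubeMean, Finset.sum_neg_distrib, neg_div]

theorem logMean_zero : logMean σ 0 = 0 := by simp [logMean]

theorem logMean_sub_bounds (h : RootData d σ) (hd : 89 ≤ d) {s t : ℝ}
    (hs : 0 ≤ s) (ht : t ≤ 2.72 / d ^ 2) (hst : s ≤ t) :
    logMean σ t ≤ logMean σ s ∧ logMean σ s - meanSq d / 2 * (t ^ 2 - s ^ 2) ≤ logMean σ t := by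
  have sub : ∀ x ∈ Set.Icc s t, x ∈ Set.Icc (0 : ℝ) (2.72 / d ^ 2) :=
    fun x hx => ⟨hs.trans hx.1, hx.2.trans ht⟩
  have hm : 0 ≤ meanSq d := le_trans (by positivity) (meanSq_bounds hd).1
  constructor
  · have := nonneg_of_hasDerivAt_nonneg (φ := fun x => logMean σ s - logMean σ x) hst
      (fun x hx => (hasDerivAt_logMean h hd (sub x hx)).const_sub _) (by simp) (fun x hx => by
        have h1 := sqMean_bounds h hd (sub x hx)
        nlinarith [mul_nonneg (sub x hx).1 (le_trans (by positivity) h1)])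
    simpa using this
  · have := nonneg_of_hasDerivAt_nonneg
      (φ := fun x => logMean σ x - logMean σ s + meanSq d / 2 * (x ^ 2 - s ^ 2)) hst
      (fun x hx => ((hasDerivAt_logMean h hd (sub x hx)).sub_const _).add
        (((hasDerivAt_pow 2 x).sub_const (s ^ 2)).const_mul (meanSq d / 2))) (by simp) (fun x hx => by
        have h1 := sqMean_le h hd (sub x hx)
        have h2 := mul_nonneg (sub x hx).1 (sub_nonneg.2 h1)
        push_cast
        linarith [pow_one x])
    linarith

/-- `t ↦ cubeMean t t / t`, as a divided difference. -/
theorem mul_cubeMean_sub (h : RootData d σ) (hd : 89 ≤ d) {x y : ℝ}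
    (hx : x ∈ Set.Icc (0 : ℝ) (2.72 / d ^ 2)) (hy : y ∈ Set.Icc (0 : ℝ) (2.72 / d ^ 2)) (hxy : x ≤ y) :
    (y - x) * (meanCube d - 0.23 * d * meanSq d) ≤ y * cubeMean σ x x - x * cubeMean σ y y ∧
    y * cubeMean σ x x - x * cubeMean σ y y ≤ (y - x) * (1.006 * meanCube d) := by
  have hd' : (89 : ℝ) ≤ d := by exact_mod_cast hd
  set k : Fin d → ℝ := fun i => (1 + 2 * (σ i * x + σ i * y) + (σ i * x) ^ 2 + (σ i * x) * (σ i * y)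
    + (σ i * y) ^ 2) / ((1 + σ i * x) ^ 2 * (1 + σ i * y) ^ 2) with hk
  have e : y * cubeMean σ x x - x * cubeMean σ y y = (y - x) * ((∑ i, σ i ^ 3 * k i) / d) := by
    rw [cubeMean, cubeMean, ← mul_div_assoc, ← mul_div_assoc, ← mul_div_assoc, ← sub_div,
      Finset.mul_sum, Finset.mul_sum, Finset.mul_sum, ← Finset.sum_sub_distrib]
    congr 1
    refine Finset.sum_congr rfl fun i _ => ?_
    obtain ⟨h1, -⟩ := h.mul_bounds hd hx i
    obtain ⟨h3, -⟩ := h.mul_bounds hd hy i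
    have h5 : 1 + σ i * x ≠ 0 := by linarith
    have h6 : 1 + σ i * y ≠ 0 := by linarith
    have e1 : y * (σ i ^ 3 / ((1 + σ i * x) * (1 + σ i * x))) - x * (σ i ^ 3 / ((1 + σ i * y) * (1 + σ i * y)))
        = σ i ^ 3 * (y * (1 + σ i * y) ^ 2 - x * (1 + σ i * x) ^ 2)
          / ((1 + σ i * x) ^ 2 * (1 + σ i * y) ^ 2) := by
      generalize 1 + σ i * x = A at *
      generalize 1 + σ i * y = B at *
      field_simp
    rw [e1, hk, ← mul_div_assoc, ← mul_div_assoc]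
    congr 1
    ring
  have hkk : ∀ i, 0 ≤ 1 - k i ∧ (0 ≤ σ i → 1 - k i ≤ 0.0527) ∧ (σ i ≤ 0 → 1 - k i ≤ 0.00764) := by
    intro i
    obtain ⟨h1, h2⟩ := h.mul_bounds hd hx i
    obtain ⟨h3, h4⟩ := h.mul_bounds hd hy i
    have huv : 0 ≤ (σ i * x) * (σ i * y) := by
      have : (σ i * x) * (σ i * y) = σ i ^ 2 * (x * y) := by ring
      rw [this]; exact mul_nonneg (sq_nonneg _) (mul_nonneg hx.1 hy.1)
    have hs1 : 0 ≤ σ i → 0 ≤ σ i * x ∧ 0 ≤ σ i * y := fun h0 => ⟨mul_nonneg h0 hx.1, mul_nonneg h0 hy.1⟩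
    have hs2 : σ i ≤ 0 → σ i * x ≤ 0 ∧ σ i * y ≤ 0 := fun h0 =>
      ⟨mul_nonpos_of_nonpos_of_nonneg h0 hx.1, mul_nonpos_of_nonpos_of_nonneg h0 hy.1⟩
    simp only [hk]
    set u := σ i * x
    set v := σ i * y
    have hu : 0 < 1 + u := by linarith
    have hv : 0 < 1 + v := by linarith
    have e1 : 1 - (1 + 2 * (u + v) + u ^ 2 + u * v + v ^ 2) / ((1 + u) ^ 2 * (1 + v) ^ 2)
        = u * v * (3 + 2 * (u + v) + u * v) / ((1 + u) ^ 2 * (1 + v) ^ 2) := by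
      field_simp; ring
    rw [e1]
    have hpos : 0 < (1 + u) ^ 2 * (1 + v) ^ 2 := by positivity
    refine ⟨div_nonneg (mul_nonneg huv (by nlinarith)) hpos.le, fun h0 => ?_, fun h0 => ?_⟩
    · obtain ⟨hu0, hv0⟩ := hs1 h0
      rw [div_le_iff₀ hpos]
      have a1 : u * v ≤ 0.01756 := by nlinarith
      have a2 : 3 + 2 * (u + v) + u * v ≤ 3 * ((1 + u) ^ 2 * (1 + v) ^ 2) := by
        have : (1 + u + v) ≤ (1 + u) * (1 + v) := by nlinarith
        have h6 : (1 + u) * (1 + v) ≤ (1 + u) ^ 2 * (1 + v) ^ 2 := by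
          have : 1 ≤ (1 + u) * (1 + v) := by nlinarith
          nlinarith
        nlinarith
      have a3 := mul_le_mul a1 a2 (by positivity) (by norm_num)
      linarith
    · obtain ⟨hu0, hv0⟩ := hs2 h0
      rw [div_le_iff₀ hpos]
      have a1 : u * v ≤ 0.00210681 := by nlinarith
      have a2 : 3 + 2 * (u + v) + u * v ≤ 3 := by nlinarith
      have a3 : 0.9102 ≤ (1 + u) ^ 2 := by nlinarith
      have a4 : 0.9102 ≤ (1 + v) ^ 2 := by nlinarith
      have a5 := mul_le_mul a3 a4 (by norm_num) (by positivity)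
      have a6 := mul_le_mul a1 a2 (by nlinarith) (by norm_num)
      linarith
  rw [e]
  have hyx := sub_nonneg.2 hxy
  constructor
  · refine mul_le_mul_of_nonneg_left ?_ hyx
    have := le_mean (a := 1) (b := -(0.23 * d)) (f := fun i => σ i ^ 3 * k i) (by omega : 0 < d) h
      fun i => by
        obtain ⟨h1, h2, h3⟩ := hkk i
        have : 0 ≤ 0.23 * d - σ i * (1 - k i) := by
          have hl := h.low i
          have hh := h.high i
          rcases le_total 0 (σ i) with h0 | h0
          · nlinarith [h2 h0]
          · nlinarith
        nlinarith [mul_nonneg (sq_nonneg (σ i)) this]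
    linarith
  · refine mul_le_mul_of_nonneg_left ?_ hyx
    have := mean_le (a := 1 - 0.00197) (b := 0.00197 * (13 / 3 * d))
      (f := fun i => σ i ^ 3 * k i) (by omega : 0 < d) h
      fun i => by
        obtain ⟨h1, h2, h3⟩ := hkk i
        have : 0 ≤ σ i * (1 - k i) + 0.00197 * (13 / 3 * d - σ i) := by
          have hl := h.low i
          have hh := h.high i
          rcases le_total 0 (σ i) with h0 | h0
          · nlinarith [mul_nonneg h0 h1]
          · nlinarith [h3 h0]
        nlinarith [mul_nonneg (sq_nonneg (σ i)) this]
    refine this.trans ?_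
    rw [meanSq, meanCube]
    have : (0 : ℝ) ≤ d * (d - 1) * (0.00797 * 3 * (d - 2) - 0.00197 * 13 / 36 * (25 * d + 1)) :=
      mul_nonneg (mul_nonneg (by positivity) (by linarith)) (by nlinarith)
    linarith only [this]

end

end Moments

section Wronskian
variable {d : ℕ} {σ : Fin d → ℝ}

/-- The geometric mean of the `1 + σ i * t`. -/
noncomputable def expMean {d : ℕ} (σ : Fin d → ℝ) (t : ℝ) : ℝ := Real.exp (logMean σ t)

theorem hasDerivAt_expMean (h : RootData d σ) (hd : 89 ≤ d) {t : ℝ}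
    (ht : t ∈ Set.Icc (0 : ℝ) (2.72 / d ^ 2)) :
    HasDerivAt (expMean σ) (2 * t * (-(sqMean σ t * expMean σ t) / 2)) t :=
  (hasDerivAt_logMean h hd ht).exp.congr_deriv (by rw [expMean]; ring)

theorem hasDerivAt_expMean_sq (h : RootData d σ) (hd : 89 ≤ d) {t : ℝ}
    (ht : t ∈ Set.Icc (0 : ℝ) (2.72 / d ^ 2)) :
    HasDerivAt (fun t => expMean σ t ^ 2) (2 * t * (-(sqMean σ t * expMean σ t ^ 2))) t :=
  ((hasDerivAt_expMean h hd ht).pow 2).congr_deriv (by push_cast; ring)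

theorem hasDerivAt_expMean_two (h : RootData d σ) (hd : 89 ≤ d) {t : ℝ}
    (ht : t ∈ Set.Icc (0 : ℝ) (2.72 / d ^ 2)) :
    HasDerivAt (fun t => -(sqMean σ t * expMean σ t) / 2)
      (expMean σ t * (cubeMean σ t t + t * sqMean σ t ^ 2) / 2) t :=
  ((((hasDerivAt_sqMean h hd ht).mul (hasDerivAt_expMean h hd ht)).neg).div_const 2).congr_deriv
    (by ring)

theorem hasDerivAt_expMean_sq_two (h : RootData d σ) (hd : 89 ≤ d) {t : ℝ}
    (ht : t ∈ Set.Icc (0 : ℝ) (2.72 / d ^ 2)) :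
    HasDerivAt (fun t => -(sqMean σ t * expMean σ t ^ 2))
      (expMean σ t ^ 2 * (cubeMean σ t t + 2 * (t * sqMean σ t ^ 2))) t :=
  (((hasDerivAt_sqMean h hd ht).mul (hasDerivAt_expMean_sq h hd ht)).neg).congr_deriv (by ring)

theorem meanSq_mul_le (hd : 89 ≤ d) : 2.72 / (d : ℝ) ^ 2 * meanSq d ≤ 5.67 := by
  have hd' : (89 : ℝ) ≤ d := by exact_mod_cast hd
  have h1 := (meanSq_bounds hd).2
  rw [div_mul_eq_mul_div, div_le_iff₀ (by positivity)]
  nlinarith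

set_option maxHeartbeats 1000000 in
theorem wronskian_bounds (h : RootData d σ) (hd : 89 ≤ d) {x y : ℝ} (hx0 : 0 ≤ x) (hxy : x ≤ y)
    (hyT : y ≤ 2.72 / d ^ 2) :
    d ^ 5 * meanSq d / 10 * (y - x)
      ≤ (expMean σ x * (cubeMean σ x x + x * sqMean σ x ^ 2) / 2)
          * (expMean σ y ^ 2 * (cubeMean σ y y + 2 * (y * sqMean σ y ^ 2)))
        - (expMean σ y * (cubeMean σ y y + y * sqMean σ y ^ 2) / 2)
          * (expMean σ x ^ 2 * (cubeMean σ x x + 2 * (x * sqMean σ x ^ 2))) ∧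
    (expMean σ x * (cubeMean σ x x + x * sqMean σ x ^ 2) / 2)
          * (expMean σ y ^ 2 * (cubeMean σ y y + 2 * (y * sqMean σ y ^ 2)))
        - (expMean σ y * (cubeMean σ y y + y * sqMean σ y ^ 2) / 2)
          * (expMean σ x ^ 2 * (cubeMean σ x x + 2 * (x * sqMean σ x ^ 2)))
      ≤ 0.503 * meanSq d ^ 2 * meanCube d * (y - x) := by
  have hd' : (89 : ℝ) ≤ d := by exact_mod_cast hd
  have hT0 : (0 : ℝ) ≤ 2.72 / d ^ 2 := by positivity
  have hx : x ∈ Set.Icc (0 : ℝ) (2.72 / d ^ 2) := ⟨hx0, hxy.trans hyT⟩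
  have hy : y ∈ Set.Icc (0 : ℝ) (2.72 / d ^ 2) := ⟨hx0.trans hxy, hyT⟩
  have h0 : (0 : ℝ) ∈ Set.Icc (0 : ℝ) (2.72 / d ^ 2) := ⟨le_rfl, hT0⟩
  have hTm := meanSq_mul_le hd
  obtain ⟨hm1, hm2⟩ := meanSq_bounds hd
  obtain ⟨hc1, hc2⟩ := meanCube_bounds hd
  have hMx1 := sqMean_bounds h hd hx
  have hMy1 := sqMean_bounds h hd hy
  have hMx2 := sqMean_le h hd hx
  have hMy2 := sqMean_le h hd hy
  have hMxy := sqMean_anti h hd hx hy hxy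
  have hMs := sqMean_sub h hd hx hy
  have hpxy := cubeMean_le h hd hx hy
  have hpx0 := cubeMean_nonneg h hd hx hx
  have hpy0 := cubeMean_nonneg h hd hy hy
  have hpx1 := cubeMean_le h hd hx hx
  have hpy1 := cubeMean_le h hd hy hy
  obtain ⟨hk1, hk2⟩ := mul_cubeMean_sub h hd hx hy hxy
  obtain ⟨he1, he2⟩ := logMean_sub_bounds h hd hx0 hyT hxy
  have he0 : expMean σ x ≤ 1 := by
    rw [expMean, Real.exp_le_one_iff, ← logMean_zero (σ := σ)]
    exact (logMean_sub_bounds h hd le_rfl hx.2 hx0).1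
  have heyx : expMean σ y ≤ expMean σ x := Real.exp_le_exp.2 he1
  set m := meanSq d
  set m' := meanCube d
  set T : ℝ := 2.72 / d ^ 2 with hT
  have hyx : 0 ≤ y - x := sub_nonneg.2 hxy
  have hm0 : 0 < m := lt_of_lt_of_le (by positivity) hm1
  have hm0' : 0 < m' := lt_of_lt_of_le (by positivity) hc1
  have hη : m / 2 * (y ^ 2 - x ^ 2) ≤ 5.67 * (y - x) := by
    have e1 := mul_le_mul_of_nonneg_left hy.2 hm0.le
    have e2 := mul_le_mul_of_nonneg_left hx.2 hm0.le
    have e3 : m / 2 * (y + x) ≤ 5.67 := by linarith only [e1, e2, hTm]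
    linarith only [mul_le_mul_of_nonneg_right e3 hyx]
  have hey : expMean σ x * (1 - m / 2 * (y ^ 2 - x ^ 2)) ≤ expMean σ y := by
    have e1 : expMean σ y = expMean σ x * Real.exp (logMean σ y - logMean σ x) := by
      rw [expMean, expMean, ← Real.exp_add]; congr 1; ring
    rw [e1]
    refine mul_le_mul_of_nonneg_left ?_ (Real.exp_pos _).le
    have := Real.add_one_le_exp (logMean σ y - logMean σ x)
    linarith
  have heylow : 1 / 2 ≤ expMean σ y := by
    have e1 := (logMean_sub_bounds h hd le_rfl hy.2 hy.1).2
    have e2 := Real.add_one_le_exp (logMean σ y)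
    rw [logMean_zero] at e1
    have e3 : m / 2 * (y ^ 2 - 0 ^ 2) ≤ 1 / 2 := by
      have e4 := mul_le_mul_of_nonneg_left hy.2 hm0.le
      have e5 : m * y ≤ 5.67 := by linarith only [e4, hTm]
      have h4 : y ≤ 0.01 := by
        refine hy.2.trans ?_
        rw [hT, div_le_iff₀ (by positivity)]; nlinarith only [hd']
      linarith only [mul_le_mul e5 h4 hy.1 (by norm_num)]
    rw [expMean]; linarith
  have hex0 : 0 < expMean σ x := Real.exp_pos _
  generalize expMean σ x = ex at *
  generalize expMean σ y = ey at *
  generalize hMxx : sqMean σ x = Mx at *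
  generalize sqMean σ y = My at *
  generalize cubeMean σ x x = px at *
  generalize cubeMean σ y y = py at *
  generalize cubeMean σ x y = pxy at *
  have hMy0 : 0 < My := lt_of_lt_of_le (by positivity) hMy1
  have hMx0 : 0 < Mx := lt_of_lt_of_le (by positivity) hMx1
  -- the difference `px * (y * My ^ 2) - py * (x * Mx ^ 2)`
  have hMM : Mx ^ 2 - My ^ 2 ≤ 2 * m * m' * (y - x) := by
    have e1 : Mx ^ 2 - My ^ 2 = (Mx + My) * ((y - x) * pxy) := by rw [← hMs]; ring
    have e2 : (y - x) * pxy ≤ (y - x) * m' := mul_le_mul_of_nonneg_left hpxy hyx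
    have e3 : 0 ≤ (y - x) * pxy := by linarith
    rw [e1]
    calc (Mx + My) * ((y - x) * pxy) ≤ (2 * m) * ((y - x) * m') :=
          mul_le_mul (by linarith) e2 e3 (by linarith)
      _ = _ := by ring
  have hMy2' : My ^ 2 ≤ m ^ 2 := pow_le_pow_left₀ hMy0.le hMy2 2
  have hMx2' : Mx ^ 2 ≤ m ^ 2 := pow_le_pow_left₀ hMx0.le hMx2 2
  have hMy3 : 0.774 * m ^ 2 ≤ My ^ 2 := by
    have := pow_le_pow_left₀ (by positivity) hMy1 2
    nlinarith only [this, sq_nonneg m]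
  have hMyx2 : My ^ 2 ≤ Mx ^ 2 := pow_le_pow_left₀ hMy0.le hMxy 2
  have hdiff_le : px * (y * My ^ 2) - py * (x * Mx ^ 2) ≤ 1.006 * m ^ 2 * m' * (y - x) := by
    have e1 : py * x * My ^ 2 ≤ py * x * Mx ^ 2 :=
      mul_le_mul_of_nonneg_left hMyx2 (mul_nonneg hpy0 hx0)
    have e2 : (y * px - x * py) * My ^ 2 ≤ (y - x) * (1.006 * m') * My ^ 2 :=
      mul_le_mul_of_nonneg_right hk2 (by positivity)
    have e3 : (y - x) * (1.006 * m') * My ^ 2 ≤ (y - x) * (1.006 * m') * m ^ 2 :=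
      mul_le_mul_of_nonneg_left hMy2' (by positivity)
    linarith
  have hd3 : m' - 0.23 * d * m ≥ 2.4 * d ^ 3 := by
    have : 0.23 * (d : ℝ) * m ≤ 0.23 * d * (25 / 12 * d ^ 2) := mul_le_mul_of_nonneg_left hm2 (by positivity)
    linarith only [this, hc1, pow_pos (by linarith : (0 : ℝ) < d) 3]
  have hTd : T * (d : ℝ) ^ 3 = 2.72 * d := by rw [hT]; field_simp
  have hdiff_ge : 3.2 * (d : ℝ) ^ 5 * m * (y - x) ≤ px * (y * My ^ 2) - py * (x * Mx ^ 2) := by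
    have e1 : px * (y * My ^ 2) - py * (x * Mx ^ 2)
        = (y * px - x * py) * My ^ 2 - x * py * (Mx ^ 2 - My ^ 2) := by ring
    have e2 : (y - x) * (2.4 * d ^ 3) ≤ y * px - x * py :=
      le_trans (mul_le_mul_of_nonneg_left hd3 hyx) hk1
    have e3 : (y - x) * (2.4 * d ^ 3) * (0.774 * m ^ 2) ≤ (y * px - x * py) * My ^ 2 :=
      mul_le_mul e2 hMy3 (by positivity) (le_trans (by positivity) e2)
    have e4 : x * py ≤ T * m' := mul_le_mul hx.2 hpy1 hpy0 hT0
    have e5 : T * m' ≤ 8.16 * d := by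
      have := mul_le_mul_of_nonneg_left hc2 hT0
      linarith
    have e6 : x * py * (Mx ^ 2 - My ^ 2) ≤ 8.16 * d * (2 * m * m' * (y - x)) :=
      mul_le_mul (e4.trans e5) hMM (by linarith) (by positivity)
    have e7 : 2 * m * m' * (y - x) ≤ 2 * m * (3 * d ^ 3) * (y - x) := by gcongr
    have e8 : 8.16 * d * (2 * m * m' * (y - x)) ≤ 8.16 * d * (2 * m * (3 * d ^ 3) * (y - x)) := by
      gcongr
    have e9 : (y - x) * (2.4 * d ^ 3) * (0.774 * (m * (2.06 * d ^ 2)))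
        ≤ (y - x) * (2.4 * d ^ 3) * (0.774 * m ^ 2) := by
      rw [pow_two m]; gcongr
    have e10 : 0 ≤ (y - x) * m * d ^ 4 * (d - 89) :=
      mul_nonneg (by positivity) (by linarith)
    have e11 : 0 ≤ (y - x) * m * d ^ 5 := by positivity
    rw [e1]
    linarith only [e3, e6, e8, e9, e10, e11]
  have hz : ∀ z M : ℝ, 0 ≤ z → z ≤ T → M ^ 2 ≤ m ^ 2 → z * M ^ 2 ≤ 0.133 * d ^ 3 := by
    intro z M hz0 hzT hM
    have e1 : z * M ^ 2 ≤ T * m ^ 2 := mul_le_mul hzT hM (by positivity) hT0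
    have e2 : T * m ^ 2 ≤ 5.67 * m := by
      rw [pow_two, ← mul_assoc]; exact mul_le_mul_of_nonneg_right hTm hm0.le
    nlinarith only [e1, e2, hm2, hd', sq_nonneg (d : ℝ)]
  have hzx := hz x Mx hx0 hx.2 hMx2'
  have hzy := hz y My hy.1 hy.2 hMy2'
  have hzx0 : 0 ≤ x * Mx ^ 2 := mul_nonneg hx0 (by positivity)
  have hzy0 : 0 ≤ y * My ^ 2 := mul_nonneg hy.1 (by positivity)
  generalize x * Mx ^ 2 = zx at *
  generalize y * My ^ 2 = zy at *
  have e0 : ∀ r : ℝ, (ex * (px + zx) / 2) * (r * ey * (py + 2 * zy))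
      - (ey * (py + zy) / 2) * (ex ^ 2 * (px + 2 * zx))
      = ex * ey / 2 * (r * ((px + zx) * (py + 2 * zy)) - ex * ((py + zy) * (px + 2 * zx))) := by
    intro r; ring
  rw [show ey ^ 2 = ey * ey by ring, e0]
  have hpos1 : 0 ≤ (px + zx) * (py + 2 * zy) := by positivity
  have hid : (px + zx) * (py + 2 * zy) - (py + zy) * (px + 2 * zx) = px * zy - py * zx := by ring
  constructor
  · have f1 : (px + zx) * (py + 2 * zy) ≤ (3.133 * d ^ 3) * (3.266 * d ^ 3) :=
      mul_le_mul (by linarith) (by linarith) (by positivity) (by positivity)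
    have f2 : m / 2 * (y ^ 2 - x ^ 2) * ((px + zx) * (py + 2 * zy))
        ≤ 5.67 * (y - x) * ((3.133 * d ^ 3) * (3.266 * d ^ 3)) :=
      mul_le_mul hη f1 hpos1 (by positivity)
    have f3 : 5.67 * (y - x) * ((3.133 * d ^ 3) * (3.266 * d ^ 3)) ≤ 1 * d ^ 5 * m * (y - x) := by
      have : 0 ≤ (y - x) * d ^ 5 * (m - 5.67 * 3.133 * 3.266 * d) := by
        refine mul_nonneg (by positivity) ?_
        nlinarith only [hm1, hd']
      linarith only [this]
    have f4 : ex * (2 * d ^ 5 * m * (y - x))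
        ≤ ey * ((px + zx) * (py + 2 * zy)) - ex * ((py + zy) * (px + 2 * zx)) := by
      have g1 := mul_le_mul_of_nonneg_right hey hpos1
      have g2 : 2 * d ^ 5 * m * (y - x) ≤ (1 - m / 2 * (y ^ 2 - x ^ 2)) * ((px + zx) * (py + 2 * zy))
          - (py + zy) * (px + 2 * zx) := by
        have : 0 ≤ d ^ 5 * m * (y - x) := by positivity
        linarith
      have g3 := mul_le_mul_of_nonneg_left g2 hex0.le
      linarith
    have f5 : 1 / 8 ≤ ex * ey / 2 * ex * 2 := by
      have : 1 / 2 ≤ ex := heylow.trans heyx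
      have := mul_le_mul this heylow (by norm_num) hex0.le
      have h8 := mul_le_mul this ‹1 / 2 ≤ ex› (by norm_num) (by positivity)
      linarith only [h8]
    have f6 := mul_le_mul_of_nonneg_left f4 (by positivity : 0 ≤ ex * ey / 2)
    have f7 := mul_le_mul_of_nonneg_right f5 (by positivity : 0 ≤ d ^ 5 * m * (y - x))
    have : 0 ≤ d ^ 5 * m * (y - x) := by positivity
    linarith
  · have g1 : ey * ((px + zx) * (py + 2 * zy)) ≤ ex * ((px + zx) * (py + 2 * zy)) :=
      mul_le_mul_of_nonneg_right heyx hpos1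
    have g2 : ey * ((px + zx) * (py + 2 * zy)) - ex * ((py + zy) * (px + 2 * zx))
        ≤ ex * (1.006 * m ^ 2 * m' * (y - x)) := by
      have := mul_le_mul_of_nonneg_left hdiff_le hex0.le
      linarith
    have hB : 0 ≤ m ^ 2 * m' * (y - x) := by positivity
    have g3 : ex * (1.006 * m ^ 2 * m' * (y - x)) ≤ 1.006 * (m ^ 2 * m' * (y - x)) := by
      have := mul_le_mul_of_nonneg_right he0 hB
      linarith
    have hey0 : 0 < ey := lt_of_lt_of_le (by norm_num) heylow
    have g4 : ex * ey / 2 ≤ 1 / 2 := by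
      have := mul_le_mul he0 (heyx.trans he0) hey0.le zero_le_one
      linarith only [this]
    calc ex * ey / 2 * (ey * ((px + zx) * (py + 2 * zy)) - ex * ((py + zy) * (px + 2 * zx)))
        ≤ ex * ey / 2 * (1.006 * (m ^ 2 * m' * (y - x))) :=
          mul_le_mul_of_nonneg_left (g2.trans g3) (by positivity)
      _ ≤ 1 / 2 * (1.006 * (m ^ 2 * m' * (y - x))) :=
          mul_le_mul_of_nonneg_right g4 (by positivity)
      _ = _ := by ring

theorem detFour_expMean_bounds (h : RootData d σ) (hd : 89 ≤ d) {t : Fin 4 → ℝ} (h0 : 0 < t 0)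
    (h1 : t 0 < t 1) (h2 : t 1 < t 2) (h3 : t 2 < t 3) (h4 : t 3 ≤ 2.72 / d ^ 2) :
    0 < detFour (fun i => t i ^ 2) (fun i => expMean σ (t i)) (fun i => expMean σ (t i) ^ 2) ∧
    detFour (fun i => t i ^ 2) (fun i => expMean σ (t i)) (fun i => expMean σ (t i) ^ 2)
      ≤ 0.503 * meanSq d ^ 2 * meanCube d / 6
        * detFour (fun i => t i ^ 2) (fun i => t i ^ 3) (fun i => t i ^ 4) := by
  have hd' : (89 : ℝ) ≤ d := by exact_mod_cast hd
  obtain ⟨b1, b2⟩ := detFour_bounds (c := d ^ 5 * meanSq d / 60)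
    (C := 0.503 * meanSq d ^ 2 * meanCube d / 6)
    (fun x hx => hasDerivAt_expMean h hd hx)
    (fun x hx => hasDerivAt_expMean_sq h hd hx) (fun x hx => hasDerivAt_expMean_two h hd hx)
    (fun x hx => hasDerivAt_expMean_sq_two h hd hx)
    (fun x y hx hxy hy => by
      obtain ⟨w1, w2⟩ := wronskian_bounds h hd hx hxy hy
      constructor
      · refine le_trans (le_of_eq ?_) w1; ring
      · refine w2.trans (le_of_eq ?_); ring) h0.le h1.le h2.le h3.le h4
  refine ⟨lt_of_lt_of_le (mul_pos ?_ ?_) b1, b2⟩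
  · have := lt_of_lt_of_le (by positivity) (meanSq_bounds hd).1
    positivity
  · rw [detFour_sq_cube_four]
    have t1 : 0 < t 1 := h0.trans h1
    have t2 : 0 < t 2 := t1.trans h2
    have t3 : 0 < t 3 := t2.trans h3
    have := sub_pos.2 h1
    have := sub_pos.2 h2
    have := sub_pos.2 h3
    have := sub_pos.2 (h1.trans h2)
    have := sub_pos.2 (h2.trans h3)
    have := sub_pos.2 (h1.trans (h2.trans h3))
    positivity

end Wronskian

section Determinant

theorem detFour_affine_first {R : Type*} [CommRing R] (a b : R) (s f g : Fin 4 → R) :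
    detFour (fun i => a + b * s i) f g = b * detFour s f g := by
  simp only [detFour, detThree]; ring

theorem detFour_affine_second {R : Type*} [CommRing R] (a b : R) (s f g : Fin 4 → R) :
    detFour s (fun i => a + b * f i) g = b * detFour s f g := by
  simp only [detFour, detThree]; ring

theorem detFour_affine_third {R : Type*} [CommRing R] (a b : R) (s f g : Fin 4 → R) :
    detFour s f (fun i => a + b * g i) = b * detFour s f g := by
  simp only [detFour, detThree]; ring

theorem detFour_add_second {R : Type*} [CommRing R] (s f g : Fin 4 → R) :
    detFour (fun i => s i + f i) f g = detFour s f g := by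
  simp only [detFour, detThree]; ring

theorem int_sq_eq_one_add (q : ℤ) (h2 : q % 2 = 1) (h3 : q % 3 ≠ 0) : ∃ u, q ^ 2 = 1 + 24 * u := by
  obtain ⟨k, rfl⟩ : ∃ k, q = 2 * k + 1 := ⟨q / 2, by omega⟩
  have h8 : (8 : ℤ) ∣ (2 * k + 1) ^ 2 - 1 := by
    obtain ⟨j, hj⟩ := (Int.even_mul_succ_self k).two_dvd
    exact ⟨j, by linear_combination 4 * hj⟩
  have h3' : (3 : ℤ) ∣ (2 * k + 1) ^ 2 - 1 := by
    rcases (by omega : (2 * k + 1) % 3 = 1 ∨ (2 * k + 1) % 3 = 2) with h | h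
    · exact (show (3 : ℤ) ∣ (2 * k + 1) - 1 by omega).trans ⟨2 * k + 2, by ring⟩
    · exact (show (3 : ℤ) ∣ (2 * k + 1) + 1 by omega).trans ⟨2 * k, by ring⟩
  have : (8 * 3 : ℤ) ∣ (2 * k + 1) ^ 2 - 1 :=
    IsCoprime.mul_dvd (by norm_num) h8 h3'
  obtain ⟨u, hu⟩ := this
  exact ⟨u, by linarith⟩

/-- Divisibility of the determinant with rows `(1, X ^ 2, q * X, q ^ 2)`. -/
theorem dvd_detFour (X q : Fin 4 → ℤ) (h2 : ∀ i, q i % 2 = 1) (h3 : ∀ i, q i % 3 ≠ 0)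
    (hX : ∀ i, X i % 2 = X 0 % 2) :
    (384 : ℤ) ∣ detFour (fun i => X i ^ 2) (fun i => q i * X i) (fun i => q i ^ 2) := by
  choose u hu using fun i => int_sq_eq_one_add (q i) (h2 i) (h3 i)
  simp only [hu]
  rw [detFour_affine_third]
  rcases Int.emod_two_eq_zero_or_one (X 0) with h0 | h0
  · have hY : ∀ i, ∃ Y, X i = 2 * Y := fun i => ⟨X i / 2, by have := hX i; omega⟩
    choose Y hY using hY
    have hk : ∀ i, ∃ k, Y i ^ 2 = 2 * k + q i * Y i := fun i => by
      obtain ⟨j, hj⟩ : ∃ j, q i = 2 * j + 1 := ⟨q i / 2, by have := h2 i; omega⟩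
      obtain ⟨l, hl⟩ := (Int.even_mul_pred_self (Y i)).two_dvd
      exact ⟨l - j * Y i, by rw [hj]; linear_combination hl⟩
    choose k hk using hk
    have e1 : (fun i => X i ^ 2) = fun i => 0 + 4 * ((0 + 2 * k i) + q i * Y i) := by
      funext i; rw [hY, zero_add, zero_add, ← hk]; ring
    have e2 : (fun i => q i * X i) = fun i => 0 + 2 * (q i * Y i) := by
      funext i; rw [hY]; ring
    rw [e1, e2, detFour_affine_first, detFour_affine_second,
      detFour_add_second (fun i => 0 + 2 * k i) (fun i => q i * Y i), detFour_affine_first]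
    exact ⟨detFour k (fun i => q i * Y i) u, by ring⟩
  · have hA : ∀ i, ∃ A, X i ^ 2 = 1 + 8 * A := fun i => by
      obtain ⟨j, hj⟩ : ∃ j, X i = 2 * j + 1 := ⟨X i / 2, by have := hX i; omega⟩
      obtain ⟨l, hl⟩ := (Int.even_mul_succ_self j).two_dvd
      exact ⟨l, by rw [hj]; linear_combination 4 * hl⟩
    choose A hA using hA
    have hC : ∀ i, ∃ C, q i * X i = 1 + 2 * C := fun i => by
      obtain ⟨j, hj⟩ : ∃ j, X i = 2 * j + 1 := ⟨X i / 2, by have := hX i; omega⟩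
      obtain ⟨l, hl⟩ : ∃ j, q i = 2 * j + 1 := ⟨q i / 2, by have := h2 i; omega⟩
      exact ⟨2 * j * l + j + l, by rw [hj, hl]; ring⟩
    choose C hC using hC
    simp only [hA, hC]
    rw [detFour_affine_first, detFour_affine_second]
    exact ⟨detFour A C u, by ring⟩

end Determinant

section Solutions

/-- `c` and `q` solve the equation `chainPoly c d = q ^ d`, in the range where `q` exceeds `d`. -/
structure LargeSol (d c q : ℕ) : Prop where
  prime : q.Prime
  lt : d < q
  eq : chainPoly c d = (q : ℤ) ^ d

theorem LargeSol.dvd {c h q L : ℕ} (hs : LargeSol (2 * h + 1) c q) (h1 : 1 ≤ h)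
    (hL : ∀ i ≤ h, 2 * h + 1 - 2 * i ∣ L * (2 * h + 1).choose i) : c + (2 * h + 1) + 1 ∣ L := by
  have hd := dvd_mul_chainPoly c h L hL
  rw [hs.eq] at hd
  have hd' : c + (2 * h + 1) + 1 ∣ L * q ^ (2 * h + 1) := by exact_mod_cast hd
  refine Nat.Coprime.dvd_of_dvd_mul_right (Nat.Coprime.pow_right _ ?_) hd'
  rw [Nat.coprime_comm, hs.prime.coprime_iff_not_dvd]
  intro hq
  exact absurd (prime_le_of_dvd h1 hs.prime hs.eq hq) (not_le.2 hs.lt)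

theorem LargeSol.odd {d c h q : ℕ} (hs : LargeSol d c q) (hdh : d = 2 * h + 1) (h1 : 1 ≤ h) :
    Odd (c + d + 1) := by
  subst hdh
  have hL : c + (2 * h + 1) + 1 ∣ ∏ i ∈ Finset.range (h + 1), (2 * h + 1 - 2 * i) :=
    hs.dvd h1 fun i hi => Dvd.dvd.mul_right (Finset.dvd_prod_of_mem (fun i => 2 * h + 1 - 2 * i)
      (Finset.mem_range.2 (by omega))) _
  refine Odd.of_dvd_nat ?_ hL
  refine Finset.prod_induction _ Odd (fun _ _ => Odd.mul) odd_one fun i hi => ?_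
  have := Finset.mem_range.1 hi
  exact ⟨h - i, by omega⟩

theorem exists_rootData {d : ℕ} (hd : 2 ≤ d) : ∃ σ : Fin d → ℝ, RootData d σ ∧
    (∀ i, -(3 * d - 1) / 2 < σ i) ∧
    ∀ c : ℕ, (d.factorial : ℝ) * chainPoly c d = ∏ i, ((c + (3 * d + 1) / 2 : ℝ) + σ i) := by
  obtain ⟨σ, h0, h1, h2, h3, h4, h5⟩ := exists_centered_roots hd
  refine ⟨σ, ⟨fun i => ?_, fun i => ?_, h3, h4, h5⟩, h1, h0⟩
  · have := h1 i; linarith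
  · have := h2 i; linarith

/-- The geometric mean of `1, …, d`. -/
noncomputable def factRoot (d : ℕ) : ℝ := (d.factorial : ℝ) ^ ((d : ℝ)⁻¹)

theorem factRoot_pow {d : ℕ} (hd : d ≠ 0) : factRoot d ^ d = d.factorial :=
  Real.rpow_inv_natCast_pow (by positivity) hd

theorem factRoot_pos (d : ℕ) : 0 < factRoot d := Real.rpow_pos_of_pos (by positivity) _

theorem le_factRoot {d : ℕ} (hd : d ≠ 0) : d / Real.exp 1 ≤ factRoot d := by
  rw [← pow_le_pow_iff_left₀ (by positivity) (factRoot_pos d).le hd, factRoot_pow hd, div_pow,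
    div_le_iff₀ (by positivity), ← Real.exp_nat_mul, mul_one]
  have := Real.pow_div_factorial_le_exp (d : ℝ) (by positivity) d
  rw [div_le_iff₀ (by positivity)] at this
  linarith

/-- The arithmetic-geometric mean inequality for the centered roots. -/
theorem factRoot_mul_le {d c q : ℕ} (hd : 2 ≤ d) (h : chainPoly c d = (q : ℤ) ^ d) :
    factRoot d * q ≤ c + (3 * d + 1) / 2 := by
  obtain ⟨σ, hσ, hlow, hprod⟩ := exists_rootData hd
  have hX : (0 : ℝ) < c + (3 * d + 1) / 2 := by positivity
  rw [← pow_le_pow_iff_left₀ (mul_nonneg (factRoot_pos d).le (by positivity)) hX.le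
    (by omega : d ≠ 0), mul_pow, factRoot_pow (by omega)]
  have h1 := hprod c
  rw [h] at h1
  push_cast at h1
  rw [h1]
  set X : ℝ := c + (3 * d + 1) / 2 with hXdef
  calc ∏ i, (X + σ i) ≤ ∏ i, X * Real.exp (σ i / X) := by
        refine Finset.prod_le_prod (fun i _ => ?_) fun i _ => ?_
        · have := hlow i
          have : (0 : ℝ) ≤ c := by positivity
          rw [hXdef]; linarith
        · have := mul_le_mul_of_nonneg_left (Real.add_one_le_exp (σ i / X)) hX.le
          rwa [mul_add, mul_div_cancel₀ _ hX.ne', mul_one, add_comm] at this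
    _ = X ^ d := by
        rw [Finset.prod_mul_distrib, ← Real.exp_sum, ← Finset.sum_div, hσ.sum_one]
        simp

theorem LargeSol.le_center {d c q : ℕ} (hs : LargeSol d c q) (hd : 2 ≤ d) :
    (d : ℝ) ^ 2 / 2.72 ≤ c + (3 * d + 1) / 2 := by
  refine le_trans ?_ (factRoot_mul_le hd hs.eq)
  have h1 : (d : ℝ) / 2.72 ≤ factRoot d := by
    refine le_trans ?_ (le_factRoot (by omega))
    gcongr
    linarith [Real.exp_one_lt_d9]
  have h2 : (d : ℝ) ≤ q := by exact_mod_cast hs.lt.le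
  calc (d : ℝ) ^ 2 / 2.72 = d / 2.72 * d := by ring
    _ ≤ factRoot d * q := mul_le_mul h1 h2 (by positivity) (factRoot_pos d).le

theorem factRoot_mul_eq {d c q : ℕ} {σ : Fin d → ℝ} (hσ : RootData d σ) (hd : 89 ≤ d)
    (hprod : ∀ c : ℕ, (d.factorial : ℝ) * chainPoly c d = ∏ i, ((c + (3 * d + 1) / 2 : ℝ) + σ i))
    (hs : LargeSol d c q) :
    factRoot d * q = (c + (3 * d + 1) / 2) * expMean σ (c + (3 * d + 1) / 2 : ℝ)⁻¹ := by
  have hd' : (89 : ℝ) ≤ d := by exact_mod_cast hd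
  have hX : (0 : ℝ) < c + (3 * d + 1) / 2 := by positivity
  have hle := hs.le_center (by omega)
  have h1 := hprod c
  rw [hs.eq] at h1
  push_cast at h1
  set X : ℝ := c + (3 * d + 1) / 2 with hXdef
  have ht : X⁻¹ ∈ Set.Icc (0 : ℝ) (2.72 / d ^ 2) := by
    refine ⟨by positivity, ?_⟩
    rw [inv_le_comm₀ hX (by positivity), inv_div]; exact hle
  have hE : 0 < expMean σ X⁻¹ := Real.exp_pos _
  rw [← pow_left_inj₀ (mul_nonneg (factRoot_pos d).le (by positivity)) (by positivity)
    (by omega : d ≠ 0), mul_pow, factRoot_pow (by omega), h1, mul_pow, expMean, ← Real.exp_nat_mul,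
    logMean, mul_div_cancel₀ _ (by positivity : (d : ℝ) ≠ 0), Real.exp_sum]
  have : X ^ d = ∏ _i : Fin d, X := by simp
  rw [this, ← Finset.prod_mul_distrib]
  refine Finset.prod_congr rfl fun i _ => ?_
  have := hσ.mul_bounds hd ht i
  rw [Real.exp_log (by linarith)]
  field_simp

theorem detFour_inv (X q : Fin 4 → ℝ) (hX : ∀ i, X i ≠ 0) (β : ℝ) :
    (∏ i, X i ^ 2) * detFour (fun i => (X i)⁻¹ ^ 2) (fun i => β * q i * (X i)⁻¹)
      (fun i => (β * q i * (X i)⁻¹) ^ 2)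
    = - (β ^ 3 * detFour (fun i => X i ^ 2) (fun i => q i * X i) (fun i => q i ^ 2)) := by
  have h0 := hX 0
  have h1 := hX 1
  have h2 := hX 2
  have h3 := hX 3
  simp only [detFour, detThree, Fin.prod_univ_four]
  field_simp
  ring

theorem detFour_inv_model (X : Fin 4 → ℝ) (hX : ∀ i, X i ≠ 0) :
    (∏ i, X i ^ 4) * detFour (fun i => (X i)⁻¹ ^ 2) (fun i => (X i)⁻¹ ^ 3) (fun i => (X i)⁻¹ ^ 4)
    = (X 0 - X 1) * (X 0 - X 2) * (X 0 - X 3) * (X 1 - X 2) * (X 1 - X 3) * (X 2 - X 3)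
      * (X 0 + X 1 + X 2 + X 3) := by
  have h0 := hX 0
  have h1 := hX 1
  have h2 := hX 2
  have h3 := hX 3
  rw [detFour_sq_cube_four, Fin.prod_univ_four]
  field_simp
  ring

/-- The repulsion inequality between four solutions. -/
theorem four_solutions_aux {d h : ℕ} (hdh : d = 2 * h + 1) (hd : 89 ≤ d) {c q : Fin 4 → ℕ}
    (hs : ∀ i, LargeSol d (c i) (q i)) (hc : StrictAnti c) {X : Fin 4 → ℝ}
    (hX : ∀ i, X i = c i + (3 * d + 1) / 2) :
    17.5 * (X 0 * X 1 * X 2 * X 3) ^ 2 ≤ (d : ℝ) ^ 4 * (X 0 + X 1 + X 2 + X 3) *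
      ((X 0 - X 1) * (X 0 - X 2) * (X 0 - X 3) * (X 1 - X 2) * (X 1 - X 3) * (X 2 - X 3)) := by
  have hdvd : (384 : ℤ) ∣ detFour (fun i => ((c i : ℤ) + 3 * h + 2) ^ 2)
      (fun i => (q i : ℤ) * ((c i : ℤ) + 3 * h + 2)) (fun i => (q i : ℤ) ^ 2) := by
    refine dvd_detFour (fun i => (c i : ℤ) + 3 * h + 2) (fun i => (q i : ℤ)) (fun i => ?_) (fun i => ?_)
      fun i => ?_
    · have := (hs i).prime.eq_two_or_odd
      have := (hs i).lt
      omega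
    · intro h3
      have h4 : 3 ∣ q i := by omega
      have := (Nat.prime_dvd_prime_iff_eq Nat.prime_three (hs i).prime).1 h4
      have := (hs i).lt
      omega
    · obtain ⟨a, ha⟩ := (hs i).odd hdh (by omega)
      obtain ⟨b, hb⟩ := (hs 0).odd hdh (by omega)
      omega
  have hodd : (d : ℝ) = 2 * h + 1 := by rw [hdh]; push_cast; ring
  have hXc : ∀ i, (((c i : ℤ) + 3 * h + 2 : ℤ) : ℝ) = X i := fun i => by
    rw [hX, hodd]; push_cast; ring
  have hsd : ∀ i, (d : ℝ) ^ 2 / 2.72 ≤ X i := fun i => by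
    rw [hX]; exact (hs i).le_center (by omega)
  obtain ⟨σ, hσ, -, hprod⟩ := exists_rootData (d := d) (by omega)
  have hr : ∀ i, factRoot d * q i = X i * expMean σ (X i)⁻¹ := fun i => by
    rw [hX]; exact factRoot_mul_eq hσ hd hprod (hs i)
  obtain ⟨hm1, hm2⟩ := meanSq_bounds hd
  obtain ⟨hc1, hc2⟩ := meanCube_bounds hd
  have hβ := le_factRoot (d := d) (by omega)
  have hd' : (89 : ℝ) ≤ d := by exact_mod_cast hd
  have hX0 : ∀ i, 0 < X i := fun i => lt_of_lt_of_le (by positivity) (hsd i)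
  have hlt : ∀ i j, i < j → X j < X i := fun i j hij => by
    rw [hX, hX]
    have : (c j : ℝ) < c i := by exact_mod_cast hc hij
    linarith
  have hlt' : ∀ i j, i < j → (X i)⁻¹ < (X j)⁻¹ := fun i j hij =>
    inv_strictAnti₀ (hX0 j) (hlt i j hij)
  obtain ⟨b1, b2⟩ := detFour_expMean_bounds hσ hd (t := fun i => (X i)⁻¹) (inv_pos.2 (hX0 0))
    (hlt' 0 1 (by decide)) (hlt' 1 2 (by decide)) (hlt' 2 3 (by decide))
    (by rw [inv_le_comm₀ (hX0 3) (by positivity), inv_div]; exact hsd 3)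
  set β := factRoot d with hβdef
  have hβ0 : 0 < β := factRoot_pos d
  have he : ∀ i, expMean σ (X i)⁻¹ = β * q i * (X i)⁻¹ := fun i => by
    rw [hr, mul_comm (X i), mul_assoc, mul_inv_cancel₀ (hX0 i).ne', mul_one]
  simp only [he] at b1 b2
  have e1 := detFour_inv X (fun i => (q i : ℝ)) (fun i => (hX0 i).ne') β
  have e2 := detFour_inv_model X fun i => (hX0 i).ne'
  have hZ : ((detFour (fun i => ((c i : ℤ) + 3 * h + 2) ^ 2)
      (fun i => (q i : ℤ) * ((c i : ℤ) + 3 * h + 2)) (fun i => (q i : ℤ) ^ 2) : ℤ) : ℝ)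
      = detFour (fun i => X i ^ 2) (fun i => (q i : ℝ) * X i) (fun i => (q i : ℝ) ^ 2) := by
    simp only [← hXc, detFour, detThree]
    push_cast
    ring
  rw [← hZ] at e1
  obtain ⟨z, hz⟩ := hdvd
  rw [hz] at e1
  set D := detFour (fun i => (X i)⁻¹ ^ 2) (fun i => β * (q i : ℝ) * (X i)⁻¹)
      (fun i => (β * (q i : ℝ) * (X i)⁻¹) ^ 2) with hD
  set D' := detFour (fun i => (X i)⁻¹ ^ 2) (fun i => (X i)⁻¹ ^ 3) (fun i => (X i)⁻¹ ^ 4) with hD'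
  have hQ : 0 < ∏ i, X i ^ 2 := Finset.prod_pos fun i _ => pow_pos (hX0 i) 2
  have hz0 : z ≤ -1 := by
    have h1 : 0 < -(β ^ 3 * ((384 * z : ℤ) : ℝ)) := by rw [← e1]; exact mul_pos hQ b1
    by_contra hcon
    have h2 : (0 : ℝ) ≤ ((384 * z : ℤ) : ℝ) := by exact_mod_cast (by omega : 0 ≤ 384 * z)
    have := mul_nonneg (pow_pos hβ0 3).le h2
    linarith
  have hz1 : (384 : ℝ) ≤ -((384 * z : ℤ) : ℝ) := by
    exact_mod_cast (by omega : (384 : ℤ) ≤ -(384 * z))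
  set V := (X 0 - X 1) * (X 0 - X 2) * (X 0 - X 3) * (X 1 - X 2) * (X 1 - X 3) * (X 2 - X 3) with hV
  set S := X 0 + X 1 + X 2 + X 3 with hS
  have hQ4 : ∏ i, X i ^ 4 = (∏ i, X i ^ 2) * ∏ i, X i ^ 2 := by
    rw [← Finset.prod_mul_distrib]; exact Finset.prod_congr rfl fun i _ => by ring
  have hQ2 : ∏ i, X i ^ 2 = (X 0 * X 1 * X 2 * X 3) ^ 2 := by
    rw [Fin.prod_univ_four]; ring
  rw [hQ4] at e2
  set Q := ∏ i, X i ^ 2 with hQdef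
  set K := 0.503 * meanSq d ^ 2 * meanCube d / 6 with hK
  have hVS : 0 ≤ V * S := by
    rw [hV, hS]
    have := sub_pos.2 (hlt 0 1 (by decide))
    have := sub_pos.2 (hlt 0 2 (by decide))
    have := sub_pos.2 (hlt 0 3 (by decide))
    have := sub_pos.2 (hlt 1 2 (by decide))
    have := sub_pos.2 (hlt 1 3 (by decide))
    have := sub_pos.2 (hlt 2 3 (by decide))
    have := hX0 0
    have := hX0 1
    have := hX0 2
    have := hX0 3
    positivity
  have m1 : 384 * β ^ 3 ≤ Q * D := by
    rw [e1]
    have := mul_le_mul_of_nonneg_left hz1 (pow_pos hβ0 3).le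
    linarith
  have m2 : Q * (Q * D) ≤ K * (V * S) := by
    rw [← e2]
    have := mul_le_mul_of_nonneg_left b2 (mul_pos hQ hQ).le
    linarith
  have m3 : Q * (384 * β ^ 3) ≤ K * (V * S) := (mul_le_mul_of_nonneg_left m1 hQ.le).trans m2
  have m4 : K ≤ 0.503 * (25 / 12 * d ^ 2) ^ 2 * (3 * d ^ 3) / 6 := by
    rw [hK]; gcongr
    · exact le_trans (by positivity) hc1
    · exact le_trans (by positivity) hm1
  have m5 : (d : ℝ) ^ 3 / 20.086 ≤ β ^ 3 := by
    have he3 : Real.exp 1 ^ 3 ≤ 20.086 := by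
      have := pow_le_pow_left₀ (Real.exp_pos 1).le Real.exp_one_lt_d9.le 3
      refine this.trans (by norm_num)
    have := pow_le_pow_left₀ (by positivity) hβ 3
    refine le_trans ?_ this
    rw [div_pow]
    gcongr
  have m6 := mul_le_mul_of_nonneg_right m4 hVS
  have m7 : Q * (384 * (d ^ 3 / 20.086)) ≤ Q * (384 * β ^ 3) := by gcongr
  have m8 : (d : ℝ) ^ 3 * (Q * (384 / 20.086)) ≤ d ^ 3 * (0.503 * (25 / 12) ^ 2 / 2 * (d ^ 4 * (V * S))) := by
    have m9 := m7.trans (m3.trans m6)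
    have e3 : Q * (384 * ((d : ℝ) ^ 3 / 20.086)) = (d : ℝ) ^ 3 * (Q * (384 / 20.086)) := by ring
    have e4 : 0.503 * (25 / 12 * (d : ℝ) ^ 2) ^ 2 * (3 * d ^ 3) / 6 * (V * S)
        = d ^ 3 * (0.503 * (25 / 12) ^ 2 / 2 * (d ^ 4 * (V * S))) := by ring
    rwa [e3, e4] at m9
  have m9 := le_of_mul_le_mul_left m8 (by positivity)
  rw [← hQ2]
  have h9 : 0 ≤ (d : ℝ) ^ 4 * (V * S) := mul_nonneg (by positivity) hVS
  have e5 : (d : ℝ) ^ 4 * S * V = d ^ 4 * (V * S) := by ring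
  rw [e5]
  generalize (d : ℝ) ^ 4 * (V * S) = Y at *
  linarith only [m9, h9]

theorem four_solutions {d h : ℕ} (hdh : d = 2 * h + 1) (hd : 89 ≤ d) {c q : Fin 4 → ℕ}
    (hs : ∀ i, LargeSol d (c i) (q i)) (hc : StrictMono c) {X : Fin 4 → ℝ}
    (hX : ∀ i, X i = c i + (3 * d + 1) / 2) :
    17.5 * (X 0 * X 1 * X 2 * X 3) ^ 2 ≤ (d : ℝ) ^ 4 * (X 0 + X 1 + X 2 + X 3) *
      ((X 1 - X 0) * (X 2 - X 0) * (X 3 - X 0) * (X 2 - X 1) * (X 3 - X 1) * (X 3 - X 2)) := by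
  have := four_solutions_aux hdh hd (c := fun i => c i.rev) (q := fun i => q i.rev)
    (fun i => hs i.rev) (fun i j hij => hc (Fin.rev_lt_rev.2 hij)) (X := fun i => X i.rev)
    (fun i => hX i.rev)
  simp only [show Fin.rev (0 : Fin 4) = 3 from rfl, show Fin.rev (1 : Fin 4) = 2 from rfl,
    show Fin.rev (2 : Fin 4) = 1 from rfl, show Fin.rev (3 : Fin 4) = 0 from rfl] at this
  linarith

end Solutions

section Gap

/-- An upper bound for the scale-invariant form of the repulsion inequality, as a function of the
square root of the ratio of the extreme points. -/
noncomputable def gapFun (m : ℝ) : ℝ :=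
  0.28622 * (m - 1) ^ 6 * (m + 1) ^ 2 * (3 + m ^ 2) / m ^ 5

theorem gapFun_lt {m n : ℝ} (hm : 1 ≤ m) (hmn : m < n) : gapFun m < gapFun n := by
  have e : ∀ x : ℝ, 0 < x → gapFun x
      = 0.28622 * (((x - 1) / x) ^ 5 * ((x - 1) * ((x + 1) ^ 2 * (3 + x ^ 2)))) := fun x hx => by
    rw [gapFun]; field_simp
  have hn : 1 < n := hm.trans_lt hmn
  rw [e m (by linarith), e n (by linarith)]
  have h1 : (m - 1) / m ≤ (n - 1) / n := by
    rw [div_le_div_iff₀ (by linarith) (by linarith)]; nlinarith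
  have h2 : 0 ≤ (m - 1) / m := div_nonneg (by linarith) (by linarith)
  have h3 : 0 < (n - 1) / n := div_pos (by linarith) (by linarith)
  have h4 : (m + 1) ^ 2 * (3 + m ^ 2) ≤ (n + 1) ^ 2 * (3 + n ^ 2) := by
    have : 0 ≤ m := by linarith
    gcongr
  have h5 : (m - 1) * ((m + 1) ^ 2 * (3 + m ^ 2)) < (n - 1) * ((n + 1) ^ 2 * (3 + n ^ 2)) :=
    mul_lt_mul (by linarith) h4 (by positivity) (by linarith)
  have h6 : ((m - 1) / m) ^ 5 ≤ ((n - 1) / n) ^ 5 := pow_le_pow_left₀ h2 h1 5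
  have h7 : 0 ≤ (m - 1) * ((m + 1) ^ 2 * (3 + m ^ 2)) := mul_nonneg (by linarith) (by positivity)
  have : ((m - 1) / m) ^ 5 * ((m - 1) * ((m + 1) ^ 2 * (3 + m ^ 2)))
      < ((n - 1) / n) ^ 5 * ((n - 1) * ((n + 1) ^ 2 * (3 + n ^ 2))) :=
    mul_lt_mul_of_le_of_lt_of_nonneg_of_pos h6 h5 h7 (pow_pos h3 5)
  linarith

theorem mul_one_sub_sq_sq_le {s : ℝ} (h0 : 0 ≤ s) (h1 : s ≤ 1) : s * (1 - s ^ 2) ^ 2 ≤ 0.28622 := by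
  have h2 : 0 ≤ 1.4 * s + 1.431 - s ^ 3 - 0.894428 * s ^ 2 := by
    have : s ^ 2 ≤ 1 := pow_le_one₀ h0 h1
    nlinarith
  nlinarith [mul_nonneg (sq_nonneg (s - 0.447214)) h2]

theorem mul_sq_sub_sq_sq_le {t S : ℝ} (h0 : 0 ≤ t) (h1 : t ≤ S) :
    t * (S ^ 2 - t ^ 2) ^ 2 ≤ 0.28622 * S ^ 5 := by
  rcases (h0.trans h1).eq_or_lt with hS | hS
  · have : t = 0 := by linarith
    rw [this, ← hS]; norm_num
  · have h := mul_one_sub_sq_sq_le (s := t / S) (by positivity) (by rwa [div_le_one hS])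
    have e : t * (S ^ 2 - t ^ 2) ^ 2 = t / S * (1 - (t / S) ^ 2) ^ 2 * S ^ 5 := by field_simp
    rw [e]
    gcongr

theorem four_points_le {y z m : ℝ} (hy : 1 ≤ y) (hyz : y ≤ z) (hz : z ≤ m) :
    (1 + y ^ 2 + z ^ 2 + m ^ 2) * ((y ^ 2 - 1) * (z ^ 2 - 1) * (m ^ 2 - 1) * (z ^ 2 - y ^ 2)
      * (m ^ 2 - y ^ 2) * (m ^ 2 - z ^ 2)) ≤ gapFun m * (y * z * m) ^ 4 := by
  have hm : 1 ≤ m := hy.trans (hyz.trans hz)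
  have hz1 : 1 ≤ z := hy.trans hyz
  have hy0 : 0 < y := by linarith
  have hz0 : 0 < z := by linarith
  have hm0 : 0 < m := by linarith
  have sq : ∀ {a b : ℝ}, 0 < a → a ≤ b → 0 ≤ b ^ 2 - a ^ 2 := fun ha hab => by nlinarith
  have hone : ∀ {b : ℝ}, 1 ≤ b → 0 ≤ b ^ 2 - 1 := fun hb => by nlinarith
  set S := m - 1 / m with hS
  set C := m + 1 / m with hC
  set t := z / y - y / z with ht
  set W := z / y + y / z with hW
  have ht0 : 0 ≤ t := by
    rw [ht, sub_nonneg, div_le_div_iff₀ hz0 hy0]; nlinarith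
  have htS : t ≤ S := by
    have h1 : z / y ≤ m := by rw [div_le_iff₀ hy0]; nlinarith
    have h2 : 1 / m ≤ y / z := by rw [div_le_div_iff₀ hm0 hz0]; nlinarith
    rw [ht, hS]; linarith
  have hW2 : 2 ≤ W := by
    have : W - 2 = (z - y) ^ 2 / (y * z) := by rw [hW]; field_simp; ring
    have h3 : 0 ≤ (z - y) ^ 2 / (y * z) := by positivity
    linarith
  have hCW : (C - W) * (C + W) = S ^ 2 - t ^ 2 := by
    rw [hC, hW, hS, ht]; field_simp; ring
  have hC0 : 0 < C := by positivity
  have hmain : S * t * (C - W) ^ 2 ≤ 0.28622 * S ^ 6 / (C + 2) ^ 2 := by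
    rw [le_div_iff₀ (by positivity)]
    have h1 : (C - W) ^ 2 * (C + 2) ^ 2 ≤ (S ^ 2 - t ^ 2) ^ 2 := by
      rw [← hCW, mul_pow]
      gcongr
    have h2 := mul_sq_sub_sq_sq_le ht0 htS
    have hS0 : 0 ≤ S := ht0.trans htS
    calc S * t * (C - W) ^ 2 * (C + 2) ^ 2 = S * t * ((C - W) ^ 2 * (C + 2) ^ 2) := by ring
      _ ≤ S * t * (S ^ 2 - t ^ 2) ^ 2 := by gcongr
      _ = S * (t * (S ^ 2 - t ^ 2) ^ 2) := by ring
      _ ≤ S * (0.28622 * S ^ 5) := by gcongr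
      _ = _ := by ring
  have h1 : (y ^ 2 - 1) * (m ^ 2 - z ^ 2) ≤ (y * m - z) ^ 2 := by nlinarith [sq_nonneg (y * z - m)]
  have h2 : (z ^ 2 - 1) * (m ^ 2 - y ^ 2) ≤ (z * m - y) ^ 2 := by nlinarith [sq_nonneg (y * z - m)]
  have h3 : (y ^ 2 - 1) * (z ^ 2 - 1) * (m ^ 2 - 1) * (z ^ 2 - y ^ 2) * (m ^ 2 - y ^ 2) * (m ^ 2 - z ^ 2)
      ≤ (y * z * m) ^ 3 * (S * t * (C - W) ^ 2) := by
    have e1 : (y * z * m) ^ 3 * (S * t * (C - W) ^ 2)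
        = (m ^ 2 - 1) * (z ^ 2 - y ^ 2) * ((y * m - z) ^ 2 * (z * m - y) ^ 2) := by
      rw [hC, hW, hS, ht]; field_simp; ring
    rw [e1]
    have h4 := mul_le_mul h1 h2 (mul_nonneg (hone hz1) (sq hy0 (hyz.trans hz))) (sq_nonneg _)
    have h5 := mul_le_mul_of_nonneg_left h4 (mul_nonneg (hone hm) (sq hy0 hyz))
    linarith
  have h4 : 1 + y ^ 2 + z ^ 2 + m ^ 2 ≤ (3 + m ^ 2) * (y * z) := by
    have a0 : m ≤ m ^ 2 := by nlinarith only [hm]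
    have a1 : 0 ≤ (z - 1) * (2 + m ^ 2 - z) := mul_nonneg (by linarith) (by linarith)
    have a3 : 0 ≤ m ^ 2 * z := by positivity
    have a2 : 0 ≤ (y - 1) * ((3 + m ^ 2) * z - y - 1) := mul_nonneg (by linarith) (by linarith)
    linarith only [a1, a2]
  have e2 : gapFun m * (y * z * m) ^ 4
      = (3 + m ^ 2) * (y * z) * ((y * z * m) ^ 3 * (0.28622 * S ^ 6 / (C + 2) ^ 2)) := by
    have e3 : C + 2 = (m + 1) ^ 2 / m := by rw [hC]; field_simp; ring
    have e4 : S = (m - 1) * (m + 1) / m := by rw [hS]; field_simp; ring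
    rw [e3, e4, gapFun]
    field_simp
  rw [e2]
  refine mul_le_mul h4 (h3.trans (mul_le_mul_of_nonneg_left hmain (by positivity))) ?_ (by positivity)
  have := hone hy
  have := hone hz1
  have := hone hm
  have := sq hy0 hyz
  have := sq hy0 (hyz.trans hz)
  have := sq hz0 hz
  positivity

/-- Four points satisfying the repulsion inequality are spread out. -/
theorem gap_of_repulsion {D X₀ X₁ X₂ X₃ m : ℝ} (hD : 0 < D) (h0 : 0 < X₀) (h01 : X₀ ≤ X₁)
    (h12 : X₁ ≤ X₂) (h23 : X₂ ≤ X₃)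
    (hrep : 17.5 * (X₀ * X₁ * X₂ * X₃) ^ 2 ≤ D * (X₀ + X₁ + X₂ + X₃) *
      ((X₁ - X₀) * (X₂ - X₀) * (X₃ - X₀) * (X₂ - X₁) * (X₃ - X₁) * (X₃ - X₂)))
    (hm : 1 ≤ m) (hF : gapFun m ≤ 17.5 * X₀ / D) : m ^ 2 * X₀ ≤ X₃ := by
  by_contra! hlt
  have hsq : ∀ x, X₀ ≤ x → ∃ y, 1 ≤ y ∧ x = X₀ * y ^ 2 := fun x hx =>
    ⟨√(x / X₀), by rw [Real.one_le_sqrt, one_le_div h0]; exact hx, by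
      rw [Real.sq_sqrt (div_nonneg (h0.le.trans hx) h0.le)]; field_simp⟩
  obtain ⟨y, hy, rfl⟩ := hsq X₁ h01
  obtain ⟨z, hz, rfl⟩ := hsq X₂ (h01.trans h12)
  obtain ⟨n, hn, rfl⟩ := hsq X₃ (h01.trans (h12.trans h23))
  have hyz : y ≤ z := by
    have := le_of_mul_le_mul_left h12 h0
    exact (pow_le_pow_iff_left₀ (by linarith) (by linarith) two_ne_zero).1 this
  have hzn : z ≤ n := by
    have := le_of_mul_le_mul_left h23 h0
    exact (pow_le_pow_iff_left₀ (by linarith) (by linarith) two_ne_zero).1 this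
  have hnm : n < m := by
    have : X₀ * n ^ 2 < X₀ * m ^ 2 := by linarith
    exact (pow_lt_pow_iff_left₀ (by linarith) (by linarith) two_ne_zero).1 (lt_of_mul_lt_mul_left this h0.le)
  have h1 := four_points_le hy hyz hzn
  have h2 := gapFun_lt hn hnm
  have h3 : X₀ ^ 7 * (17.5 * X₀ * (y * z * n) ^ 4) ≤ X₀ ^ 7 * (D * (gapFun n * (y * z * n) ^ 4)) := by
    have := mul_le_mul_of_nonneg_left h1 (by positivity : 0 ≤ X₀ ^ 7 * D)
    linarith
  have h4 := le_of_mul_le_mul_left h3 (by positivity)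
  have h5 : 17.5 * X₀ ≤ D * gapFun n := by
    have hp : 0 < (y * z * n) ^ 4 := by positivity
    refine le_of_mul_le_mul_right ?_ hp
    linarith
  have h6 : D * gapFun n < D * (17.5 * X₀ / D) := mul_lt_mul_of_pos_left (h2.trans_le hF) hD
  rw [mul_div_cancel₀ _ hD.ne'] at h6
  linarith

end Gap

section Growth

/-- A sequence growing at least as fast as the gap estimate forces on every third solution. -/
def GapSeq (v : ℕ → ℝ) (B : ℕ) : Prop :=
  ∀ j < B, ∀ m, 1 ≤ m → gapFun m ≤ v j → m ^ 2 * v j ≤ v (j + 1)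

theorem GapSeq.step {v : ℕ → ℝ} {B j : ℕ} (hv : GapSeq v B) (hj : j < B) {τ τ' : ℝ} (m : ℝ)
    (hm : 1 ≤ m) (hτ : gapFun m ≤ τ) (hτ' : τ' ≤ m ^ 2 * τ) (h : τ ≤ v j) : τ' ≤ v (j + 1) :=
  hτ'.trans ((mul_le_mul_of_nonneg_left h (sq_nonneg m)).trans (hv j hj m hm (hτ.trans h)))

theorem gapFun_cube_le (n : ℕ) :
    gapFun ((((n + 13 : ℕ) + 1 : ℝ) / (n + 13 : ℕ)) ^ 3) ≤ 3960 / ((n + 13 : ℕ) + 1 : ℝ) ^ 6 := by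
  set k : ℝ := ((n + 13 : ℕ) : ℝ) with hk
  have hk0 : 0 < k := by rw [hk]; positivity
  have e : gapFun (((k + 1) / k) ^ 3) = 0.28622 * (1 + 3 * k + 3 * k ^ 2) ^ 6
      * (1 + 3 * k + 3 * k ^ 2 + 2 * k ^ 3) ^ 2 * (3 * k ^ 6 + (k + 1) ^ 6)
      / (k ^ 15 * (k + 1) ^ 15) := by
    have e1 : ((k + 1) / k) ^ 3 - 1 = (1 + 3 * k + 3 * k ^ 2) / k ^ 3 := by field_simp; ring
    have e2 : ((k + 1) / k) ^ 3 + 1 = (1 + 3 * k + 3 * k ^ 2 + 2 * k ^ 3) / k ^ 3 := by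
      field_simp; ring
    have e3 : 3 + (((k + 1) / k) ^ 3) ^ 2 = (3 * k ^ 6 + (k + 1) ^ 6) / k ^ 6 := by field_simp
    rw [gapFun, e1, e2, e3]
    field_simp
  rw [e, div_le_div_iff₀ (by positivity) (by positivity)]
  have e4 : 3960 * (k ^ 15 * (k + 1) ^ 15) = 3960 * k ^ 15 * (k + 1) ^ 9 * (k + 1) ^ 6 := by ring
  rw [e4]
  refine mul_le_mul_of_nonneg_right ?_ (by positivity)
  rw [hk, ← sub_nonneg]
  push_cast
  ring_nf
  positivity

/-- The first stage: growth from `3960 / (n + 13) ^ 6` to `3960 / 13 ^ 6`. -/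
theorem GapSeq.first {v : ℕ → ℝ} {B : ℕ} (hv : GapSeq v B) :
    ∀ n j, j + n ≤ B → 3960 / ((n + 13 : ℕ) : ℝ) ^ 6 ≤ v j → 3960 / (13 : ℝ) ^ 6 ≤ v (j + n) := by
  intro n
  induction n with
  | zero => intro j _ h; simpa using h
  | succ n ih =>
    intro j hj h
    have h1 := ih (j + 1) (by omega) ?_
    · rwa [show j + (n + 1) = j + 1 + n by ring]
    · have e : ((n + 1 + 13 : ℕ) : ℝ) = (n + 13 : ℕ) + 1 := by push_cast; ring
      rw [e] at h
      have hp : (0 : ℝ) < (n + 13 : ℕ) := by positivity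
      refine hv.step (by omega) _ ?_ (gapFun_cube_le n) (le_of_eq ?_) h
      · refine one_le_pow₀ ?_
        rw [one_le_div hp]; linarith
      · field_simp

/-- The middle stage. -/
theorem GapSeq.middle {v : ℕ → ℝ} {B j : ℕ} (hv : GapSeq v B) (hj : j + 14 ≤ B)
    (h : 8.1e-4 ≤ v j) : 130200 ≤ v (j + 14) := by
  have h1 : 1.306e-3 ≤ v (j + 1) := hv.step (by omega) 1.27 (by norm_num) (by norm_num [gapFun]) (by norm_num) h
  have h2 : 2.193e-3 ≤ v (j + 2) := hv.step (by omega) 1.296 (by norm_num) (by norm_num [gapFun]) (by norm_num) h1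
  have h3 : 3.861e-3 ≤ v (j + 3) := hv.step (by omega) 1.327 (by norm_num) (by norm_num [gapFun]) (by norm_num) h2
  have h4 : 7.183e-3 ≤ v (j + 4) := hv.step (by omega) 1.364 (by norm_num) (by norm_num [gapFun]) (by norm_num) h3
  have h5 : 0.0143 ≤ v (j + 5) := hv.step (by omega) 1.411 (by norm_num) (by norm_num [gapFun]) (by norm_num) h4
  have h6 : 0.0309 ≤ v (j + 6) := hv.step (by omega) 1.47 (by norm_num) (by norm_num [gapFun]) (by norm_num) h5
  have h7 : 0.07414 ≤ v (j + 7) := hv.step (by omega) 1.549 (by norm_num) (by norm_num [gapFun]) (by norm_num) h6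
  have h8 : 0.203 ≤ v (j + 8) := hv.step (by omega) 1.655 (by norm_num) (by norm_num [gapFun]) (by norm_num) h7
  have h9 : 0.6628 ≤ v (j + 9) := hv.step (by omega) 1.807 (by norm_num) (by norm_num [gapFun]) (by norm_num) h8
  have h10 : 2.742 ≤ v (j + 10) := hv.step (by omega) 2.034 (by norm_num) (by norm_num [gapFun]) (by norm_num) h9
  have h11 : 15.79 ≤ v (j + 11) := hv.step (by omega) 2.4 (by norm_num) (by norm_num [gapFun]) (by norm_num) h10
  have h12 : 145.6 ≤ v (j + 12) := hv.step (by omega) 3.037 (by norm_num) (by norm_num [gapFun]) (by norm_num) h11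
  have h13 : 2655 ≤ v (j + 13) := hv.step (by omega) 4.271 (by norm_num) (by norm_num [gapFun]) (by norm_num) h12
  exact hv.step (by omega) 7.005 (by norm_num) (by norm_num [gapFun]) (by norm_num) h13

theorem gapFun_le {m : ℝ} (hm : 1 ≤ m) : gapFun m ≤ 0.28622 * m ^ 5 := by
  rw [gapFun, div_le_iff₀ (by positivity)]
  have h1 : (m - 1) ^ 2 * (m + 1) ^ 2 ≤ m ^ 4 := by
    have h2 : (m - 1) * (m + 1) ≤ m ^ 2 := by nlinarith
    have h3 : 0 ≤ (m - 1) * (m + 1) := mul_nonneg (by linarith) (by linarith)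
    calc (m - 1) ^ 2 * (m + 1) ^ 2 = ((m - 1) * (m + 1)) ^ 2 := by ring
      _ ≤ (m ^ 2) ^ 2 := pow_le_pow_left₀ h3 h2 2
      _ = _ := by ring
  have h2 : (m - 1) ^ 4 * (3 + m ^ 2) ≤ m ^ 6 := by
    obtain ⟨x, rfl⟩ : ∃ x, m = x + 1 := ⟨m - 1, by ring⟩
    have hx : 0 ≤ x := by linarith
    rw [← sub_nonneg]
    ring_nf
    positivity
  calc 0.28622 * (m - 1) ^ 6 * (m + 1) ^ 2 * (3 + m ^ 2)
      = 0.28622 * (((m - 1) ^ 2 * (m + 1) ^ 2) * ((m - 1) ^ 4 * (3 + m ^ 2))) := by ring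
    _ ≤ 0.28622 * (m ^ 4 * m ^ 6) := by gcongr
    _ = _ := by ring

/-- The last stage: the logarithm grows by a factor of `7 / 5`. -/
theorem GapSeq.last {v : ℕ → ℝ} {B : ℕ} (hv : GapSeq v B) {a : ℝ} (ha : 0 ≤ a) :
    ∀ n j, j + n ≤ B → Real.exp a ≤ 3.49 * v j → Real.exp (1.4 ^ n * a) ≤ 3.49 * v (j + n) := by
  intro n
  induction n with
  | zero => intro j _ h; simpa using h
  | succ n ih =>
    intro j hj h
    have h1 := ih j (by omega) h
    have hp : 0 ≤ 1.4 ^ n * a := by positivity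
    rw [pow_succ, mul_right_comm]
    generalize 1.4 ^ n * a = b at h1 hp
    have h2 : Real.exp b / 3.49 ≤ v (j + n) := by rw [div_le_iff₀ (by norm_num)]; linarith
    have h3 : Real.exp (b / 5) ^ 2 * (Real.exp b / 3.49) ≤ v (j + n + 1) := by
      refine hv.step (by omega) (Real.exp (b / 5)) (Real.one_le_exp (by positivity)) ?_ le_rfl h2
      refine (gapFun_le (Real.one_le_exp (by positivity))).trans ?_
      rw [← Real.exp_nat_mul, show ((5 : ℕ) : ℝ) * (b / 5) = b by push_cast; ring]
      have := Real.exp_pos b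
      rw [le_div_iff₀ (by norm_num)]; linarith
    rw [← Real.exp_nat_mul, ← mul_div_assoc, ← Real.exp_add, div_le_iff₀ (by norm_num),
      show ((2 : ℕ) : ℝ) * (b / 5) + b = b * 1.4 by push_cast; ring] at h3
    rw [← add_assoc]; linarith
theorem exp_thirteen_le : Real.exp 13 ≤ 3.49 * 130200 := by
  have := pow_le_pow_left₀ (Real.exp_pos 1).le Real.exp_one_lt_d9.le 13
  rw [← Real.exp_nat_mul] at this
  norm_num at this ⊢
  linarith

theorem GapSeq.middle_last {v : ℕ → ℝ} {B j n : ℕ} (hv : GapSeq v B) (hj : j + 14 + n ≤ B)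
    (h : 8.1e-4 ≤ v j) : Real.exp (1.4 ^ n * 13) ≤ 3.49 * v (j + 14 + n) := by
  have h1 := hv.middle (by omega) h
  refine hv.last (by norm_num) n (j + 14) hj (exp_thirteen_le.trans ?_)
  linarith

end Growth

section LargeDegree

theorem LargeSol.dvd_lcmUpto {d c h q : ℕ} (hs : LargeSol d c q) (hdh : d = 2 * h + 1) (h1 : 1 ≤ h) :
    c + d + 1 ∣ Nat.lcmUpto d := by
  subst hdh
  refine hs.dvd h1 fun i hi => Dvd.dvd.mul_right ?_ _
  exact Finset.dvd_lcm (f := id) (Finset.mem_Icc.2 ⟨by omega, by omega⟩)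

/-- More than `3 * B` solutions give rise to a sequence with `B` gaps. -/
theorem exists_gapSeq {d h : ℕ} (hdh : d = 2 * h + 1) (hd : 89 ≤ d) {S : Finset ℕ}
    (hS : ∀ c ∈ S, ∃ q, LargeSol d c q) {B : ℕ} (hB : 3 * B < S.card) :
    ∃ v : ℕ → ℝ, GapSeq v B ∧ 6.433 / (d : ℝ) ^ 2 ≤ v 0 ∧
      v B ≤ 35 * Nat.lcmUpto d / (d : ℝ) ^ 4 := by
  have hd' : (89 : ℝ) ≤ d := by exact_mod_cast hd
  set c := S.orderEmbOfFin rfl with hc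
  have hcS : ∀ i, c i ∈ S := fun i => S.orderEmbOfFin_mem rfl i
  choose q hq using fun i => hS (c i) (hcS i)
  set X : ℕ → ℝ := fun j => if hj : j < S.card then (c ⟨j, hj⟩ : ℝ) + (3 * d + 1) / 2 else 0 with hX
  have hXj : ∀ j (hj : j < S.card), X j = (c ⟨j, hj⟩ : ℝ) + (3 * d + 1) / 2 := fun j hj => by
    simp only [hX, dif_pos hj]
  have hlow : ∀ j, j < S.card → (d : ℝ) ^ 2 / 2.72 ≤ X j := fun j hj => by
    rw [hXj j hj]; exact (hq _).le_center (by omega)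
  have hmono : ∀ i j, i ≤ j → j < S.card → X i ≤ X j := fun i j hij hj => by
    rw [hXj i (by omega), hXj j hj]
    have : (c ⟨i, by omega⟩ : ℝ) ≤ c ⟨j, hj⟩ := by
      exact_mod_cast c.monotone (by simpa using hij)
    linarith
  refine ⟨fun j => 17.5 * X (3 * j) / d ^ 4, ?_, ?_, ?_⟩
  · intro j hj m hm hF
    have hlt : ∀ i : Fin 4, 3 * j + i.1 < S.card := fun i => by omega
    have hrep := four_solutions hdh hd (c := fun i : Fin 4 => c ⟨3 * j + i.1, hlt i⟩)
      (q := fun i => q ⟨3 * j + i.1, hlt i⟩) (fun i => hq _)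
      (fun i k hik => c.strictMono (by simpa using hik)) (X := fun i => X (3 * j + i.1))
      (fun i => hXj _ (hlt i))
    have h0 : 0 < X (3 * j) := lt_of_lt_of_le (by positivity) (hlow (3 * j) (by omega))
    have := gap_of_repulsion (D := (d : ℝ) ^ 4) (by positivity) h0
      (hmono (3 * j) (3 * j + 1) (by omega) (by omega))
      (hmono (3 * j + 1) (3 * j + 2) (by omega) (by omega))
      (hmono (3 * j + 2) (3 * j + 3) (by omega) (by omega)) hrep hm hF
    simp only [mul_add_one, ← mul_div_assoc]
    refine div_le_div_of_nonneg_right ?_ (by positivity)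
    linarith
  · have := hlow 0 (by omega)
    rw [div_le_iff₀ (by norm_num)] at this
    rw [div_le_div_iff₀ (by positivity) (by positivity)]
    have h2 := mul_le_mul_of_nonneg_right this (by positivity : 0 ≤ 17.5 / 2.72 * (d : ℝ) ^ 2)
    have h3 : 0 ≤ (d : ℝ) ^ 4 := by positivity
    simp only [mul_zero]
    linarith
  · have hle := Nat.le_of_dvd (Nat.lcmUpto_pos d) ((hq ⟨3 * B, hB⟩).dvd_lcmUpto hdh (by omega))
    have hle' : ((c ⟨3 * B, hB⟩ : ℕ) : ℝ) + d + 1 ≤ Nat.lcmUpto d := by exact_mod_cast hle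
    have hc0 : (0 : ℝ) ≤ (c ⟨3 * B, hB⟩ : ℕ) := by positivity
    simp only
    rw [hXj _ hB]
    refine div_le_div_of_nonneg_right ?_ (by positivity)
    linarith

/-- If there are more than `3 * (k + 14 + n)` solutions, then `lcmUpto d` is large. -/
theorem exp_le_lcmUpto {d h : ℕ} (hdh : d = 2 * h + 1) (hd : 89 ≤ d) {S : Finset ℕ}
    (hS : ∀ c ∈ S, ∃ q, LargeSol d c q) {k n : ℕ} (hcard : 3 * (k + 14 + n) < S.card)
    (hk : 3960 / ((k + 13 : ℕ) : ℝ) ^ 6 ≤ 6.433 / (d : ℝ) ^ 2 ∨ k = 0 ∧ d = 89) :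
    Real.exp (1.4 ^ n * 13) ≤ 123 * Nat.lcmUpto d / (d : ℝ) ^ 4 := by
  obtain ⟨v, hv, h0, hvB⟩ := exists_gapSeq hdh hd hS hcard
  have h1 : 8.1e-4 ≤ v k := by
    rcases hk with hk | ⟨rfl, rfl⟩
    · have := hv.first k 0 (by omega) (hk.trans h0)
      rw [zero_add] at this
      refine le_trans (by norm_num) this
    · refine le_trans ?_ h0
      norm_num
  have h2 := hv.middle_last (n := n) le_rfl h1
  refine h2.trans ?_
  have h3 : 0 ≤ (Nat.lcmUpto d : ℝ) / (d : ℝ) ^ 4 := by positivity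
  rw [mul_div_assoc] at hvB ⊢
  linarith

theorem lcmUpto_dvd_lcmUpto {m n : ℕ} (h : m ≤ n) : Nat.lcmUpto m ∣ Nat.lcmUpto n :=
  Finset.lcm_mono (Finset.Icc_subset_Icc le_rfl h)

theorem lcmUpto_ninetynine_le : Nat.lcmUpto 99 ≤ 4 ^ 99 := by decide +kernel

theorem card_le_of_le_ninetynine {d h : ℕ} (hdh : d = 2 * h + 1) (hd : 89 ≤ d) (hd2 : d ≤ 99)
    {S : Finset ℕ} (hS : ∀ c ∈ S, ∃ q, LargeSol d c q) {k : ℕ}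
    (hk : 3960 / ((k + 13 : ℕ) : ℝ) ^ 6 ≤ 6.433 / (d : ℝ) ^ 2 ∨ k = 0 ∧ d = 89) :
    S.card ≤ 3 * (k + 21) := by
  by_contra! hcon
  have h1 := exp_le_lcmUpto hdh hd hS (k := k) (n := 7) (by omega) hk
  have h2 : Nat.lcmUpto d ≤ 4 ^ 99 :=
    (Nat.le_of_dvd (Nat.lcmUpto_pos _) (lcmUpto_dvd_lcmUpto hd2)).trans lcmUpto_ninetynine_le
  have h2' : (Nat.lcmUpto d : ℝ) ≤ 4 ^ 99 := by exact_mod_cast h2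
  have hd' : (89 : ℝ) ≤ d := by exact_mod_cast hd
  have h3 : 123 * (Nat.lcmUpto d : ℝ) / (d : ℝ) ^ 4 ≤ 123 * 4 ^ 99 / 89 ^ 4 := by gcongr
  have h4 : (2.7 : ℝ) ^ 137 ≤ Real.exp (1.4 ^ 7 * 13) := by
    have h5 : (2.7 : ℝ) ≤ Real.exp 1 := by linarith [Real.exp_one_gt_d9]
    have h6 := pow_le_pow_left₀ (by norm_num) h5 137
    rw [← Real.exp_nat_mul] at h6
    refine h6.trans (Real.exp_le_exp.2 ?_)
    norm_num
  have h5 := h4.trans (h1.trans h3)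
  norm_num at h5

theorem log_lcmUpto_le {d : ℕ} (hd : 100 ≤ d) : Real.log (Nat.lcmUpto d) ≤ 2.312 * d := by
  have hd' : (100 : ℝ) ≤ d := by exact_mod_cast hd
  rw [← Chebyshev.psi_eq_log_lcmUpto]
  refine (Chebyshev.psi_le (by linarith)).trans ?_
  set s := √(d : ℝ) with hs
  have hs2 : s ^ 2 = d := Real.sq_sqrt (by positivity)
  have hs10 : 10 ≤ s := by rw [hs, Real.le_sqrt (by norm_num) (by positivity)]; linarith
  have h1 : Real.log d = 2 * Real.log s := by rw [← hs2, Real.log_pow]; norm_num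
  have h2 : Real.log s ≤ s / 10 + 1.303 := by
    have e1 : Real.log s = Real.log (s / 10) + Real.log 10 := by
      rw [← Real.log_mul (by positivity) (by norm_num)]; congr 1; ring
    have e2 := Real.log_le_sub_one_of_pos (by positivity : 0 < s / 10)
    have e3 : Real.log 10 ≤ 2.303 := by
      rw [Real.log_le_iff_le_exp (by norm_num)]
      have h5 : (2.7182818283 : ℝ) ^ 2 ≤ Real.exp 2 := by
        have := pow_le_pow_left₀ (by norm_num) Real.exp_one_gt_d9.le 2
        rw [← Real.exp_nat_mul] at this
        simpa using this
      have h6 : 1.3538 ≤ Real.exp 0.303 := by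
        have h7 := Real.sum_le_exp_of_nonneg (x := 0.303) (by norm_num) 5
        refine le_trans ?_ h7
        norm_num [Finset.sum_range_succ, Nat.factorial]
      rw [show (2.303 : ℝ) = 2 + 0.303 by norm_num, Real.exp_add]
      have := mul_le_mul h5 h6 (by norm_num) (Real.exp_pos 2).le
      refine le_trans (by norm_num) this
    linarith
  have h3 : Real.log 4 ≤ 1.3863 := by
    rw [show (4 : ℝ) = 2 ^ 2 by norm_num, Real.log_pow]
    have := Real.log_two_lt_d9
    push_cast; linarith
  rw [h1]
  have h4 : 2 * s * (2 * Real.log s) ≤ 4 * s * (s / 10 + 1.303) := by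
    have := mul_le_mul_of_nonneg_left h2 (by positivity : 0 ≤ 4 * s)
    linarith
  have h5 : Real.log 4 * d ≤ 1.3863 * d := by gcongr
  nlinarith

theorem card_le_of_ge {d h k : ℕ} (hdh : d = 2 * h + 1) (hk1 : 101 + 9 * k ≤ d)
    (hk2 : d ≤ 109 + 9 * k) {S : Finset ℕ} (hS : ∀ c ∈ S, ∃ q, LargeSol d c q) :
    S.card ≤ 3 * (24 + 2 * k) := by
  by_contra! hcon
  have hd' : (101 : ℝ) + 9 * k ≤ d := by exact_mod_cast hk1
  have hd2 : (d : ℝ) ≤ 109 + 9 * k := by exact_mod_cast hk2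
  have hk0 : (0 : ℝ) ≤ k := by positivity
  have hd0 : (0 : ℝ) < d := by linarith
  have h1 := exp_le_lcmUpto hdh (by omega) hS (k := 1 + k) (n := 9 + k) (by omega) (Or.inl (by
    have e : ((1 + k + 13 : ℕ) : ℝ) = k + 14 := by push_cast; ring
    rw [e, div_le_div_iff₀ (by positivity) (by positivity)]
    have a1 : 24.82 * d ≤ ((k : ℝ) + 14) ^ 3 := by nlinarith [pow_nonneg hk0 3, pow_nonneg hk0 2]
    have a2 := pow_le_pow_left₀ (by positivity) a1 2
    nlinarith))
  have h2 : 123 * (Nat.lcmUpto d : ℝ) / (d : ℝ) ^ 4 ≤ Nat.lcmUpto d := by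
    rw [div_le_iff₀ (by positivity)]
    have : (123 : ℝ) ≤ d ^ 4 := by
      have := pow_le_pow_left₀ (by norm_num) (show (4 : ℝ) ≤ d by linarith) 4
      linarith
    have := mul_le_mul_of_nonneg_left this (by positivity : (0 : ℝ) ≤ Nat.lcmUpto d)
    linarith
  have h3 := h1.trans h2
  rw [← Real.le_log_iff_exp_le (by exact_mod_cast Nat.lcmUpto_pos d)] at h3
  have h4 := h3.trans (log_lcmUpto_le (by omega))
  have h5 : 1 + (k : ℝ) * 0.4 ≤ 1.4 ^ k := by
    have := one_add_mul_le_pow (a := (0.4 : ℝ)) (by norm_num) k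
    norm_num at this ⊢
    exact this
  rw [pow_add] at h4
  have h6 : (20.66 : ℝ) ≤ 1.4 ^ 9 := by norm_num
  have h7 := mul_le_mul h6 h5 (by positivity) (by positivity)
  linarith

/-- The number of odd primes up to `d`. -/
def oddPrimeCount (d : ℕ) : ℕ := ((Finset.range (d + 1)).filter fun p => p.Prime ∧ p ≠ 2).card

theorem oddPrimeCount_succ_le (d : ℕ) : oddPrimeCount (d + 1) ≤ oddPrimeCount d + 1 := by
  rw [oddPrimeCount, Finset.range_add_one, Finset.filter_insert]
  split_ifs
  · exact (Finset.card_insert_le _ _)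
  · exact Nat.le_succ _

theorem oddPrimeCount_succ {d p : ℕ} (hp : p ∣ d + 1) (h1 : 1 < p) (h2 : p < d + 1) :
    oddPrimeCount (d + 1) = oddPrimeCount d := by
  rw [oddPrimeCount, Finset.range_add_one, Finset.filter_insert, if_neg]
  · rfl
  · rintro ⟨hpr, -⟩
    exact absurd ((Nat.dvd_prime hpr).1 hp) (by omega)

theorem oddPrimeCount_le (j : ℕ) : oddPrimeCount (89 + 6 * j) ≤ 23 + 2 * j ∧
    oddPrimeCount (91 + 6 * j) ≤ 24 + 2 * j ∧ oddPrimeCount (93 + 6 * j) ≤ 24 + 2 * j := by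
  have h2 : ∀ a j, oddPrimeCount (2 * a + 90 + 6 * j) = oddPrimeCount (2 * a + 89 + 6 * j) := fun a j => by
    rw [show 2 * a + 90 + 6 * j = 2 * a + 89 + 6 * j + 1 by ring]
    exact oddPrimeCount_succ (p := 2) (by omega) (by omega) (by omega)
  have h3 : ∀ j, oddPrimeCount (93 + 6 * j) = oddPrimeCount (92 + 6 * j) := fun j => by
    rw [show 93 + 6 * j = 92 + 6 * j + 1 by ring]
    exact oddPrimeCount_succ (p := 3) (by omega) (by omega) (by omega)
  have h1 : ∀ a, oddPrimeCount (a + 1) ≤ oddPrimeCount a + 1 := oddPrimeCount_succ_le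
  have key : oddPrimeCount (89 + 6 * j) ≤ 23 + 2 * j := by
    induction j with
    | zero => decide +kernel
    | succ j ih =>
      have a0 := h2 0 j
      have a1 := h1 (90 + 6 * j)
      have a2 := h2 1 j
      have a3 := h3 j
      have a4 := h2 2 j
      have a5 := h1 (94 + 6 * j)
      rw [show 89 + 6 * (j + 1) = 94 + 6 * j + 1 by ring]
      rw [show 90 + 6 * j + 1 = 91 + 6 * j by ring] at a1
      simp only [mul_zero, zero_add, Nat.reduceAdd, Nat.reduceMul] at a0 a2 a4
      omega
  have a0 := h2 0 j
  have a1 := h1 (90 + 6 * j)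
  have a2 := h2 1 j
  have a3 := h3 j
  rw [show 90 + 6 * j + 1 = 91 + 6 * j by ring] at a1
  simp only [mul_zero, zero_add, Nat.reduceAdd, Nat.reduceMul] at a0 a2
  omega

theorem card_add_oddPrimeCount_le_of_ge {d h : ℕ} (hdh : d = 2 * h + 1) (hd : 89 ≤ d)
    {S : Finset ℕ} (hS : ∀ c ∈ S, ∃ q, LargeSol d c q) : S.card + oddPrimeCount d ≤ d - 1 := by
  have hp : 3 * oddPrimeCount d ≤ d - 19 := by
    have := oddPrimeCount_le ((d - 89) / 6)
    rcases (by omega : d = 89 + 6 * ((d - 89) / 6) ∨ d = 91 + 6 * ((d - 89) / 6)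
      ∨ d = 93 + 6 * ((d - 89) / 6)) with h | h | h
    · rw [← h] at this; omega
    · rw [← h] at this; omega
    · rw [← h] at this; omega
  rcases (by omega : d = 89 ∨ 91 ≤ d ∧ d ≤ 99 ∨ 101 ≤ d) with h1 | ⟨h1, h2⟩ | h1
  · have := card_le_of_le_ninetynine hdh hd (by omega) hS (k := 0) (Or.inr ⟨rfl, h1⟩)
    omega
  · have := card_le_of_le_ninetynine hdh hd h2 hS (k := 1) (Or.inl (by
      have : (d : ℝ) ≤ 99 := by exact_mod_cast h2
      have h3 : (91 : ℝ) ≤ d := by exact_mod_cast h1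
      rw [div_le_div_iff₀ (by positivity) (by positivity)]
      push_cast
      nlinarith))
    omega
  · have := card_le_of_ge hdh (k := (d - 101) / 9) (by omega) (by omega) hS
    omega

end LargeDegree

section LowerBound

theorem exp_sub_sq_le_one_add {u : ℝ} (hu : -(1 / 2) ≤ u) : Real.exp (u - u ^ 2) ≤ 1 + u := by
  rw [← Real.le_log_iff_exp_le (by linarith)]
  rcases le_total 0 u with h0 | h0
  · have h1 := Real.one_sub_inv_le_log_of_pos (show 0 < 1 + u by linarith)
    refine le_trans ?_ h1
    have : 1 - (1 + u)⁻¹ - (u - u ^ 2) = u ^ 3 / (1 + u) := by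
      have : 1 + u ≠ 0 := by linarith
      field_simp; ring
    have h2 : 0 ≤ u ^ 3 / (1 + u) := div_nonneg (by positivity) (by linarith)
    linarith
  · have := nonneg_of_hasDerivAt_nonneg (φ := fun x : ℝ => Real.log (1 - x) + x + x ^ 2)
      (φ' := fun x => -1 / (1 - x) + 1 + 2 * x) (a := 0) (b := -u) (by linarith)
      (fun x hx => by
        have hx2 : 1 - x ≠ 0 := by linarith [hx.2]
        have h2 : HasDerivAt (fun x : ℝ => 1 - x) (-1) x := by
          simpa using (hasDerivAt_id x).const_sub 1
        refine ((h2.log hx2).add (hasDerivAt_id x) |>.add (hasDerivAt_pow 2 x)).congr_deriv ?_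
        push_cast; ring)
      (by simp) (fun x hx => by
        have hx2 : 0 < 1 - x := by linarith [hx.2]
        have e : -1 / (1 - x) + 1 + 2 * x = x * (1 - 2 * x) / (1 - x) := by
          field_simp; ring
        rw [e]
        exact div_nonneg (mul_nonneg hx.1 (by linarith [hx.2])) hx2.le)
    simp only [sub_neg_eq_add] at this
    linarith

theorem three_mul_le_factRoot {d : ℕ} (hd : 3 ≤ d) (hodd : Odd d) :
    3 * (d : ℝ) ≤ factRoot d * (d + 2 : ℕ) := by
  have key : ∀ {a : ℝ} {d : ℕ}, 0 ≤ a → d ≠ 0 → a ^ d ≤ d.factorial → a ≤ factRoot d :=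
    fun {a d} ha hd h => by
      rwa [← pow_le_pow_iff_left₀ ha (factRoot_pos d).le hd, factRoot_pow hd]
  obtain ⟨k, hk⟩ := hodd
  rcases (by omega : d = 3 ∨ d = 5 ∨ 7 ≤ d) with rfl | rfl | h
  · have := key (a := 9 / 5) (d := 3) (by norm_num) (by norm_num) (by norm_num [Nat.factorial])
    push_cast; linarith
  · have := key (a := 15 / 7) (d := 5) (by norm_num) (by norm_num) (by norm_num [Nat.factorial])
    push_cast; linarith
  · have h1 := le_factRoot (d := d) (by omega)
    have h7 : (7 : ℝ) ≤ d := by exact_mod_cast h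
    have h2 : (d : ℝ) / 3 ≤ factRoot d := by
      refine le_trans ?_ h1
      have := Real.exp_one_lt_d9
      gcongr
      linarith
    push_cast
    nlinarith

theorem LargeSol.add_two_le {d c q : ℕ} (hs : LargeSol d c q) (hd : 3 ≤ d) (hodd : Odd d) :
    d + 2 ≤ q := by
  have h1 := hs.lt
  have h2 := hs.prime.eq_two_or_odd
  obtain ⟨k, hk⟩ := hodd
  omega

theorem LargeSol.three_mul_le {d c q : ℕ} (hs : LargeSol d c q) (hd : 3 ≤ d) (hodd : Odd d) :
    3 * (d : ℝ) ≤ c + (3 * d + 1) / 2 := by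
  refine (three_mul_le_factRoot hd hodd).trans (le_trans ?_ (factRoot_mul_le (by omega) hs.eq))
  have := hs.add_two_le hd hodd
  have h0 := factRoot_pos d
  gcongr

/-- A lower bound matching `factRoot_mul_le`. -/
theorem LargeSol.sq_sub_le {d c q : ℕ} (hs : LargeSol d c q) (hd : 3 ≤ d) (hodd : Odd d) :
    (c + (3 * d + 1) / 2 : ℝ) ^ 2 - meanSq d ≤ (c + (3 * d + 1) / 2) * (factRoot d * q) := by
  have hd' : (3 : ℝ) ≤ d := by exact_mod_cast hd
  obtain ⟨σ, hσ, -, hprod⟩ := exists_rootData (d := d) (by omega)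
  have h3 := hs.three_mul_le hd hodd
  have h1 := hprod c
  rw [hs.eq] at h1
  push_cast at h1
  set X : ℝ := c + (3 * d + 1) / 2 with hXdef
  have hX : 0 < X := by linarith
  have h2 : X * Real.exp (-(meanSq d / X ^ 2)) ≤ factRoot d * q := by
    rw [← pow_le_pow_iff_left₀ (by positivity) (mul_nonneg (factRoot_pos d).le (by positivity))
      (by omega : d ≠ 0), mul_pow (factRoot d), factRoot_pow (by omega), h1]
    have e1 : (X * Real.exp (-(meanSq d / X ^ 2))) ^ d
        = ∏ i, X * Real.exp (σ i / X - (σ i / X) ^ 2) := by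
      rw [Finset.prod_mul_distrib, ← Real.exp_sum, Finset.sum_sub_distrib, ← Finset.sum_div,
        hσ.sum_one, mul_pow, ← Real.exp_nat_mul]
      simp only [div_pow]
      rw [← Finset.sum_div, hσ.sum_sq, meanSq]
      simp only [Finset.prod_const, Finset.card_univ, Fintype.card_fin]
      congr 2
      ring
    rw [e1]
    refine Finset.prod_le_prod (fun i _ => by positivity) fun i _ => ?_
    have hu : -(1 / 2) ≤ σ i / X := by
      rw [le_div_iff₀ hX]
      have := hσ.low i
      linarith
    have := mul_le_mul_of_nonneg_left (exp_sub_sq_le_one_add hu) hX.le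
    rwa [mul_add, mul_div_cancel₀ _ hX.ne', mul_one] at this
  have h4 := Real.add_one_le_exp (-(meanSq d / X ^ 2))
  have h5 : X * (X * (-(meanSq d / X ^ 2) + 1)) ≤ X * (factRoot d * q) :=
    mul_le_mul_of_nonneg_left ((mul_le_mul_of_nonneg_left h4 hX.le).trans h2) hX.le
  have e2 : X * (X * (-(meanSq d / X ^ 2) + 1)) = X ^ 2 - meanSq d := by field_simp; ring
  rwa [e2] at h5

end LowerBound

section Enumeration

/-- A necessary condition, in natural numbers, on `x` for `c + d + 1 = x` to belong to a solution.
Here `R / P` approximates the geometric mean of `1, …, d` from below. -/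
def sieveTest (a P R D m x : ℕ) : ℕ :=
  cond (Nat.ble (Nat.mul (Nat.add x a) P) D) 0
    (cond (Nat.ble (Nat.mul (Nat.add x a) (Nat.mul (Nat.add x a) P))
      (Nat.add (Nat.mul (Nat.mul (Nat.div (Nat.mul (Nat.add x a) P) R) (Nat.succ R)) (Nat.add x a)) m))
      1 0)

theorem sieveTest_eq_one {d h c q P R m : ℕ} (hdh : d = 2 * h + 1) (h1 : 1 ≤ h)
    (hs : LargeSol d c q) (hP : 0 < P) (hR0 : 0 < R) (hR : R ^ d ≤ d.factorial * P ^ d)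
    (hR' : d.factorial * P ^ d < (R + 1) ^ d) (hm : (25 * d + 1) * (d - 1) * P ≤ 12 * m) :
    sieveTest h P R (d * R) m (c + d + 1) = 1 := by
  have hd : d ≠ 0 := by omega
  have hodd : Odd d := ⟨h, hdh⟩
  have hP' : (0 : ℝ) < P := by exact_mod_cast hP
  have hβ0 := factRoot_pos d
  have b1 : (R : ℝ) ≤ factRoot d * P := by
    rw [← pow_le_pow_iff_left₀ (by positivity) (by positivity) hd, mul_pow, factRoot_pow hd]
    exact_mod_cast hR
  have b2 : factRoot d * P < R + 1 := by
    rw [← pow_lt_pow_iff_left₀ (by positivity) (by positivity) hd, mul_pow, factRoot_pow hd]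
    exact_mod_cast hR'
  have hup := factRoot_mul_le (by omega) hs.eq
  have hlow := hs.sq_sub_le (by omega) hodd
  have hq : (d : ℝ) + 1 ≤ q := by exact_mod_cast hs.lt
  obtain ⟨X, hX⟩ : ∃ X, X = c + d + 1 + h := ⟨_, rfl⟩
  have hXr : (c : ℝ) + (3 * d + 1) / 2 = X := by rw [hX, hdh]; push_cast; ring
  rw [hXr] at hup hlow
  have hR0' : (0 : ℝ) < R := by exact_mod_cast hR0
  have c1 : d * R < X * P := by
    have e1 : ((d : ℝ) + 1) * R ≤ q * (factRoot d * P) :=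
      mul_le_mul hq b1 hR0'.le (by positivity)
    have e2 : factRoot d * q * P ≤ X * P := mul_le_mul_of_nonneg_right hup hP'.le
    have : (d : ℝ) * R < X * P := by linarith
    exact_mod_cast this
  have c2 : q ≤ X * P / R := by
    rw [Nat.le_div_iff_mul_le hR0]
    have e1 : (q : ℝ) * R ≤ q * (factRoot d * P) := mul_le_mul_of_nonneg_left b1 (by positivity)
    have e2 : factRoot d * q * P ≤ X * P := mul_le_mul_of_nonneg_right hup hP'.le
    have : (q : ℝ) * R ≤ X * P := by linarith
    exact_mod_cast this
  have c3 : X * (X * P) ≤ q * (R + 1) * X + m := by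
    have e1 : meanSq d * P ≤ m := by
      have : ((25 * d + 1) * (d - 1) * P : ℝ) ≤ 12 * m := by
        have h2 : ((d - 1 : ℕ) : ℝ) = d - 1 := by
          rw [Nat.cast_sub (by omega)]; simp
        rw [← h2]; exact_mod_cast hm
      rw [meanSq]; linarith
    have e2 : X * q * (factRoot d * P) ≤ X * q * (R + 1) :=
      mul_le_mul_of_nonneg_left b2.le (by positivity)
    have e3 := mul_le_mul_of_nonneg_right hlow hP'.le
    have : (X : ℝ) * (X * P) ≤ q * (R + 1) * X + m := by linarith
    exact_mod_cast this
  have c4 : X * (X * P) ≤ X * P / R * (R + 1) * X + m := by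
    refine c3.trans ?_
    gcongr
  have t1 : Nat.ble (Nat.mul (Nat.add (c + d + 1) h) P) (d * R) = false := by
    rw [← Bool.not_eq_true, Nat.ble_eq, Nat.add_eq, ← hX, Nat.mul_eq]
    omega
  have t2 : Nat.ble (Nat.mul (Nat.add (c + d + 1) h) (Nat.mul (Nat.add (c + d + 1) h) P))
      (Nat.add (Nat.mul (Nat.mul (Nat.div (Nat.mul (Nat.add (c + d + 1) h) P) R) (Nat.succ R))
        (Nat.add (c + d + 1) h)) m) = true := by
    simp only [Nat.ble_eq, Nat.add_eq, ← hX, Nat.mul_eq, Nat.succ_eq_add_one]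
    exact c4
  rw [sieveTest, t1, t2]
  rfl

/-- The sum of `f (x * t₁ * ⋯ * tₖ)` over all choices of an element `tᵢ` of each list in `l`. -/
noncomputable def productSum (f : ℕ → ℕ) (l : List (List ℕ)) : ℕ → ℕ :=
  List.rec f (fun pw _ ih x => List.rec 0 (fun t _ s => Nat.add s (ih (Nat.mul x t))) pw) l

/-- `x` is `y` times a product of elements, one from each list in `l`. -/
def IsProductOf : List (List ℕ) → ℕ → ℕ → Prop
  | [], y, x => x = y
  | pw :: l, y, x => ∃ t ∈ pw, IsProductOf l (y * t) x

theorem card_le_productSum (f : ℕ → ℕ) (l : List (List ℕ)) : ∀ (y : ℕ) (T : Finset ℕ),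
    (∀ x ∈ T, IsProductOf l y x ∧ 1 ≤ f x) → T.card ≤ productSum f l y := by
  classical
  induction l with
  | nil =>
    intro y T hT
    have hsub : T ⊆ {y} := fun x hx => Finset.mem_singleton.2 (hT x hx).1
    rcases Finset.subset_singleton_iff.1 hsub with rfl | rfl
    · exact Nat.zero_le _
    · exact (hT y (Finset.mem_singleton_self y)).2
  | cons pw l ih =>
    intro y
    have key : ∀ (pw : List ℕ) (T : Finset ℕ),
        (∀ x ∈ T, (∃ t ∈ pw, IsProductOf l (y * t) x) ∧ 1 ≤ f x) →
        T.card ≤ List.rec 0 (fun t _ s => Nat.add s (productSum f l (Nat.mul y t))) pw := by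
      intro pw
      induction pw with
      | nil =>
        intro T hT
        rw [Finset.card_eq_zero.2]
        refine Finset.eq_empty_of_forall_notMem fun x hx => ?_
        obtain ⟨⟨t, ht, -⟩, -⟩ := hT x hx
        simp at ht
      | cons t pw ihp =>
        intro T hT
        have h1 := ihp (T.filter fun x => ¬ IsProductOf l (y * t) x) fun x hx => by
          rw [Finset.mem_filter] at hx
          obtain ⟨⟨s, hs, hs2⟩, h2⟩ := hT x hx.1
          rcases List.mem_cons.1 hs with rfl | hs
          · exact absurd hs2 hx.2
          · exact ⟨⟨s, hs, hs2⟩, h2⟩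
        have h2 := ih (y * t) (T.filter fun x => IsProductOf l (y * t) x) fun x hx => by
          rw [Finset.mem_filter] at hx
          exact ⟨hx.2, (hT x hx.1).2⟩
        have h3 := Finset.card_filter_add_card_filter_not (s := T) fun x => IsProductOf l (y * t) x
        have h4 := add_le_add h1 h2
        rw [← h3, add_comm]
        exact h4
    exact key pw

/-- Nontrivial divisors of the maximal odd prime powers up to `87`. -/
def oddPrimePowers : List (List ℕ) :=
  [[3, 9, 27, 81], [5, 25], [7, 49], [11], [13], [17], [19], [23], [29], [31], [37], [41], [43], [47],
    [53], [59], [61], [67], [71], [73], [79], [83]]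

/-- The divisors of `L` in each list of `l`, with the trivial one. -/
noncomputable def divisorLists (L : ℕ) (l : List (List ℕ)) : List (List ℕ) :=
  List.rec [] (fun pw _ s => List.rec s (fun t r _ => List.cons (List.cons 1 (List.cons t r)) s)
    (List.rec [] (fun t _ r => cond (Nat.beq (Nat.mod L t) 0) (List.cons t r) r) pw)) l

theorem mem_filterDivisors {L t : ℕ} (ht : t ∣ L) : ∀ pw : List ℕ, t ∈ pw →
    t ∈ (List.rec [] (fun t _ r => cond (Nat.beq (Nat.mod L t) 0) (List.cons t r) r) pw : List ℕ) := by
  intro pw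
  induction pw with
  | nil => intro h; exact absurd h List.not_mem_nil
  | cons s pw ih =>
    intro h
    change t ∈ cond (Nat.beq (Nat.mod L s) 0) (List.cons s _) _
    rcases List.mem_cons.1 h with rfl | h
    · have : Nat.beq (Nat.mod L t) 0 = true := Nat.beq_eq.mpr (Nat.mod_eq_zero_of_dvd ht)
      rw [this]
      exact List.mem_cons_self
    · cases Nat.beq (Nat.mod L s) 0
      · exact ih h
      · exact List.mem_cons_of_mem _ (ih h)

theorem isProductOf_divisorLists {L : ℕ} : ∀ l : List (List ℕ),
    (∀ pw ∈ l, ∀ t, t ∣ pw.getLastD 1 → t = 1 ∨ t ∈ pw) →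
    ∀ y z, z ∣ (l.map fun pw => pw.getLastD 1).prod → z ∣ L →
      IsProductOf (divisorLists L l) y (y * z) := by
  intro l
  induction l with
  | nil =>
    intro _ y z hz _
    simp only [List.map_nil, List.prod_nil, Nat.dvd_one] at hz
    rw [hz, mul_one]
    rfl
  | cons pw l ih =>
    intro hl y z hz hzL
    rw [List.map_cons, List.prod_cons] at hz
    obtain ⟨t, z', ht, hz', rfl⟩ := exists_dvd_and_dvd_of_dvd_mul hz
    have ih' := ih (fun pw h => hl pw (List.mem_cons_of_mem _ h))
    have htL : t ∣ L := (Dvd.intro _ rfl).trans hzL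
    have hzL' : z' ∣ L := (Dvd.intro_left _ rfl).trans hzL
    have hmem : t = 1 ∨ t ∈ (List.rec [] (fun t _ r => cond (Nat.beq (Nat.mod L t) 0)
        (List.cons t r) r) pw : List ℕ) :=
      (hl pw List.mem_cons_self t ht).imp_right fun h => mem_filterDivisors htL pw h
    change IsProductOf (List.rec (divisorLists L l)
      (fun t r _ => List.cons (List.cons 1 (List.cons t r)) (divisorLists L l))
      (List.rec [] (fun t _ r => cond (Nat.beq (Nat.mod L t) 0) (List.cons t r) r) pw : List ℕ)) _ _
    revert hmem
    generalize (List.rec [] (fun t _ r => cond (Nat.beq (Nat.mod L t) 0)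
        (List.cons t r) r) pw : List ℕ) = r
    intro hmem
    cases r with
    | nil =>
      rcases hmem with rfl | h
      · rw [one_mul]; exact ih' y z' hz' hzL'
      · exact absurd h List.not_mem_nil
    | cons s r =>
      refine ⟨t, ?_, ?_⟩
      · rcases hmem with rfl | h
        · exact List.mem_cons_self
        · exact List.mem_cons_of_mem _ h
      · rw [← mul_assoc]; exact ih' (y * t) z' hz' hzL'

/-- A common multiple of the denominators of `choose d i / (d - 2 * i)` for `i < n`. -/
noncomputable def denomLcm (d n : ℕ) : ℕ :=
  Nat.rec 1 (fun i r => Nat.lcm r (Nat.div (Nat.sub d (Nat.mul 2 i))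
    (Nat.gcd (Nat.sub d (Nat.mul 2 i)) (Nat.div d.factorial (Nat.mul i.factorial (Nat.sub d i).factorial))))) n

theorem dvd_denomLcm_mul_choose {d i : ℕ} (hi : 2 * i < d) : ∀ n, i < n →
    d - 2 * i ∣ denomLcm d n * d.choose i := by
  intro n
  induction n with
  | zero => intro h; exact absurd h (Nat.not_lt_zero _)
  | succ n ih =>
    intro hn
    have e : denomLcm d (n + 1) = Nat.lcm (denomLcm d n) ((d - 2 * n) / Nat.gcd (d - 2 * n)
        (d.factorial / (n.factorial * (d - n).factorial))) := rfl
    rcases (by omega : i < n ∨ i = n) with h | rfl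
    · refine (ih h).trans (mul_dvd_mul_right ?_ _)
      rw [e]; exact Nat.dvd_lcm_left _ _
    · rw [← Nat.choose_eq_factorial_div_factorial (by omega)] at e
      have h1 : (d - 2 * i) / Nat.gcd (d - 2 * i) (d.choose i) ∣ denomLcm d (i + 1) := by
        rw [e]; exact Nat.dvd_lcm_right _ _
      have h2 := mul_dvd_mul h1 (Nat.gcd_dvd_right (d - 2 * i) (d.choose i))
      rwa [Nat.div_mul_cancel (Nat.gcd_dvd_left _ _)] at h2

/-- The integer part of `2 ^ j / 128` times the geometric mean of `1, …, d`. -/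
noncomputable def rootApprox (d j : ℕ) : ℕ :=
  Nat.rec 0 (fun k r => cond (Nat.ble (Nat.pow (Nat.mul 128 (Nat.succ (Nat.mul 2 r))) d)
    (Nat.mul d.factorial (Nat.pow (Nat.pow 2 (Nat.succ k)) d))) (Nat.succ (Nat.mul 2 r)) (Nat.mul 2 r)) j

theorem rootApprox_spec {d : ℕ} (hd : 1 ≤ d) (hd2 : d < 128) (j : ℕ) :
    (128 * rootApprox d j) ^ d ≤ d.factorial * (2 ^ j) ^ d ∧
    d.factorial * (2 ^ j) ^ d < (128 * (rootApprox d j + 1)) ^ d := by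
  induction j with
  | zero =>
    have e : rootApprox d 0 = 0 := rfl
    rw [e]
    refine ⟨by simp [Nat.ne_of_gt hd], ?_⟩
    have := d.factorial_le_pow
    have h2 := Nat.pow_lt_pow_left hd2 (Nat.ne_of_gt hd)
    simpa using this.trans_lt h2
  | succ j ih =>
    have e : rootApprox d (j + 1) = if (128 * (2 * rootApprox d j + 1)) ^ d
        ≤ d.factorial * (2 ^ (j + 1)) ^ d then 2 * rootApprox d j + 1 else 2 * rootApprox d j := by
      change cond (Nat.ble ((128 * (2 * rootApprox d j + 1)) ^ d)
        (d.factorial * (2 ^ (j + 1)) ^ d)) (2 * rootApprox d j + 1) (2 * rootApprox d j) = _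
      split_ifs with h
      · rw [Nat.ble_eq.mpr h]; rfl
      · rw [Bool.eq_false_iff.2 fun h' => h (Nat.ble_eq.mp h')]; rfl
    have e2 : d.factorial * (2 ^ (j + 1)) ^ d = 2 ^ d * (d.factorial * (2 ^ j) ^ d) := by
      rw [pow_succ, mul_pow]; ring
    have h1 : (128 * (2 * rootApprox d j)) ^ d ≤ d.factorial * (2 ^ (j + 1)) ^ d := by
      rw [e2, show 128 * (2 * rootApprox d j) = 2 * (128 * rootApprox d j) by ring, mul_pow]
      exact Nat.mul_le_mul_left _ ih.1
    have h2 : d.factorial * (2 ^ (j + 1)) ^ d < (128 * (2 * rootApprox d j + 1 + 1)) ^ d := by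
      rw [e2, show 128 * (2 * rootApprox d j + 1 + 1) = 2 * (128 * (rootApprox d j + 1)) by ring, mul_pow 2]
      exact Nat.mul_lt_mul_of_pos_left ih.2 (by positivity)
    rw [e]
    split_ifs with h
    · exact ⟨h, h2⟩
    · exact ⟨h1, not_le.1 h⟩

theorem rootApprox_add_seven {d : ℕ} (hd : 1 ≤ d) (hd2 : d < 128) (j : ℕ) :
    0 < rootApprox d (j + 7) ∧ rootApprox d (j + 7) ^ d ≤ d.factorial * (2 ^ j) ^ d ∧
    d.factorial * (2 ^ j) ^ d < (rootApprox d (j + 7) + 1) ^ d := by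
  obtain ⟨h1, h2⟩ := rootApprox_spec hd hd2 (j + 7)
  have e : d.factorial * (2 ^ (j + 7)) ^ d = 128 ^ d * (d.factorial * (2 ^ j) ^ d) := by
    rw [pow_add, mul_pow]; norm_num; ring
  rw [e, mul_pow] at h1 h2
  have h1' := Nat.le_of_mul_le_mul_left h1 (by positivity)
  have h2' := Nat.lt_of_mul_lt_mul_left h2
  refine ⟨Nat.pos_of_ne_zero fun h0 => ?_, h1', h2'⟩
  rw [h0, zero_add, one_pow, Nat.lt_one_iff] at h2'
  have : 0 < d.factorial * (2 ^ j) ^ d := by positivity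
  omega

/-- Evaluate `n` before passing it to `f`. -/
noncomputable def forceNat (n : ℕ) (f : ℕ → ℕ) : ℕ := Nat.rec (f 0) (fun k _ => f (Nat.succ k)) n

theorem forceNat_eq (n : ℕ) (f : ℕ → ℕ) : forceNat n f = f n := by cases n <;> rfl

/-- The number of `x` in the enumeration that pass the sieve, for the exponent `d = 2 * h + 1`. -/
noncomputable def sieveCount (d h : ℕ) : ℕ :=
  forceNat (rootApprox d 263) fun R => forceNat (denomLcm d (Nat.succ h)) fun L =>
    productSum (sieveTest h (Nat.pow 2 256) R (Nat.mul d R)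
      (Nat.mul (Nat.div (Nat.add (Nat.mul (Nat.add (Nat.mul 25 d) 1) (Nat.sub d 1)) 11) 12) (Nat.pow 2 256)))
      (divisorLists L oddPrimePowers) 1

theorem divisors_oddPrimePowers :
    ∀ pw ∈ oddPrimePowers, ∀ t, t ∣ pw.getLastD 1 → t = 1 ∨ t ∈ pw := by
  have h : ∀ pw ∈ oddPrimePowers, 0 < pw.getLastD 1 ∧
      ∀ t ∈ List.range (pw.getLastD 1 + 1), t ∣ pw.getLastD 1 → t = 1 ∨ t ∈ pw := by
    decide +kernel
  intro pw hpw t ht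
  obtain ⟨h1, h2⟩ := h pw hpw
  exact h2 t (List.mem_range.2 (Nat.lt_succ_of_le (Nat.le_of_dvd h1 ht))) ht

theorem card_le_sieveCount {d h : ℕ} (hdh : d = 2 * h + 1) (h1 : 1 ≤ h) (hd : d < 128)
    (hL : denomLcm d (h + 1) ∣ (oddPrimePowers.map fun pw => pw.getLastD 1).prod)
    {S : Finset ℕ} (hS : ∀ c ∈ S, ∃ q, LargeSol d c q) : S.card ≤ sieveCount d h := by
  rw [sieveCount, forceNat_eq, forceNat_eq]
  have hcard : S.card = (S.image fun c => c + d + 1).card :=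
    (Finset.card_image_of_injective _ fun a b hab => by simpa using hab).symm
  rw [hcard]
  refine card_le_productSum _ _ _ _ fun x hx => ?_
  obtain ⟨c, hc, rfl⟩ := Finset.mem_image.1 hx
  obtain ⟨q, hq⟩ := hS c hc
  obtain ⟨r0, r1, r2⟩ := rootApprox_add_seven (d := d) (by omega) hd 256
  constructor
  · have hdvd : c + d + 1 ∣ denomLcm d (h + 1) := by
      have h2 := hdh
      subst h2
      exact hq.dvd h1 fun i hi => dvd_denomLcm_mul_choose (by omega) _ (by omega)
    have := isProductOf_divisorLists (L := denomLcm d (h + 1)) oddPrimePowers divisors_oddPrimePowers 1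
      (c + d + 1) (hdvd.trans hL) hdvd
    rwa [one_mul] at this
  · refine (sieveTest_eq_one hdh h1 hq (P := 2 ^ 256) (by positivity) r0 r1 r2 ?_).ge
    have := Nat.div_add_mod ((25 * d + 1) * (d - 1) + 11) 12
    have h3 := Nat.mod_lt ((25 * d + 1) * (d - 1) + 11) (show 12 > 0 by norm_num)
    have h4 : (25 * d + 1) * (d - 1) ≤ 12 * (((25 * d + 1) * (d - 1) + 11) / 12) := by omega
    have h5 := Nat.mul_le_mul_right (2 ^ 256) h4
    rw [mul_assoc 12] at h5
    exact h5

end Enumeration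

section SmallDegree

theorem denomLcm_dvd : ∀ h < 44, denomLcm (2 * h + 1) (h + 1) ∣
    (oddPrimePowers.map fun pw => pw.getLastD 1).prod := by
  decide +kernel

theorem sieveCount_le_of_lt_thirtysix : ∀ h < 36, 1 ≤ h →
    sieveCount (2 * h + 1) h + oddPrimeCount (2 * h + 1) ≤ 2 * h := by
  decide +kernel

theorem sieveCount_le_of_le_thirtynine : ∀ i < 4,
    sieveCount (2 * (i + 36) + 1) (i + 36) + oddPrimeCount (2 * (i + 36) + 1) ≤ 2 * (i + 36) := by
  decide +kernel

theorem sieveCount_le_of_le_fortyone : ∀ i < 2,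
    sieveCount (2 * (i + 40) + 1) (i + 40) + oddPrimeCount (2 * (i + 40) + 1) ≤ 2 * (i + 40) := by
  decide +kernel

theorem sieveCount_le_of_le_fortythree : ∀ i < 2,
    sieveCount (2 * (i + 42) + 1) (i + 42) + oddPrimeCount (2 * (i + 42) + 1) ≤ 2 * (i + 42) := by
  decide +kernel

theorem card_add_oddPrimeCount_le_of_le {d h : ℕ} (hdh : d = 2 * h + 1) (h1 : 1 ≤ h) (hd : d ≤ 87)
    {S : Finset ℕ} (hS : ∀ c ∈ S, ∃ q, LargeSol d c q) : S.card + oddPrimeCount d ≤ d - 1 := by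
  have hL := denomLcm_dvd h (by omega)
  rw [← hdh] at hL
  have hc := card_le_sieveCount hdh h1 (by omega) hL hS
  suffices h3 : sieveCount (2 * h + 1) h + oddPrimeCount (2 * h + 1) ≤ 2 * h by
    rw [← hdh] at h3; omega
  rcases (by omega : h < 36 ∨ (36 ≤ h ∧ h < 40) ∨ (40 ≤ h ∧ h < 42) ∨ 42 ≤ h) with h2 | h2 | h2 | h2
  · exact sieveCount_le_of_lt_thirtysix h h2 h1
  · obtain ⟨i, rfl⟩ : ∃ i, h = i + 36 := ⟨h - 36, by omega⟩
    exact sieveCount_le_of_le_thirtynine i (by omega)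
  · obtain ⟨i, rfl⟩ : ∃ i, h = i + 40 := ⟨h - 40, by omega⟩
    exact sieveCount_le_of_le_fortyone i (by omega)
  · obtain ⟨i, rfl⟩ : ∃ i, h = i + 42 := ⟨h - 42, by omega⟩
    exact sieveCount_le_of_le_fortythree i (by omega)

end SmallDegree

theorem card_add_oddPrimeCount_le {d : ℕ} (hodd : Odd d) (hd : 1 < d)
    {S : Finset ℕ} (hS : ∀ c ∈ S, ∃ q, LargeSol d c q) : S.card + oddPrimeCount d ≤ d - 1 := by
  obtain ⟨h, hdh⟩ := hodd
  rcases le_or_gt d 87 with h1 | h1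
  · exact card_add_oddPrimeCount_le_of_le hdh (by omega) h1 hS
  · exact card_add_oddPrimeCount_le_of_ge hdh (by omega) hS

theorem chainPoly_eq_of_isPristine {c q d : ℕ} (hq : q.Prime) (hq2 : q ≠ 2)
    (h : IsPristine (2 ^ c * q ^ d)) : chainPoly c d = (q : ℤ) ^ d := by
  have h1 := numRecDivisors_two_primes Nat.prime_two hq hq2.symm c d
  rw [h.2] at h1
  push_cast at h1
  exact (mul_left_cancel₀ (by positivity) h1).symm

theorem theorem6 (d : ℕ) (hd_odd : Odd d) (hd_one : 1 < d) :
    {n : ℕ | IsPristine n ∧ ∃ c q : ℕ, q.Prime ∧ q ≠ 2 ∧ n = 2 ^ c * q ^ d}.encard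
      ≤ ((d - 1 : ℕ) : ℕ∞) := by
  classical
  set A := {n : ℕ | IsPristine n ∧ ∃ c q : ℕ, q.Prime ∧ q ≠ 2 ∧ n = 2 ^ c * q ^ d} with hA
  have hsol : ∀ n : ℕ, ∃ c q : ℕ, n ∈ A →
      q.Prime ∧ q ≠ 2 ∧ n = 2 ^ c * q ^ d ∧ chainPoly c d = (q : ℤ) ^ d := by
    intro n
    by_cases hn : n ∈ A
    · obtain ⟨hp, c, q, hq, hq2, rfl⟩ := hn
      exact ⟨c, q, fun _ => ⟨hq, hq2, rfl, chainPoly_eq_of_isPristine hq hq2 hp⟩⟩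
    · exact ⟨0, 0, fun h => absurd h hn⟩
  choose c q hcq using hsol
  have key : ∀ T : Finset ℕ, (T : Set ℕ) ⊆ A → T.card ≤ d - 1 := by
    intro T hT
    have hT' : ∀ n ∈ T, n ∈ A := fun n hn => hT hn
    have h1 : (T.filter fun n => q n ≤ d).card ≤ oddPrimeCount d := by
      refine Finset.card_le_card_of_injOn q (fun n hn => ?_) fun m hm n hn hmn => ?_
      · obtain ⟨hnT, hle⟩ := Finset.mem_filter.1 hn
        obtain ⟨a1, a2, -⟩ := hcq n (hT' n hnT)
        exact Finset.mem_filter.2 ⟨Finset.mem_range.2 (by omega), a1, a2⟩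
      · obtain ⟨-, -, a3, a4⟩ := hcq m (hT' m (Finset.mem_filter.1 hm).1)
        obtain ⟨-, -, b3, b4⟩ := hcq n (hT' n (Finset.mem_filter.1 hn).1)
        rw [hmn, ← b4] at a4
        rw [a3, b3, hmn, (chainPoly_strictMono hd_one.le).injective a4]
    set U := T.filter fun n => ¬ q n ≤ d with hU
    have h2 : (U.image c).card + oddPrimeCount d ≤ d - 1 := by
      refine card_add_oddPrimeCount_le hd_odd hd_one fun a ha => ?_
      obtain ⟨n, hn, rfl⟩ := Finset.mem_image.1 ha
      obtain ⟨hnT, hlt⟩ := Finset.mem_filter.1 hn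
      obtain ⟨a1, -, -, a4⟩ := hcq n (hT' n hnT)
      exact ⟨q n, a1, not_le.1 hlt, a4⟩
    have h3 : (U.image c).card = U.card := by
      refine Finset.card_image_of_injOn fun m hm n hn hmn => ?_
      obtain ⟨-, -, a3, a4⟩ := hcq m (hT' m (Finset.mem_filter.1 hm).1)
      obtain ⟨-, -, b3, b4⟩ := hcq n (hT' n (Finset.mem_filter.1 hn).1)
      rw [hmn, b4] at a4
      have h5 : q n ^ d = q m ^ d := by exact_mod_cast a4
      rw [a3, b3, hmn, h5]
    have h4 := Finset.card_filter_add_card_filter_not (s := T) fun n => q n ≤ d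
    rw [← hU] at h4
    omega
  by_contra! hlt
  obtain ⟨T, hTA, hT⟩ := Set.exists_subset_encard_eq (Order.add_one_le_of_lt hlt)
  have hfin : T.Finite := Set.finite_of_encard_eq_coe (k := d - 1 + 1) (by rw [hT]; push_cast; rfl)
  have h1 := key hfin.toFinset (by simpa using hTA)
  rw [hfin.encard_eq_coe_toFinset_card] at hT
  have h2 : hfin.toFinset.card = d - 1 + 1 := by exact_mod_cast hT
  omega
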